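/- All graphs are finite and simple. The problem \textsc{Light Connecting Induced Subgraph} has as input a graph $G$, a set of terminals $K\subseteq V(G)$ and two integers $\ell,f$, and asks whether there is a set $S$ with $K\subseteq S\subseteq V(G)$ and $|S|=\ell+|K|$ such that $G[S]$ is connected and has at most $f$ edges. The problem \textsc{$k$-in-a-tree} has as input a graph $G$ and a set of terminals $K\subseteq V(G)$, and asks whether there is a set $S$ with $K\subseteq S\subseteq V(G)$ such that $G[S]$ is a tree. A tree decomposition of $G$ is a tree $T$ with bags $B_x\subseteq V(G)$ ($x\in V(T)$) such that every vertex of $G$ lies in a bag, both ends of every edge of $G$ lie in a common bag, and $B_x\cap B_y\subseteq B_q$ whenever $q$ lies on the path between $x$ and $y$ in $T$. It has width at most $t$ if no bag has more than $t+1$ vertices. It is nice if $T$ is rooted at a node with an empty bag and every node $x$ is of one of four types: a leaf with $B_x=\emptyset$; an introduce node, with one child $y$ and $B_x=B_y\cup\{u\}$ for some $u\notin B_y$; a forget node (for $u$), with one child $y$ and $B_y=B_x\cup\{u\}$ for some $u\notin B_x$; a join node, with two children $y,z$ and $B_x=B_y=B_z$. Theorem. There are an algorithm and a constant $C$ such that,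 given an instance $(G,K,\ell,f)$ of \textsc{Light Connecting Induced Subgraph}, where $G$ has $n$ vertices, and a nice tree decomposition of $G$ with $N$ nodes and of width at most $t$ that is rooted at the forget node of some terminal $r\in K$, the algorithm decides the instance in at most $C\cdot 2^{Ct}\cdot n^{C}\cdot N$ steps. Hence the running time is $2^{O(t)}n^{O(1)}$ for nice tree decompositions with $n^{O(1)}$ nodes. Corollary. There are an algorithm and a constant $C$ such that, given an instance $(G,K)$ of \textsc{$k$-in-a-tree} and a nice tree decomposition of $G$ as above, the algorithm decides the instance in at most $C\cdot 2^{Ct}\cdot n^{C}\cdot N$ steps. Algorithms are programs of a pointer machine: a fixed number of variables hold pointers to binary trees, and clearing or copying a variable, forming a pair, following a left or right pointer, and testing a variable for the empty tree each cost one step (this model is polynomially equivalent to Turing machines). Integers and vertex names are given in binary, graphs as lists of vertices and of edges, and the rooted decomposition as a rooted tree of bags. -/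

import Mathlib

/-! ### The machine model

A pointer machine in the form of the textbook WHILE language over binary trees: a program uses
finitely many variables, each of which holds (a pointer to) a binary tree. Each elementary
instruction (clearing or copying a variable, building one new pair out of two pointers, following
a left or right pointer) and each test of a variable against `nil` costs one time unit. There are no
unit-cost operations on numbers and no unit-cost comparisons of trees, so that the model is
polynomially equivalent to Turing machines. -/

/-- The data of the machine: binary trees. -/
inductive Datum where
  | nil : Datum
  | cons : Datum → Datum → Datum

/-- The left component; the left component of `nil` is `nil`. -/
def Datum.head : Datum → Datum
  | .nil => .nil
  | .cons a _ => a

/-- The right component; the right component of `nil` is `nil`. -/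
def Datum.tail : Datum → Datum
  | .nil => .nil
  | .cons _ b => b

/-- Programs; variables are named by natural numbers. -/
inductive Cmd where
  /-- `x := nil` -/
  | clear (x : ℕ) : Cmd
  /-- `x := y` -/
  | copy (x y : ℕ) : Cmd
  /-- `x := cons y z` -/
  | pair (x y z : ℕ) : Cmd
  /-- `x := head y` -/
  | left (x y : ℕ) : Cmd
  /-- `x := tail y` -/
  | right (x y : ℕ) : Cmd
  /-- first `c`, then `d` -/
  | seq (c d : Cmd) : Cmd
  /-- `if x ≠ nil then c else d` -/
  | cond (x : ℕ) (c d : Cmd) : Cmd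
  /-- `while x ≠ nil do c` -/
  | loop (x : ℕ) (c : Cmd) : Cmd

/-- `Cmd.Exec c s k s'`: started in the memory state `s`, the program `c` halts in the state `s'`
after exactly `k` time units. -/
inductive Cmd.Exec : Cmd → (ℕ → Datum) → ℕ → (ℕ → Datum) → Prop where
  | clear (x : ℕ) (s : ℕ → Datum) :
      Cmd.Exec (.clear x) s 1 (Function.update s x .nil)
  | copy (x y : ℕ) (s : ℕ → Datum) :
      Cmd.Exec (.copy x y) s 1 (Function.update s x (s y))
  | pair (x y z : ℕ) (s : ℕ → Datum) :
      Cmd.Exec (.pair x y z) s 1 (Function.update s x (.cons (s y) (s z)))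
  | left (x y : ℕ) (s : ℕ → Datum) :
      Cmd.Exec (.left x y) s 1 (Function.update s x (s y).head)
  | right (x y : ℕ) (s : ℕ → Datum) :
      Cmd.Exec (.right x y) s 1 (Function.update s x (s y).tail)
  | seq {c d : Cmd} {s₁ s₂ s₃ : ℕ → Datum} {k l : ℕ} :
      Cmd.Exec c s₁ k s₂ → Cmd.Exec d s₂ l s₃ → Cmd.Exec (.seq c d) s₁ (k + l) s₃
  | condTrue {x : ℕ} {c d : Cmd} {s₁ s₂ : ℕ → Datum} {k : ℕ} :
      s₁ x ≠ .nil → Cmd.Exec c s₁ k s₂ → Cmd.Exec (.cond x c d) s₁ (k + 1) s₂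
  | condFalse {x : ℕ} {c d : Cmd} {s₁ s₂ : ℕ → Datum} {k : ℕ} :
      s₁ x = .nil → Cmd.Exec d s₁ k s₂ → Cmd.Exec (.cond x c d) s₁ (k + 1) s₂
  | loopTrue {x : ℕ} {c : Cmd} {s₁ s₂ s₃ : ℕ → Datum} {k l : ℕ} :
      s₁ x ≠ .nil → Cmd.Exec c s₁ k s₂ → Cmd.Exec (.loop x c) s₂ l s₃ →
        Cmd.Exec (.loop x c) s₁ (k + l + 1) s₃
  | loopFalse {x : ℕ} {c : Cmd} {s : ℕ → Datum} :
      s x = .nil → Cmd.Exec (.loop x c) s 1 s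

/-- The final state and the running time are determined by the program and the initial state. -/
theorem Cmd.Exec.deterministic {c : Cmd} {s s₁ s₂ : ℕ → Datum} {k₁ k₂ : ℕ}
    (h₁ : Cmd.Exec c s k₁ s₁) (h₂ : Cmd.Exec c s k₂ s₂) : k₁ = k₂ ∧ s₁ = s₂ := by
  induction h₁ generalizing k₂ s₂ with
  | clear => cases h₂; exact ⟨rfl, rfl⟩
  | copy => cases h₂; exact ⟨rfl, rfl⟩
  | pair => cases h₂; exact ⟨rfl, rfl⟩
  | left => cases h₂; exact ⟨rfl, rfl⟩
  | right => cases h₂; exact ⟨rfl, rfl⟩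
  | seq _ _ ih₁ ih₂ =>
    cases h₂ with
    | seq a b =>
      obtain ⟨rfl, rfl⟩ := ih₁ a
      obtain ⟨rfl, rfl⟩ := ih₂ b
      exact ⟨rfl, rfl⟩
  | condTrue hx _ ih =>
    cases h₂ with
    | condTrue _ a => obtain ⟨rfl, rfl⟩ := ih a; exact ⟨rfl, rfl⟩
    | condFalse hy _ => exact absurd hy hx
  | condFalse hx _ ih =>
    cases h₂ with
    | condTrue hy _ => exact absurd hx hy
    | condFalse _ a => obtain ⟨rfl, rfl⟩ := ih a; exact ⟨rfl, rfl⟩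
  | loopTrue hx _ _ ih₁ ih₂ =>
    cases h₂ with
    | loopTrue _ a b =>
      obtain ⟨rfl, rfl⟩ := ih₁ a
      obtain ⟨rfl, rfl⟩ := ih₂ b
      exact ⟨rfl, rfl⟩
    | loopFalse hy => exact absurd hy hx
  | loopFalse hx =>
    cases h₂ with
    | loopTrue hy _ _ => exact absurd hx hy
    | loopFalse _ => exact ⟨rfl, rfl⟩

/-- The initial memory state: the input is in variable `0`, all other variables hold `nil`. -/
def inputState (x : Datum) : ℕ → Datum := fun i => if i = 0 then x else .nil

/-- On input `x` the program `P` halts within time `T`, and it accepts (ends with variable `0`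
different from `nil`) if and only if `Q` holds. -/
def Cmd.DecidesWithin (P : Cmd) (x : Datum) (Q : Prop) (T : ℕ) : Prop :=
  ∃ (s : ℕ → Datum) (k : ℕ), Cmd.Exec P (inputState x) k s ∧ k ≤ T ∧ (s 0 ≠ .nil ↔ Q)

/-! ### The two decision problems -/

/-- Light Connecting Induced Subgraph: is there a connected induced subgraph of `G` on `ℓ + |K|`
vertices and with at most `f` edges that contains `K`? -/
def LightConnectingInducedSubgraph {V : Type} (G : SimpleGraph V) (K : Finset V) (ℓ f : ℤ) :
    Prop :=
  ∃ S : Finset V, K ⊆ S ∧ (G.induce (S : Set V)).Connected ∧ (S.card : ℤ) = ℓ + K.card ∧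
    ((G.induce (S : Set V)).edgeSet.ncard : ℤ) ≤ f

/-- `k`-in-a-tree: is there an induced subgraph of `G` that is a tree and contains `K`? -/
def KInATree {V : Type} (G : SimpleGraph V) (K : Finset V) : Prop :=
  ∃ S : Finset V, K ⊆ S ∧ (G.induce (S : Set V)).IsTree

/-! ### Tree decompositions -/

/-- The tree `T` with the bags `B` is a tree decomposition of `G`. -/
structure IsTreeDecomposition {V ι : Type} [DecidableEq V] (G : SimpleGraph V)
    (T : SimpleGraph ι) (B : ι → Finset V) : Prop where
  isTree : T.IsTree
  vertices : ∀ v : V, ∃ i, v ∈ B i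
  edges : ∀ u v : V, G.Adj u v → ∃ i, u ∈ B i ∧ v ∈ B i
  path : ∀ (i j q : ι) (p : T.Walk i j), p.IsPath → q ∈ p.support → B i ∩ B j ⊆ B q

/-- Rooted trees in which every node has at most two children and carries a bag of vertices. -/
inductive BagTree (V : Type) where
  /-- a node without children -/
  | leaf (B : Finset V) : BagTree V
  /-- a node with one child -/
  | unary (B : Finset V) (c : BagTree V) : BagTree V
  /-- a node with two children -/
  | binary (B : Finset V) (l r : BagTree V) : BagTree V

namespace BagTree

/-- The bag of the root. -/
def bag {V : Type} : BagTree V → Finset V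
  | leaf B => B
  | unary B _ => B
  | binary B _ _ => B

/-- The number of nodes. -/
def numNodes {V : Type} : BagTree V → ℕ
  | leaf _ => 1
  | unary _ c => c.numNodes + 1
  | binary _ l r => l.numNodes + r.numNodes + 1

/-- The set of nodes; below a node with children, `none` is that node itself. -/
def Node {V : Type} : BagTree V → Type
  | leaf _ => Unit
  | unary _ c => Option c.Node
  | binary _ l r => Option (l.Node ⊕ r.Node)

/-- The root. -/
def root {V : Type} : (D : BagTree V) → D.Node
  | leaf _ => ()
  | unary _ _ => none
  | binary _ _ _ => none

/-- The bag of a node. -/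
def bagAt {V : Type} : (D : BagTree V) → D.Node → Finset V
  | leaf B, _ => B
  | unary B _, none => B
  | unary _ c, some x => c.bagAt x
  | binary B _ _, none => B
  | binary _ l _, some (.inl x) => l.bagAt x
  | binary _ _ r, some (.inr x) => r.bagAt x

/-- `D.IsChild x y`: the node `y` is a child of the node `x`. -/
def IsChild {V : Type} : (D : BagTree V) → D.Node → D.Node → Prop
  | leaf _, _, _ => False
  | unary _ _, _, none => False
  | unary _ c, none, some y => y = c.root
  | unary _ c, some x, some y => c.IsChild x y
  | binary _ _ _, _, none => False
  | binary _ l _, none, some (.inl y) => y = l.root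
  | binary _ _ r, none, some (.inr y) => y = r.root
  | binary _ l _, some (.inl x), some (.inl y) => l.IsChild x y
  | binary _ _ r, some (.inr x), some (.inr y) => r.IsChild x y
  | binary _ _ _, some (.inl _), some (.inr _) => False
  | binary _ _ _, some (.inr _), some (.inl _) => False

/-- The underlying unrooted tree: a node is adjacent to its children and to its parent. -/
def graph {V : Type} (D : BagTree V) : SimpleGraph D.Node :=
  SimpleGraph.fromRel D.IsChild

/-- Every node is a leaf node, an introduce node, a forget node or a join node. -/
def NiceNodes {V : Type} [DecidableEq V] : BagTree V → Prop
  | leaf B => B = ∅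
  | unary B c =>
      ((∃ u, u ∉ c.bag ∧ B = insert u c.bag) ∨ (∃ u, u ∉ B ∧ c.bag = insert u B)) ∧ c.NiceNodes
  | binary B l r => B = l.bag ∧ B = r.bag ∧ l.NiceNodes ∧ r.NiceNodes

/-- The root is the forget node for `r`. -/
def RootForgets {V : Type} [DecidableEq V] (r : V) : BagTree V → Prop
  | leaf _ => False
  | unary B c => r ∉ B ∧ c.bag = insert r B
  | binary _ _ _ => False

/-- The width (largest size of a bag, minus one) is at most `t`. -/
def WidthLE {V : Type} (D : BagTree V) (t : ℕ) : Prop :=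
  ∀ x : D.Node, (D.bagAt x).card ≤ t + 1

end BagTree

/-- `D` is a nice tree decomposition of `G`; its root is an empty bag. -/
structure IsNiceTreeDecomposition {V : Type} [DecidableEq V] (G : SimpleGraph V)
    (D : BagTree V) : Prop where
  decomposition : IsTreeDecomposition G D.graph D.bagAt
  root_empty : D.bag = ∅
  nice : D.NiceNodes

/-! ### Encoding of the inputs -/

namespace Datum

/-- A list is encoded as a chain of pairs that ends in `nil`. -/
def ofList (l : List Datum) : Datum := l.foldr cons nil

/-- A bit. -/
def ofBool : Bool → Datum
  | false => nil
  | true => cons nil nil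

/-- A natural number: the list of its binary digits, least significant digit first, without
leading zeros. -/
def ofNat (m : ℕ) : Datum := ofList (m.bits.map ofBool)

/-- An integer: sign bit and absolute value. -/
def ofInt (z : ℤ) : Datum := cons (ofBool (decide (z < 0))) (ofNat z.natAbs)

/-- A list of vertices, each given by its binary number. -/
def ofVertices {n : ℕ} (l : List (Fin n)) : Datum := ofList (l.map fun v => ofNat v)

/-- A set of vertices: the increasing list of its elements. -/
def ofSet {n : ℕ} (S : Finset (Fin n)) : Datum :=
  ofVertices ((List.finRange n).filter fun v => decide (v ∈ S))

open Classical in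
/-- A graph: the list of its vertices, and the list of all pairs of adjacent vertices. -/
noncomputable def ofGraph {n : ℕ} (G : SimpleGraph (Fin n)) : Datum :=
  cons (ofVertices (List.finRange n))
    (ofList ((((List.finRange n).product (List.finRange n)).filter
      fun e => decide (G.Adj e.1 e.2)).map fun e => cons (ofNat e.1) (ofNat e.2)))

/-- A rooted tree with bags: the bag of the root, followed by the trees below the root. -/
def ofBagTree {n : ℕ} : BagTree (Fin n) → Datum
  | .leaf B => ofList [ofSet B]
  | .unary B c => ofList [ofSet B, ofBagTree c]
  | .binary B l r => ofList [ofSet B, ofBagTree l, ofBagTree r]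

end Datum

/-! ### Sizes and typed encodings -/

/-! Fix a terminal r. For a set S containing r, count the two-colourings of S that are constant
along the edges of G[S] and give r a fixed colour. With c components there are 2^(c-1) of them, so
their number is odd exactly when G[S] is connected (`card_cuts_ne_zero_iff`). Connectivity thus
becomes a parity, and this parity can be computed along a tree decomposition while remembering only
the colours in the bag.

At a node with bag Y, every set S chosen below the node has a vector `cutVec` over the field with
two elements: the sum, over the cuts of S that no edge outside Y crosses, of a monomial recording
the size of S \ Y, the number of edges of G[S] not inside Y, and the colouring of Y. Introducing or
forgetting a vertex acts on these vectors linearly, and joining acts bilinearly (`cutVec_insert`,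
`cutVec_forget`, `cutVec_union`, `joinLin_eq_zero`). The table of a node spans the space generated
by the vectors of all admissible S. Because the space is kept and not the sum of the vectors,
different sets S cannot cancel each other, and no randomisation is needed. Spans commute with linear
and bilinear maps, so each table can be computed from the tables of the children (`tspan_table`).
Gaussian elimination keeps at most as many vectors as there are monomials, a number polynomial in
2^t n (`Echelon.length_le`, `card_monomials_le`, `esize_table`).

At the root the bag is empty and `cutVec` of S is one monomial, (|S|, |E(G[S])|, empty colouring),
with the parity of the number of cuts as coefficient. A coordinate that vanishes on generators
vanishes on their span, so the monomials occurring in the root table are exactly those of the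
connected sets containing K (`exists_table_iff`). Both problems are read off from them; a tree is a
connected graph with one edge fewer than vertices.

For the running time, `PolyTime` is closed under composition and under folds with controlled
intermediate sizes, so the work at one node is polynomial in 2^t n, and a stack machine does it once
per node (`Cmd.reach_traverse`). Only the lowest 2n+1 digits of the two integers are read, so the
bound does not depend on their length. -/

/-- The number of nodes of a binary tree, leaves included. -/
def Datum.size : Datum → ℕ
  | .nil => 1
  | .cons a b => a.size + b.size + 1

theorem Datum.one_le_size (d : Datum) : 1 ≤ d.size := by
  cases d <;> simp [Datum.size]

/-- Types whose elements are represented by data of the machine. -/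
class Enc (α : Type) where
  enc : α → Datum
  inj : Function.Injective enc

/-- The size of the representation. -/
def esize {α : Type} [Enc α] (a : α) : ℕ := (Enc.enc a).size

theorem one_le_esize {α : Type} [Enc α] (a : α) : 1 ≤ esize a := Datum.one_le_size _

instance : Enc Datum := ⟨id, Function.injective_id⟩

instance : Enc Unit := ⟨fun _ => .nil, fun _ _ _ => rfl⟩

instance : Enc Bool := ⟨Datum.ofBool, fun a b h => by cases a <;> cases b <;> simp_all [Datum.ofBool]⟩

instance {α β : Type} [Enc α] [Enc β] : Enc (α × β) :=
  ⟨fun p => .cons (Enc.enc p.1) (Enc.enc p.2), fun a b h => by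
    simp only [Datum.cons.injEq] at h
    exact Prod.ext (Enc.inj h.1) (Enc.inj h.2)⟩

instance {α : Type} [Enc α] : Enc (List α) :=
  ⟨fun l => Datum.ofList (l.map Enc.enc), fun a => by
    induction a with
    | nil => intro b h; cases b <;> simp_all [Datum.ofList]
    | cons x a ih =>
      intro b h
      cases b with
      | nil => simp_all [Datum.ofList]
      | cons y b =>
        simp only [Datum.ofList, List.map_cons, List.foldr_cons, Datum.cons.injEq] at h
        rw [Enc.inj h.1, ih h.2]⟩

instance {α : Type} [Enc α] : Enc (Option α) :=
  ⟨fun o => o.elim .nil (fun a => .cons (Enc.enc a) .nil), fun a b h => by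
    cases a <;> cases b <;> simp_all
    exact Enc.inj h⟩

/-- Natural numbers are represented in unary. -/
instance : Enc ℕ :=
  ⟨fun n => Enc.enc (List.replicate n ()), fun a b h => by
    simpa using congrArg List.length (Enc.inj h)⟩

section
variable {α β : Type} [Enc α] [Enc β]

@[simp] theorem enc_datum (d : Datum) : Enc.enc d = d := rfl
@[simp] theorem enc_pair (a : α) (b : β) : Enc.enc (a, b) = .cons (Enc.enc a) (Enc.enc b) := rfl
@[simp] theorem enc_nil : Enc.enc ([] : List α) = .nil := rfl
@[simp] theorem enc_cons (a : α) (l : List α) : Enc.enc (a :: l) = .cons (Enc.enc a) (Enc.enc l) := rfl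
@[simp] theorem enc_none : Enc.enc (none : Option α) = .nil := rfl
@[simp] theorem enc_some (a : α) : Enc.enc (some a) = .cons (Enc.enc a) .nil := rfl
@[simp] theorem enc_true : Enc.enc true = .cons .nil .nil := rfl
@[simp] theorem enc_false : Enc.enc false = .nil := rfl

@[simp] theorem esize_pair (a : α) (b : β) : esize (a, b) = esize a + esize b + 1 := rfl
@[simp] theorem esize_nil : esize ([] : List α) = 1 := rfl
@[simp] theorem esize_cons (a : α) (l : List α) : esize (a :: l) = esize a + esize l + 1 := rfl
@[simp] theorem esize_none : esize (none : Option α) = 1 := rfl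
@[simp] theorem esize_some (a : α) : esize (some a) = esize a + 2 := rfl
@[simp] theorem esize_unit (u : Unit) : esize u = 1 := rfl
theorem esize_bool (b : Bool) : esize b ≤ 3 := by cases b <;> simp [esize, Datum.size]

theorem esize_list (l : List α) : esize l = (l.map fun a => esize a + 1).sum + 1 := by
  induction l with
  | nil => rfl
  | cons a l ih => simp [ih]; omega

theorem length_le_esize (l : List α) : l.length ≤ esize l := by
  induction l with
  | nil => simp
  | cons a l ih => simp; omega

theorem esize_le_of_mem {l : List α} {a : α} (h : a ∈ l) : esize a ≤ esize l := by
  induction l with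
  | nil => simp at h
  | cons b l ih =>
    rcases List.mem_cons.1 h with rfl | h
    · simp; omega
    · have := ih h; simp; omega

theorem esize_append (l l' : List α) : esize (l ++ l') + 1 = esize l + esize l' := by
  induction l with
  | nil => simp; omega
  | cons a l ih => simp; omega

theorem esize_list_le {l : List α} {m : ℕ} (h : ∀ a ∈ l, esize a ≤ m) :
    esize l ≤ l.length * (m + 1) + 1 := by
  induction l with
  | nil => simp
  | cons a l ih =>
    have h1 := ih fun b hb => h b (List.mem_cons_of_mem _ hb)
    have h2 := h a (by simp)
    simp only [esize_cons, List.length_cons, add_mul, one_mul]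
    omega

theorem esize_nat (n : ℕ) : esize n = 2 * n + 1 := by
  change esize (List.replicate n ()) = _
  rw [esize_list]; simp; ring

theorem esize_sublist {l l' : List α} (h : l.Sublist l') : esize l ≤ esize l' := by
  induction h with
  | slnil => simp
  | cons a _ ih => simp; omega
  | cons_cons a _ ih => simp; omega

theorem esize_perm {l l' : List α} (h : l.Perm l') : esize l = esize l' := by
  rw [esize_list, esize_list, (h.map _).sum_eq]

theorem esize_le_of_nodup_subset {l l' : List α} (h : l.Nodup) (h' : l ⊆ l') :
    esize l ≤ esize l' := by
  obtain ⟨m, hm, hs⟩ := h.subperm h'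
  rw [← esize_perm hm]
  exact esize_sublist hs
end

theorem eval_mono (p : Polynomial ℕ) {a b : ℕ} (h : a ≤ b) : p.eval a ≤ p.eval b := by
  rw [Polynomial.eval_eq_sum_range, Polynomial.eval_eq_sum_range]
  exact Finset.sum_le_sum fun i _ => Nat.mul_le_mul_left _ (Nat.pow_le_pow_left h i)

/-! ### Functions computable in polynomial time -/

/-- `f` is computed by a program in polynomial time, with a result of polynomial size. The input
and the output are in variable `0`; the program works correctly from any contents of the other
variables, and leaves all variables from some index on untouched. -/
@[fun_prop]
def PolyTime {α β : Type} [Enc α] [Enc β] (f : α → β) : Prop :=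
  ∃ (c : Cmd) (K : ℕ) (p : Polynomial ℕ), ∀ (a : α) (s : ℕ → Datum), s 0 = Enc.enc a →
    ∃ (s' : ℕ → Datum) (k : ℕ), c.Exec s k s' ∧ s' 0 = Enc.enc (f a) ∧ (∀ i, K < i → s' i = s i) ∧
      k ≤ p.eval (esize a) ∧ esize (f a) ≤ p.eval (esize a)

namespace PolyTime

variable {α β γ δ : Type} [Enc α] [Enc β] [Enc γ] [Enc δ]

theorem of_enc_eq {f : α → β} (h : ∀ a, Enc.enc (f a) = Enc.enc a) : PolyTime f := by
  refine ⟨.copy 0 0, 0, Polynomial.X + 1, fun a s hs => ⟨_, _, .copy _ _ _, ?_, ?_, ?_, ?_⟩⟩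
  · simp [hs, h]
  · intro i hi; simp [hi.ne']
  · simp
  · simp [esize, h]

@[fun_prop]
theorem id : PolyTime (fun a : α => a) := of_enc_eq fun _ => rfl

@[fun_prop]
theorem comp {f : β → γ} {g : α → β} (hf : PolyTime f) (hg : PolyTime g) :
    PolyTime (fun a => f (g a)) := by
  obtain ⟨c, K, p, hc⟩ := hf
  obtain ⟨d, L, q, hd⟩ := hg
  refine ⟨.seq d c, max K L, q + p.comp q, fun a s hs => ?_⟩
  obtain ⟨s₁, k₁, e₁, v₁, f₁, t₁, z₁⟩ := hd a s hs
  obtain ⟨s₂, k₂, e₂, v₂, f₂, t₂, z₂⟩ := hc (g a) s₁ v₁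
  refine ⟨s₂, k₁ + k₂, .seq e₁ e₂, v₂, fun i hi => ?_, ?_, ?_⟩
  · rw [f₂ i (lt_of_le_of_lt (le_max_left _ _) hi), f₁ i (lt_of_le_of_lt (le_max_right _ _) hi)]
  all_goals
    have := eval_mono p z₁
    simp only [Polynomial.eval_add, Polynomial.eval_comp]
    omega

-- Both programs leave the registers above M alone, so M + 1 can keep the input for the second run
-- and M + 2 the first result. The clause about untouched registers in `PolyTime` serves this
-- purpose.
@[fun_prop]
theorem prodMk {f : α → β} {g : α → γ} (hf : PolyTime f) (hg : PolyTime g) :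
    PolyTime (fun a => (f a, g a)) := by
  obtain ⟨c, K, p, hc⟩ := hf
  obtain ⟨d, L, q, hd⟩ := hg
  set M := max K L with hM
  refine ⟨.seq (.copy (M + 1) 0) (.seq c (.seq (.copy (M + 2) 0) (.seq (.copy 0 (M + 1)) (.seq d
    (.pair 0 (M + 2) 0))))), M + 2, p + q + 4, fun a s hs => ?_⟩
  obtain ⟨s₁, k₁, e₁, v₁, f₁, t₁, z₁⟩ := hc a (Function.update s (M + 1) (s 0)) (by simpa using hs)
  obtain ⟨s₂, k₂, e₂, v₂, f₂, t₂, z₂⟩ := hd a (Function.update (Function.update s₁ (M + 2) (s₁ 0)) 0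
    (s₁ (M + 1))) (by rw [f₁ (M + 1) (by omega)]; simpa using hs)
  refine ⟨_, _, .seq (.copy _ _ _) (.seq e₁ (.seq (.copy _ _ _) (.seq (.copy _ _ _) (.seq
    (by simpa using e₂) (.pair _ _ _ _))))), ?_, fun i hi => ?_, ?_, ?_⟩
  · rw [f₂ _ (by omega)]; simp [v₁, v₂]
  · have h0 : i ≠ 0 := by omega
    have h1 : i ≠ M + 1 := by omega
    have h2 : i ≠ M + 2 := by omega
    have h3 := f₁ i (by omega)
    have h4 := f₂ i (by omega)
    simp [h0, h1, h2] at h3 h4 ⊢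
    rw [h4, h3]
  · simp; omega
  · simp; omega

@[fun_prop]
theorem fst {f : α → β × γ} (hf : PolyTime f) : PolyTime (fun a => (f a).1) := by
  refine comp (f := Prod.fst) ?_ hf
  refine ⟨.left 0 0, 0, Polynomial.X + 1, fun a s hs => ⟨_, _, .left _ _ _, ?_, ?_, ?_, ?_⟩⟩
  · simp [hs, Datum.head]; rfl
  · intro i hi; simp [hi.ne']
  · simp
  · obtain ⟨a, b⟩ := a; simp; omega

@[fun_prop]
theorem snd {f : α → β × γ} (hf : PolyTime f) : PolyTime (fun a => (f a).2) := by
  refine comp (f := Prod.snd) ?_ hf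
  refine ⟨.right 0 0, 0, Polynomial.X + 1, fun a s hs => ⟨_, _, .right _ _ _, ?_, ?_, ?_, ?_⟩⟩
  · simp [hs, Datum.tail]; rfl
  · intro i hi; simp [hi.ne']
  · simp
  · obtain ⟨a, b⟩ := a; simp; omega

/-- A function with the same representation of the values. -/
theorem congr_enc {f : α → β} (hf : PolyTime f) {g : α → γ}
    (h : ∀ a, Enc.enc (g a) = Enc.enc (f a)) : PolyTime g := by
  obtain ⟨c, K, p, hc⟩ := hf
  refine ⟨c, K, p, fun a s hs => ?_⟩
  have := hc a s hs
  simpa only [esize, h] using this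

@[fun_prop]
theorem datum_cons {f g : α → Datum} (hf : PolyTime f) (hg : PolyTime g) :
    PolyTime (fun a => Datum.cons (f a) (g a)) := congr_enc (prodMk hf hg) fun _ => rfl

@[fun_prop]
theorem const (b : β) : PolyTime (fun _ : α => b) := by
  suffices h : ∀ d : Datum, PolyTime (fun _ : α => d) from congr_enc (h (Enc.enc b)) fun _ => rfl
  intro d
  induction d with
  | nil =>
    refine ⟨.clear 0, 0, 1, fun a s hs => ⟨_, _, .clear _ _, ?_, ?_, ?_, ?_⟩⟩
    · simp
    · intro i hi; simp [hi.ne']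
    · simp
    · simp [esize, Datum.size]
  | cons a b iha ihb => exact datum_cons iha ihb

@[fun_prop]
theorem datum_head {f : α → Datum} (hf : PolyTime f) : PolyTime (fun a => (f a).head) := by
  refine comp (f := Datum.head) ?_ hf
  refine ⟨.left 0 0, 0, Polynomial.X + 1, fun a s hs => ⟨_, _, .left _ _ _, ?_, ?_, ?_, ?_⟩⟩
  · simp [hs]
  · intro i hi; simp [hi.ne']
  · simp
  · cases a <;> simp [esize, Datum.head, Datum.size]; omega

@[fun_prop]
theorem datum_tail {f : α → Datum} (hf : PolyTime f) : PolyTime (fun a => (f a).tail) := by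
  refine comp (f := Datum.tail) ?_ hf
  refine ⟨.right 0 0, 0, Polynomial.X + 1, fun a s hs => ⟨_, _, .right _ _ _, ?_, ?_, ?_, ?_⟩⟩
  · simp [hs]
  · intro i hi; simp [hi.ne']
  · simp
  · cases a <;> simp [esize, Datum.tail, Datum.size]; omega

/-- Is this the empty tree? -/
def _root_.Datum.isNil : Datum → Bool
  | .nil => true
  | .cons _ _ => false

@[fun_prop]
theorem datum_isNil {f : α → Datum} (hf : PolyTime f) : PolyTime (fun a => (f a).isNil) := by
  refine comp (f := Datum.isNil) ?_ hf
  refine ⟨.cond 0 (.clear 0) (.pair 0 0 0), 0, 3, fun a s hs => ?_⟩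
  cases a with
  | nil =>
    refine ⟨_, _, .condFalse hs (.pair _ _ _ _), ?_, ?_, ?_, ?_⟩
    · simp [hs, Datum.isNil]
    · intro i hi; simp [hi.ne']
    · simp
    · simpa using esize_bool _
  | cons a b =>
    refine ⟨_, _, .condTrue (by simp [hs]) (.clear _ _), ?_, ?_, ?_, ?_⟩
    · simp [Datum.isNil]
    · intro i hi; simp [hi.ne']
    · simp
    · simpa using esize_bool _

@[fun_prop]
theorem cond {b : α → Bool} {f g : α → β} (hb : PolyTime b) (hf : PolyTime f) (hg : PolyTime g) :
    PolyTime (fun a => bif b a then f a else g a) := by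
  obtain ⟨e, J, r, he⟩ := hb
  obtain ⟨c, K, p, hc⟩ := hf
  obtain ⟨d, L, q, hd⟩ := hg
  set M := max J (max K L) with hM
  refine ⟨.seq (.copy (M + 1) 0) (.seq e (.seq (.copy (M + 2) 0) (.seq (.copy 0 (M + 1))
    (.cond (M + 2) c d)))), M + 2, r + p + q + 4, fun a s hs => ?_⟩
  obtain ⟨s₁, k₁, e₁, v₁, f₁, t₁, z₁⟩ := he a (Function.update s (M + 1) (s 0)) (by simpa using hs)
  set s₂ := Function.update (Function.update s₁ (M + 2) (s₁ 0)) 0 (s₁ (M + 1)) with hs₂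
  have h20 : s₂ 0 = Enc.enc a := by rw [hs₂, f₁ (M + 1) (by omega)]; simpa using hs
  have h2i : ∀ i, M + 2 < i → s₂ i = s i := fun i hi => by
    have h0 : i ≠ 0 := by omega
    have h1 : i ≠ M + 1 := by omega
    have h2 : i ≠ M + 2 := by omega
    have h3 := f₁ i (by omega)
    simp [hs₂, h0, h1, h2] at h3 ⊢
    exact h3
  have h2 : s₂ (M + 2) = Enc.enc (b a) := by simp [hs₂, v₁]
  cases hba : b a with
  | true =>
    obtain ⟨s₃, k₃, e₃, v₃, f₃, t₃, z₃⟩ := hc a s₂ h20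
    refine ⟨_, _, .seq (.copy _ _ _) (.seq e₁ (.seq (.copy _ _ _) (.seq (.copy _ _ _) (.condTrue
      (by simp [v₁, hba]) (by simpa using e₃))))), by simp only [hba, cond_true, v₃], fun i hi => ?_, ?_, ?_⟩
    · rw [f₃ i (by omega), h2i i hi]
    · simp; omega
    · simp [hba]; omega
  | false =>
    obtain ⟨s₃, k₃, e₃, v₃, f₃, t₃, z₃⟩ := hd a s₂ h20
    refine ⟨_, _, .seq (.copy _ _ _) (.seq e₁ (.seq (.copy _ _ _) (.seq (.copy _ _ _) (.condFalse
      (by simp [v₁, hba]) (by simpa using e₃))))), by simp only [hba, cond_false, v₃], fun i hi => ?_, ?_, ?_⟩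
    · rw [f₃ i (by omega), h2i i hi]
    · simp; omega
    · simp [hba]; omega

/-- Iterating `f` until the first component is empty. -/
theorem iterate {f : List α × β → List α × β} (hf : PolyTime f) {ι : γ → List α × β}
    (hι : PolyTime ι) {g : γ → β} (q : Polynomial ℕ)
    (h : ∀ x, ∃ n ≤ q.eval (esize x), (∀ i < n, (f^[i] (ι x)).1 ≠ []) ∧ f^[n] (ι x) = ([], g x) ∧
      ∀ i ≤ n, esize (f^[i] (ι x)) ≤ q.eval (esize x)) : PolyTime g := by
  obtain ⟨c, K₁, p, hc⟩ := hf
  obtain ⟨d, K₂, r, hd⟩ := hι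
  set K := max K₁ K₂ with hK
  -- Register K + 1 always holds the first component of the state, so the loop stops exactly when
  -- that list is empty.
  refine ⟨.seq d (.seq (.left (K + 1) 0) (.seq (.loop (K + 1) (.seq c (.left (K + 1) 0)))
    (.right 0 0))), K + 1, r + q * (p.comp q + 2) + q + 5, fun x s hs => ?_⟩
  obtain ⟨n, hn, hne, hfin, hsz⟩ := h x
  -- Induction on the number m of iterations still to come. All intermediate states obey the size
  -- bound q, so one cost bound serves for every iteration.
  have key : ∀ m ≤ n, ∀ s : ℕ → Datum, s 0 = Enc.enc (f^[n - m] (ι x)) →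
      s (K + 1) = Enc.enc (f^[n - m] (ι x)).1 →
      ∃ s' k, (Cmd.loop (K + 1) (.seq c (.left (K + 1) 0))).Exec
      s k s' ∧ s' 0 = Enc.enc (f^[n] (ι x)) ∧ (∀ i, K + 1 < i → s' i = s i) ∧
      k ≤ m * (p.eval (q.eval (esize x)) + 2) + 1 := by
    intro m
    induction m with
    | zero =>
      intro _ s h0 h1
      exact ⟨s, 1, .loopFalse (by rw [h1]; simp [hfin]), by simpa using h0, fun _ _ => rfl, by simp⟩
    | succ m ih =>
      intro hm s h0 h1
      obtain ⟨s₁, k₁, e₁, v₁, f₁, t₁, z₁⟩ := hc _ s h0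
      have hstep : f (f^[n - (m + 1)] (ι x)) = f^[n - m] (ι x) := by
        rw [← Function.iterate_succ_apply' f]; congr 2; omega
      rw [hstep] at v₁
      obtain ⟨s₂, k₂, e₂, v₂, f₂, t₂⟩ := ih (by omega)
        (Function.update s₁ (K + 1) (s₁ 0).head) (by simp [v₁])
        (by simp [v₁]; rfl)
      refine ⟨s₂, k₁ + 1 + k₂ + 1, .loopTrue ?_ (.seq e₁ (.left _ _ _)) e₂, v₂, fun i hi => ?_, ?_⟩
      · rw [h1]
        have := hne (n - (m + 1)) (by omega)
        generalize (f^[n - (m + 1)] (ι x)).1 = l at this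
        cases l <;> simp at this ⊢
      · rw [f₂ i hi, Function.update_of_ne (by omega), f₁ i (by omega)]
      · have := eval_mono p (hsz (n - (m + 1)) (by omega))
        rw [add_mul]; omega
  obtain ⟨s₀, k₀, e₀, v₀, f₀, t₀, z₀⟩ := hd x s hs
  obtain ⟨s₁, k₁, e₁, v₁, f₁, t₁⟩ := key n le_rfl (Function.update s₀ (K + 1) (s₀ 0).head)
    (by simp [v₀]) (by simp [v₀]; rfl)
  refine ⟨_, _, .seq e₀ (.seq (.left _ _ _) (.seq e₁ (.right _ _ _))), ?_, fun i hi => ?_, ?_, ?_⟩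
  · simp [v₁, hfin, Datum.tail]
  · rw [Function.update_of_ne (by omega), f₁ i hi, Function.update_of_ne (by omega),
      f₀ i (by omega)]
  · have := Nat.mul_le_mul_right (p.eval (q.eval (esize x)) + 2) hn
    simp only [Polynomial.eval_add, Polynomial.eval_mul, Polynomial.eval_comp,
      Polynomial.eval_ofNat]
    omega
  · have := hsz n le_rfl
    rw [hfin] at this
    simp at this ⊢
    omega

end PolyTime

/-! ### Booleans, options, lists and unary arithmetic in polynomial time -/

namespace PolyTime

variable {α β γ δ : Type} [Enc α] [Enc β] [Enc γ] [Enc δ]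

@[fun_prop]
theorem enc {f : α → β} (hf : PolyTime f) : PolyTime (fun a => Enc.enc (f a)) :=
  congr_enc hf fun _ => rfl

@[fun_prop]
theorem not {f : α → Bool} (hf : PolyTime f) : PolyTime (fun a => !f a) :=
  congr_enc (cond hf (const false) (const true)) fun a => by cases f a <;> rfl

@[fun_prop]
theorem and {f g : α → Bool} (hf : PolyTime f) (hg : PolyTime g) : PolyTime (fun a => f a && g a) :=
  congr_enc (cond hf hg (const false)) fun a => by cases f a <;> rfl

@[fun_prop]
theorem or {f g : α → Bool} (hf : PolyTime f) (hg : PolyTime g) : PolyTime (fun a => f a || g a) :=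
  congr_enc (cond hf (const true) hg) fun a => by cases f a <;> rfl

@[fun_prop]
theorem list_cons {f : α → β} {g : α → List β} (hf : PolyTime f) (hg : PolyTime g) :
    PolyTime (fun a => f a :: g a) := congr_enc (prodMk hf hg) fun _ => rfl

@[fun_prop]
theorem list_tail {f : α → List β} (hf : PolyTime f) : PolyTime (fun a => (f a).tail) :=
  congr_enc (datum_tail (enc hf)) fun a => by cases f a <;> rfl

@[fun_prop]
theorem list_isEmpty {f : α → List β} (hf : PolyTime f) : PolyTime (fun a => (f a).isEmpty) :=
  congr_enc (datum_isNil (enc hf)) fun a => by cases f a <;> rfl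

@[fun_prop]
theorem list_head? {f : α → List β} (hf : PolyTime f) : PolyTime (fun a => (f a).head?) :=
  congr_enc (f := fun a => bif (Enc.enc (f a)).isNil then Datum.nil else
    .cons (Enc.enc (f a)).head .nil) (by fun_prop) fun a => by cases f a <;> rfl

@[fun_prop]
theorem option_elim {o : α → Option β} {f : α → γ} {g : α → β → γ} (ho : PolyTime o)
    (hf : PolyTime f) (hg : PolyTime (fun p : α × β => g p.1 p.2)) :
    PolyTime (fun a => (o a).elim (f a) (g a)) := by
  obtain ⟨e, J, r, he⟩ := ho
  obtain ⟨c, K, p, hc⟩ := hg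
  obtain ⟨d, L, q, hd⟩ := hf
  set M := max J (max K L) with hM
  refine ⟨.seq (.copy (M + 1) 0) (.seq e (.cond 0 (.seq (.left 0 0) (.seq (.pair 0 (M + 1) 0) c))
    (.seq (.copy 0 (M + 1)) d))), M + 1, r + p.comp (Polynomial.X + r + 1) + q + 5,
    fun a s hs => ?_⟩
  obtain ⟨s₁, k₁, e₁, v₁, f₁, t₁, z₁⟩ := he a (Function.update s (M + 1) (s 0)) (by simpa using hs)
  have hM1 : s₁ (M + 1) = Enc.enc a := by rw [f₁ (M + 1) (by omega)]; simpa using hs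
  have h1i : ∀ i, M + 1 < i → s₁ i = s i := fun i hi => by
    rw [f₁ i (by omega), Function.update_of_ne (by omega)]
  cases hoa : o a with
  | some b =>
    obtain ⟨s₃, k₃, e₃, v₃, f₃, t₃, z₃⟩ := hc (a, b) (Function.update (Function.update s₁ 0
      (s₁ 0).head) 0 (.cons (s₁ (M + 1)) (s₁ 0).head)) (by simp [hM1, v₁, hoa, Datum.head])
    refine ⟨_, _, .seq (.copy _ _ _) (.seq e₁ (.condTrue (by simp [v₁, hoa]) (.seq (.left _ _ _)
      (.seq (.pair _ _ _ _) (by simpa using e₃))))), by simpa [hoa] using v₃, fun i hi => ?_, ?_, ?_⟩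
    · rw [f₃ i (by omega), Function.update_of_ne (by omega), Function.update_of_ne (by omega),
        h1i i hi]
    all_goals
      have := eval_mono p (show esize (a, b) ≤ esize a + r.eval (esize a) + 1 by
        rw [hoa] at z₁; simp at z₁ ⊢; omega)
      simp only [esize_pair] at this t₃ z₃
      simp [hoa]
      omega
  | none =>
    obtain ⟨s₃, k₃, e₃, v₃, f₃, t₃, z₃⟩ := hd a (Function.update s₁ 0 (s₁ (M + 1))) (by simp [hM1])
    refine ⟨_, _, .seq (.copy _ _ _) (.seq e₁ (.condFalse (by simp [v₁, hoa]) (.seq (.copy _ _ _)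
      (by simpa using e₃)))), by simpa [hoa] using v₃, fun i hi => ?_, ?_, ?_⟩
    · rw [f₃ i (by omega), Function.update_of_ne (by omega), h1i i hi]
    all_goals
      simp [hoa] at z₃ ⊢
      omega

theorem size_bound {f : α → β} (hf : PolyTime f) :
    ∃ p : Polynomial ℕ, ∀ a, esize (f a) ≤ p.eval (esize a) := by
  obtain ⟨c, K, p, hc⟩ := hf
  refine ⟨p, fun a => ?_⟩
  obtain ⟨_, _, _, _, _, _, h⟩ := hc a (fun _ => Enc.enc a) rfl
  exact h

/-- A fold over a list whose intermediate results have polynomial size. -/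
theorem foldl {f : γ → β → α → β} {b : γ → β} {l : γ → List α} (hl : PolyTime l) (hb : PolyTime b)
    (hf : PolyTime (fun p : γ × β × α => f p.1 p.2.1 p.2.2)) 
    (q : Polynomial ℕ) (hq : ∀ c l', l' <+: l c → esize (l'.foldl (f c) (b c)) ≤ q.eval (esize c)) :
    PolyTime (fun c => (l c).foldl (f c) (b c)) := by
  -- The fold is run as an iteration on the triple of remaining list, parameter and accumulator; the
  -- parameter travels along because f depends on it.
  let F : List α × γ × β → List α × γ × β := fun p =>
    p.1.head?.elim p fun a => (p.1.tail, p.2.1, f p.2.1 p.2.2 a)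
  have hF : PolyTime F := by
    refine option_elim (by fun_prop) (by fun_prop) ?_
    have : PolyTime (fun x : (List α × γ × β) × α => f x.1.2.1 x.1.2.2 x.2) :=
      comp (f := fun p : γ × β × α => f p.1 p.2.1 p.2.2)
        (g := fun x : (List α × γ × β) × α => (x.1.2.1, x.1.2.2, x.2)) hf (by fun_prop)
    fun_prop
  have hiter : ∀ (l : List α) (c : γ) (b : β) (i : ℕ), i ≤ l.length →
      F^[i] (l, c, b) = (l.drop i, c, (l.take i).foldl (f c) b) := by
    intro l c b i
    induction i generalizing l b with
    | zero => simp
    | succ i ih =>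
      intro hi
      cases l with
      | nil => simp at hi
      | cons a l =>
        rw [Function.iterate_succ_apply]
        exact ih l (f c b a) (by simpa using hi)
  obtain ⟨r, hr⟩ := hl.size_bound
  refine (iterate (ι := fun c => (l c, c, b c)) (g := fun c => (c, (l c).foldl (f c) (b c))) hF
    (by fun_prop) (q + Polynomial.X + r + 2) fun c => ?_).snd
  have hlc := length_le_esize (l c)
  have hrc := hr c
  refine ⟨(l c).length, by simp; omega, fun i hi => ?_, ?_, fun i hi => ?_⟩
  · rw [hiter _ _ _ _ hi.le]
    intro h
    have := congrArg List.length h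
    simp at this; omega
  · rw [hiter _ _ _ _ le_rfl]; simp
  · rw [hiter _ _ _ _ hi]
    have h1 := hq c _ (List.take_prefix i (l c))
    have h2 := esize_sublist (List.drop_sublist i (l c))
    simp at h1 ⊢
    omega

@[fun_prop]
theorem list_reverse {l : γ → List α} (hl : PolyTime l) : PolyTime (fun c => (l c).reverse) := by
  obtain ⟨r, hr⟩ := hl.size_bound
  have := foldl (f := fun _ acc a => a :: acc) (b := fun _ => []) hl (by fun_prop) (by fun_prop) r
    (fun c l' h => by
      rw [List.foldl_flip_cons_eq_append']
      simp only [List.append_nil]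
      rw [esize_perm l'.reverse_perm]
      exact (esize_sublist h.sublist).trans (hr c))
  simpa only [List.foldl_flip_cons_eq_append', List.append_nil] using this

@[fun_prop]
theorem list_append {l l' : γ → List α} (hl : PolyTime l) (hl' : PolyTime l') :
    PolyTime (fun c => l c ++ l' c) := by
  obtain ⟨r, hr⟩ := hl.size_bound
  obtain ⟨r', hr'⟩ := hl'.size_bound
  have := foldl (f := fun _ acc a => a :: acc) (list_reverse hl) hl' (by fun_prop) (r + r')
    (fun c m h => by
      rw [List.foldl_flip_cons_eq_append']
      have h1 := esize_append m.reverse (l' c)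
      have h2 := esize_sublist h.sublist
      rw [esize_perm (l c).reverse_perm] at h2
      rw [esize_perm m.reverse_perm] at h1
      have := hr c
      have := hr' c
      simp
      omega)
  simpa only [List.foldl_flip_cons_eq_append', List.reverse_reverse] using this

@[fun_prop]
theorem list_map {l : γ → List α} {f : γ → α → β} (hl : PolyTime l)
    (hf : PolyTime (fun p : γ × α => f p.1 p.2)) : PolyTime (fun c => (l c).map (f c)) := by
  obtain ⟨r, hr⟩ := hl.size_bound
  obtain ⟨p, hp⟩ := hf.size_bound
  have hfold : ∀ (c : γ) (l : List α) (acc : List β),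
      l.foldl (fun acc a => f c a :: acc) acc = (l.map (f c)).reverse ++ acc := by
    intro c l
    induction l with
    | nil => simp
    | cons a l ih => intro acc; simp [ih]
  have hf' : PolyTime (fun x : γ × List β × α => f x.1 x.2.2) :=
    comp (f := fun p : γ × α => f p.1 p.2) (g := fun x : γ × List β × α => (x.1, x.2.2)) hf
      (by fun_prop)
  -- Consing yields the images in reverse order, which is undone at the end. The size is at most the
  -- number of entries times the bound for a single image.
  have := foldl (f := fun c acc a => f c a :: acc) (b := fun _ => []) hl (by fun_prop)
    (by fun_prop) (r * (p.comp (Polynomial.X + r + 1) + 1) + 1) (fun c m h => by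
      rw [hfold, List.append_nil, esize_perm (List.reverse_perm _)]
      refine (esize_list_le (m := p.eval (esize c + r.eval (esize c) + 1)) ?_).trans ?_
      · intro b hb
        obtain ⟨a, ha, rfl⟩ := List.mem_map.1 hb
        refine (hp (c, a)).trans (eval_mono p ?_)
        have := (esize_le_of_mem (h.subset ha)).trans (hr c)
        simp; omega
      · have h1 : m.length ≤ r.eval (esize c) :=
          h.length_le.trans ((length_le_esize _).trans (hr c))
        have := Nat.mul_le_mul_right (p.eval (esize c + r.eval (esize c) + 1) + 1) h1
        simpa using this)
  simp only [hfold, List.append_nil] at this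
  simpa using list_reverse this

theorem esize_flatten_le (L : List (List α)) : esize L.flatten ≤ esize L := by
  induction L with
  | nil => simp
  | cons l L ih =>
    have := esize_append l L.flatten
    simp at *; omega

@[fun_prop]
theorem list_flatten {L : γ → List (List α)} (hL : PolyTime L) :
    PolyTime (fun c => (L c).flatten) := by
  obtain ⟨r, hr⟩ := hL.size_bound
  have hfold : ∀ (l : List (List α)) (acc : List α),
      l.foldl (fun acc a => acc ++ a) acc = acc ++ l.flatten := by
    intro l
    induction l with
    | nil => simp
    | cons a l ih => intro acc; simp [ih]
  have := foldl (f := fun _ acc a => acc ++ a) (b := fun _ => []) hL (by fun_prop) (by fun_prop) r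
    (fun c m h => by
      rw [hfold, List.nil_append]
      exact (esize_flatten_le m).trans ((esize_sublist h.sublist).trans (hr c)))
  simpa only [hfold, List.nil_append] using this

@[fun_prop]
theorem list_flatMap {l : γ → List α} {f : γ → α → List β} (hl : PolyTime l)
    (hf : PolyTime (fun p : γ × α => f p.1 p.2)) : PolyTime (fun c => (l c).flatMap (f c)) := by
  simp only [List.flatMap_def]
  fun_prop

@[fun_prop]
theorem list_filter {l : γ → List α} {f : γ → α → Bool} (hl : PolyTime l)
    (hf : PolyTime (fun p : γ × α => f p.1 p.2)) : PolyTime (fun c => (l c).filter (f c)) := by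
  have : ∀ c, (l c).filter (f c) = (l c).flatMap fun a => bif f c a then [a] else [] := by
    intro c
    induction l c with
    | nil => rfl
    | cons a l ih => cases h : f c a <;> simp [h, ih]
  simp only [this]
  fun_prop

@[fun_prop]
theorem list_any {l : γ → List α} {f : γ → α → Bool} (hl : PolyTime l)
    (hf : PolyTime (fun p : γ × α => f p.1 p.2)) : PolyTime (fun c => (l c).any (f c)) := by
  have : ∀ c, (l c).any (f c) = !((l c).filter (f c)).isEmpty := by
    intro c
    induction l c with
    | nil => rfl
    | cons a l ih => cases h : f c a <;> simp [h, ih]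
  simp only [this]
  fun_prop

-- A number is represented in unary as a list of units, so the length is the list with its entries
-- erased.
@[fun_prop]
theorem list_length {l : γ → List α} (hl : PolyTime l) : PolyTime (fun c => (l c).length) :=
  congr_enc (f := fun c => (l c).map fun _ => ()) (by fun_prop) fun c => by
    rw [List.map_const']; rfl

theorem replicate {n : γ → ℕ} (hn : PolyTime n) : PolyTime (fun c => List.replicate (n c) ()) :=
  congr_enc hn fun _ => rfl

@[fun_prop]
theorem nat_add {m n : γ → ℕ} (hm : PolyTime m) (hn : PolyTime n) : PolyTime (fun c => m c + n c) := by
  have h1 := replicate hm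
  have h2 := replicate hn
  refine congr_enc (f := fun c => List.replicate (m c) () ++ List.replicate (n c) ()) (by fun_prop)
    fun c => ?_
  rw [List.replicate_append_replicate]; rfl

end PolyTime

/-! ### Testing equality -/

/-- Equality as a Boolean. -/
noncomputable def eqb {α : Type} (a b : α) : Bool := open Classical in decide (a = b)

@[simp] theorem eqb_iff {α : Type} {a b : α} : eqb a b = true ↔ a = b := by simp [eqb]

@[simp] theorem eqb_self {α : Type} (a : α) : eqb a a = true := eqb_iff.2 rfl

/-- One step of the comparison of two trees, with a stack of pairs that are still to be compared. -/
def Datum.eqStep (p : List (Datum × Datum) × Bool) : List (Datum × Datum) × Bool :=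
  p.1.head?.elim p fun x =>
    bif x.1.isNil then bif x.2.isNil then (p.1.tail, p.2) else ([], false)
    else bif x.2.isNil then ([], false) else
      ((x.1.head, x.2.head) :: (x.1.tail, x.2.tail) :: p.1.tail, p.2)

/-- The total size of the left trees on the stack drops with every step that finds no mismatch, and
a mismatch empties the stack at once; so m steps suffice. Splitting a pair of nodes into two pairs
does not enlarge the stack, which gives the size bound. -/
theorem Datum.iterate_eqStep (m : ℕ) : ∀ l : List (Datum × Datum),
    (l.map fun x => x.1.size).sum ≤ m → ∃ n ≤ m, (∀ i < n, (eqStep^[i] (l, true)).1 ≠ []) ∧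
      eqStep^[n] (l, true) = ([], eqb (l.map Prod.fst) (l.map Prod.snd)) ∧
      ∀ i ≤ n, esize (eqStep^[i] (l, true)) ≤ esize l + 4 := by
  have hb : ∀ b : Bool, esize b ≤ 3 := esize_bool
  induction m with
  | zero =>
    intro l hl
    cases l with
    | nil => 
      refine ⟨0, le_rfl, by simp, by simp [eqb], fun i hi => ?_⟩
      have := hb true
      simp [Nat.le_zero.1 hi]; omega
    | cons x l => have := x.1.one_le_size; simp at hl; omega
  | succ m ih =>
    intro l hl
    cases l with
    | nil =>
      refine ⟨0, by omega, by simp, by simp [eqb], fun i hi => ?_⟩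
      have := hb true
      simp [Nat.le_zero.1 hi]; omega
    | cons x l =>
      have main : ∀ l₁, eqStep (x :: l, true) = (l₁, true) →
          (l₁.map fun x => x.1.size).sum ≤ m → esize l₁ ≤ esize (x :: l) →
          (l₁.map Prod.fst = l₁.map Prod.snd ↔ (x :: l).map Prod.fst = (x :: l).map Prod.snd) →
          ∃ n ≤ m + 1, (∀ i < n, (eqStep^[i] (x :: l, true)).1 ≠ []) ∧
          eqStep^[n] (x :: l, true) = ([], eqb ((x :: l).map Prod.fst) ((x :: l).map Prod.snd)) ∧
          ∀ i ≤ n, esize (eqStep^[i] (x :: l, true)) ≤ esize (x :: l) + 4 := by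
        intro l₁ h1 h2 h3 h4
        obtain ⟨n, hn, hne, hfin, hsz⟩ := ih l₁ h2
        refine ⟨n + 1, by omega, fun i hi => ?_, ?_, fun i hi => ?_⟩
        · cases i with
          | zero => simp
          | succ i => rw [Function.iterate_succ_apply, h1]; exact hne i (by omega)
        · rw [Function.iterate_succ_apply, h1, hfin]
          congr 1
          rw [Bool.eq_iff_iff, eqb_iff, eqb_iff, h4]
        · cases i with
          | zero => have := hb true; simp; omega
          | succ i =>
            rw [Function.iterate_succ_apply, h1]; exact (hsz i (by omega)).trans (by omega)
      have bad : eqStep (x :: l, true) = ([], false) → x.1 ≠ x.2 → 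
          ∃ n ≤ m + 1, (∀ i < n, (eqStep^[i] (x :: l, true)).1 ≠ []) ∧
          eqStep^[n] (x :: l, true) = ([], eqb ((x :: l).map Prod.fst) ((x :: l).map Prod.snd)) ∧
          ∀ i ≤ n, esize (eqStep^[i] (x :: l, true)) ≤ esize (x :: l) + 4 := by
        intro h1 h2
        refine ⟨1, by omega, fun i hi => ?_, ?_, fun i hi => ?_⟩
        · simp [Nat.lt_one_iff.1 hi]
        · simp [h1, h2, eqb]
        · have := hb true
          have := hb false
          interval_cases i
          · simp; omega
          · simp [h1]; omega
      obtain ⟨a, b⟩ := x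
      cases a with
      | nil =>
        cases b with
        | nil =>
          refine main l rfl ?_ ?_ ?_
          · simp [Datum.size] at hl; omega
          · simp; omega
          · simp
        | cons b₁ b₂ => exact bad rfl (by simp)
      | cons a₁ a₂ =>
        cases b with
        | nil => exact bad rfl (by simp)
        | cons b₁ b₂ =>
          refine main ((a₁, b₁) :: (a₂, b₂) :: l) rfl ?_ ?_ ?_
          · simp [Datum.size] at hl ⊢; omega
          · simp [esize, Datum.size]; omega
          · simp [and_assoc]

namespace PolyTime

variable {α β γ δ : Type} [Enc α] [Enc β] [Enc γ] [Enc δ]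

theorem datum_eqb : PolyTime (fun p : Datum × Datum => eqb p.1 p.2) := by
  refine iterate (f := Datum.eqStep) (ι := fun p => ([p], true)) ?_ (by fun_prop)
    (Polynomial.X + 10) fun p => ?_
  · unfold Datum.eqStep
    fun_prop
  obtain ⟨n, h1, h2, h3, h4⟩ := Datum.iterate_eqStep p.1.size [p] (by simp)
  refine ⟨n, ?_, h2, ?_, fun i hi => (h4 i hi).trans ?_⟩
  · simp only [Polynomial.eval_add, Polynomial.eval_X, Polynomial.eval_ofNat]
    change n ≤ p.1.size + p.2.size + 1 + 10
    omega
  · rw [h3]; simp [eqb]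
  · simp

-- Encodings are injective, so equality can be tested on the underlying trees.
@[fun_prop]
theorem eqb {f g : γ → α} (hf : PolyTime f) (hg : PolyTime g) :
    PolyTime (fun c => eqb (f c) (g c)) := by
  have h : PolyTime (fun c => (Enc.enc (f c), Enc.enc (g c))) := by fun_prop
  have : PolyTime (fun c => _root_.eqb (Enc.enc (f c)) (Enc.enc (g c))) := datum_eqb.comp h
  have heq : ∀ c, _root_.eqb (Enc.enc (f c)) (Enc.enc (g c)) = _root_.eqb (f c) (g c) := fun c => by
    rw [Bool.eq_iff_iff, eqb_iff, eqb_iff, Enc.inj.eq_iff]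
  simpa only [heq] using this

/-- Membership in a list. -/
noncomputable def _root_.memb {α : Type} (a : α) (l : List α) : Bool := l.any (_root_.eqb a)

@[simp] theorem _root_.memb_iff {α : Type} {a : α} {l : List α} : memb a l = true ↔ a ∈ l := by
  simp [memb]

@[fun_prop]
theorem memb {f : γ → α} {l : γ → List α} (hf : PolyTime f) (hl : PolyTime l) :
    PolyTime (fun c => memb (f c) (l c)) := by
  unfold _root_.memb
  fun_prop

end PolyTime

/-! ### Gaussian elimination over the field with two elements

A vector is given by the list of the coordinates that are one. -/

section Elimination

variable {α : Type}

/-- The sum of the unit vectors of the elements of a list. -/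
noncomputable def vec (l : List α) : α →₀ ZMod 2 := (l.map fun a => Finsupp.single a 1).sum

@[simp] theorem vec_nil : vec ([] : List α) = 0 := rfl

@[simp] theorem vec_cons (a : α) (l : List α) : vec (a :: l) = Finsupp.single a 1 + vec l := by
  simp [vec]

theorem vec_append (l l' : List α) : vec (l ++ l') = vec l + vec l' := by simp [vec]

theorem vec_perm {l l' : List α} (h : l.Perm l') : vec l = vec l' := (h.map _).sum_eq

/-- Replacing every entry by a list is extension by linearity on the level of vectors. For this
reason the table operations written with `flatMap` are linear maps. -/
theorem vec_flatMap {β : Type} (l : List α) (φ : α → List β) :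
    vec (l.flatMap φ) = Finsupp.linearCombination (ZMod 2) (fun a => vec (φ a)) (vec l) := by
  induction l with
  | nil => simp
  | cons a l ih => simp [vec_append, ih, Finsupp.linearCombination_single]

theorem vec_apply_of_not_mem {l : List α} {a : α} (h : a ∉ l) : vec l a = 0 := by
  induction l with
  | nil => rfl
  | cons b l ih =>
    simp only [List.mem_cons, not_or] at h
    simp [ih h.2, Ne.symm h.1]

theorem vec_apply_of_mem {l : List α} (hl : l.Nodup) {a : α} (h : a ∈ l) : vec l a = 1 := by
  induction l with
  | nil => simp at h
  | cons b l ih =>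
    rw [List.nodup_cons] at hl
    rcases List.mem_cons.1 h with rfl | h
    · simp [vec_apply_of_not_mem hl.1]
    · simp [ih hl.2 h, show b ≠ a from fun e => hl.1 (e ▸ h)]

theorem vec_apply_ne_zero {l : List α} (hl : l.Nodup) {a : α} : vec l a ≠ 0 ↔ a ∈ l := by
  by_cases h : a ∈ l
  · simp [vec_apply_of_mem hl h, h]
  · simp [vec_apply_of_not_mem h, h]

/-- Adding a unit vector. -/
noncomputable def toggle (l : List α) (m : α) : List α :=
  bif memb m l then l.filter (fun x => !eqb m x) else m :: l

theorem toggle_nodup {l : List α} (h : l.Nodup) (m : α) : (toggle l m).Nodup := by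
  unfold toggle
  cases hm : memb m l
  · have : m ∉ l := fun h => by rw [← memb_iff] at h; simp [h] at hm
    simp [this, h]
  · exact h.filter _

theorem vec_toggle {l : List α} (h : l.Nodup) (m : α) :
    vec (toggle l m) = vec l + Finsupp.single m 1 := by
  unfold toggle
  cases hm : memb m l
  · simp [add_comm]
  · have : l.Perm (m :: l.filter (fun x => !eqb m x)) := by
      refine (List.perm_ext_iff_of_nodup h ?_).2 fun a => ?_
      · simp [h.filter]
      · rw [memb_iff] at hm
        by_cases e : m = a
        · subst e; simp [hm]
        · have : eqb m a = false := by simp [eqb, e]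
          simp [this, Ne.symm e]
    rw [vec_perm this, vec_cons, add_comm, ← add_assoc, ← Finsupp.single_add]
    simp [CharTwo.add_self_eq_zero]

theorem toggle_subset (l : List α) (m : α) : toggle l m ⊆ m :: l := by
  unfold toggle
  cases memb m l
  · simp
  · exact fun a ha => List.mem_cons_of_mem _ (List.mem_filter.1 ha).1

/-- The same vector without repetitions. -/
noncomputable def cancelPairs (l : List α) : List α := l.foldl toggle []

theorem foldl_toggle (l : List α) : ∀ acc : List α, acc.Nodup → (l.foldl toggle acc).Nodup ∧
    vec (l.foldl toggle acc) = vec acc + vec l ∧ l.foldl toggle acc ⊆ acc ++ l := by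
  induction l with
  | nil => intro acc h; simp [h]
  | cons a l ih =>
    intro acc h
    obtain ⟨h1, h2, h3⟩ := ih _ (toggle_nodup h a)
    refine ⟨h1, ?_, fun x hx => ?_⟩
    · rw [List.foldl_cons, h2, vec_toggle h, vec_cons, add_assoc]
    · rcases List.mem_append.1 (h3 hx) with hx | hx
      · rcases List.mem_cons.1 (toggle_subset _ _ hx) with rfl | hx <;> simp_all
      · simp [hx]

theorem cancelPairs_nodup (l : List α) : (cancelPairs l).Nodup := (foldl_toggle l [] List.nodup_nil).1

theorem vec_cancelPairs (l : List α) : vec (cancelPairs l) = vec l := by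
  simpa [cancelPairs] using (foldl_toggle l [] List.nodup_nil).2.1

theorem cancelPairs_subset (l : List α) : cancelPairs l ⊆ l := by
  simpa [cancelPairs] using (foldl_toggle l [] List.nodup_nil).2.2

/-- Clearing the coordinate of `v` at the pivot of `b`. -/
noncomputable def elimStep (v b : List α) : List α :=
  b.head?.elim v fun p => bif memb p v then cancelPairs (v ++ b) else v

theorem elimStep_cases (v b : List α) :
    elimStep v b = v ∧ (∀ p, b.head? = some p → p ∉ v) ∨
      elimStep v b = cancelPairs (v ++ b) ∧ ∃ p, b.head? = some p ∧ p ∈ v := by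
  unfold elimStep
  cases b with
  | nil => simp
  | cons p b =>
    cases h : memb p v
    · left; simp [h, ← memb_iff]
    · right; simpa [h] using memb_iff.1 h

/-- Clearing the coordinates of `v` at the pivots of `B`. -/
noncomputable def eliminate (B : List (List α)) (v : List α) : List α := B.foldl elimStep v

/-- Either no row was added and v comes back unchanged, possibly with repetitions, or the last
addition passed through `cancelPairs`. This controls the size of the result without any echelon
assumption. -/
theorem eliminate_eq_or (B : List (List α)) (v : List α) :
    eliminate B v = v ∨ (eliminate B v).Nodup ∧ eliminate B v ⊆ v ++ B.flatten := by
  induction B generalizing v with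
  | nil => left; rfl
  | cons b B ih =>
    have step : elimStep v b = v ∨ (elimStep v b).Nodup ∧ elimStep v b ⊆ v ++ b := by
      rcases elimStep_cases v b with ⟨h, -⟩ | ⟨h, -⟩
      · exact .inl h
      · rw [h]; exact .inr ⟨cancelPairs_nodup _, cancelPairs_subset _⟩
    change eliminate B (elimStep v b) = v ∨ (eliminate B (elimStep v b)).Nodup ∧
      eliminate B (elimStep v b) ⊆ _
    rcases ih (elimStep v b) with h | ⟨h1, h2⟩
    · rw [h]
      rcases step with h | ⟨h1, h2⟩
      · exact .inl h
      · refine .inr ⟨h1, fun a ha => ?_⟩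
        have := h2 ha
        simp only [List.mem_append, List.flatten_cons] at this ⊢
        tauto
    · refine .inr ⟨h1, fun a ha => ?_⟩
      have h3 := h2 ha
      simp only [List.mem_append, List.flatten_cons] at h3 ⊢
      rcases step with h | ⟨-, h⟩
      · rw [h] at h3; tauto
      · rcases h3 with h3 | h3
        · have := h h3; simp only [List.mem_append] at this; tauto
        · tauto

theorem eliminate_nodup (B : List (List α)) {v : List α} (hv : v.Nodup) :
    (eliminate B v).Nodup := by
  rcases eliminate_eq_or B v with h | h
  · rwa [h]
  · exact h.1

theorem eliminate_subset (B : List (List α)) (v : List α) : eliminate B v ⊆ v ++ B.flatten := by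
  rcases eliminate_eq_or B v with h | h
  · rw [h]; simp
  · exact h.2

/-- The space spanned by a list of vectors. -/
noncomputable def tspan (T : List (List α)) : Submodule (ZMod 2) (α →₀ ZMod 2) :=
  Submodule.span _ (vec '' {v | v ∈ T})

theorem vec_mem_tspan {T : List (List α)} {v : List α} (h : v ∈ T) : vec v ∈ tspan T :=
  Submodule.subset_span ⟨v, h, rfl⟩

theorem tspan_mono {T T' : List (List α)} (h : T ⊆ T') : tspan T ≤ tspan T' :=
  Submodule.span_mono (Set.image_mono fun _ hv => h hv)

theorem tspan_le {T : List (List α)} {W : Submodule (ZMod 2) (α →₀ ZMod 2)} :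
    tspan T ≤ W ↔ ∀ v ∈ T, vec v ∈ W := by
  simp [tspan, Submodule.span_le, Set.subset_def]

theorem tspan_append (T T' : List (List α)) : tspan (T ++ T') = tspan T ⊔ tspan T' := by
  rw [tspan, tspan, tspan, ← Submodule.span_union, ← Set.image_union]
  congr 2; ext; simp

theorem vec_eliminate_sub_mem (B : List (List α)) (v : List α) :
    vec (eliminate B v) - vec v ∈ tspan B := by
  induction B generalizing v with
  | nil => simp [eliminate]
  | cons b B ih =>
    have h1 := tspan_mono (List.subset_cons_self b B) (ih (elimStep v b))
    have h2 : vec (elimStep v b) - vec v ∈ tspan (b :: B) := by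
      rcases elimStep_cases v b with ⟨h, -⟩ | ⟨h, -⟩
      · simp [h]
      · rw [h, vec_cancelPairs, vec_append, add_sub_cancel_left]
        exact vec_mem_tspan (by simp)
    have := add_mem h1 h2
    rwa [sub_add_sub_cancel] at this

/-- No list contains the pivot of an earlier one. -/
def Echelon (B : List (List α)) : Prop :=
  (∀ b ∈ B, b.Nodup ∧ b ≠ []) ∧ B.Pairwise fun b b' => ∀ p, b.head? = some p → p ∉ b'

/-- A pivot that has been cleared cannot return: the later steps only bring in coordinates of later
rows, and in echelon form these avoid the earlier pivots. -/
theorem pivot_not_mem_eliminate {B : List (List α)} (hB : Echelon B) (v : List α) (hv : v.Nodup) :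
    ∀ b ∈ B, ∀ p, b.head? = some p → p ∉ eliminate B v := by
  induction B generalizing v with
  | nil => simp
  | cons b B ih =>
    obtain ⟨h1, h2⟩ := hB
    rw [List.pairwise_cons] at h2
    have hstep : (elimStep v b).Nodup ∧ ∀ p, b.head? = some p → p ∉ elimStep v b := by
      rcases elimStep_cases v b with ⟨h, h'⟩ | ⟨h, p, hp, hpv⟩
      · rw [h]; exact ⟨hv, h'⟩
      · rw [h]
        refine ⟨cancelPairs_nodup _, fun p' hp' => ?_⟩
        obtain rfl : p = p' := by rw [hp] at hp'; simpa using hp'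
        have hpb : p ∈ b := List.mem_of_mem_head? hp
        rw [← vec_apply_ne_zero (cancelPairs_nodup _), vec_cancelPairs, vec_append, Finsupp.add_apply,
          vec_apply_of_mem hv hpv, vec_apply_of_mem (h1 b (by simp)).1 hpb]
        simp [CharTwo.add_self_eq_zero]
    intro b' hb' p hp
    rcases List.mem_cons.1 hb' with rfl | hb'
    · intro hmem
      rcases List.mem_append.1 (eliminate_subset B _ hmem) with h | h
      · exact hstep.2 p hp h
      · obtain ⟨c, hc, hpc⟩ := List.mem_flatten.1 h
        exact h2.1 c hc p hp hpc
    · exact ih ⟨fun b hb => h1 b (List.mem_cons_of_mem _ hb), h2.2⟩ _ hstep.1 b' hb' p hp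

/-- Adding a vector to a basis in echelon form. -/
noncomputable def insertVec (B : List (List α)) (v : List α) : List (List α) :=
  bif (eliminate B v).isEmpty then B else B ++ [eliminate B v]

theorem insertVec_cases (B : List (List α)) (v : List α) :
    insertVec B v = B ∧ eliminate B v = [] ∨
      insertVec B v = B ++ [eliminate B v] ∧ eliminate B v ≠ [] := by
  unfold insertVec
  cases h : eliminate B v <;> simp

/-- The remainder of v avoids all earlier pivots, so it may be appended as a new row; it differs
from v by an element of the span of B, so the span is the same as after adding v itself. -/
theorem insertVec_echelon {B : List (List α)} (hB : Echelon B) {v : List α} (hv : v.Nodup) :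
    Echelon (insertVec B v) ∧ tspan (insertVec B v) = tspan (v :: B) := by
  have hsub := vec_eliminate_sub_mem B v
  have hB' : B ⊆ v :: B := List.subset_cons_self v B
  rcases insertVec_cases B v with ⟨h, h'⟩ | ⟨h, h'⟩
  · rw [h]
    refine ⟨hB, le_antisymm (tspan_mono hB') (tspan_le.2 fun w hw => ?_)⟩
    rcases List.mem_cons.1 hw with rfl | hw
    · rw [h', vec_nil, zero_sub] at hsub
      simpa using hsub
    · exact vec_mem_tspan hw
  · rw [h]
    refine ⟨⟨fun b hb => ?_, ?_⟩, le_antisymm (tspan_le.2 fun w hw => ?_)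
      (tspan_le.2 fun w hw => ?_)⟩
    · rcases List.mem_append.1 hb with hb | hb
      · exact hB.1 b hb
      · rw [List.mem_singleton.1 hb]
        exact ⟨eliminate_nodup B hv, h'⟩
    · rw [List.pairwise_append]
      refine ⟨hB.2, by simp, fun b hb c hc => ?_⟩
      rw [List.mem_singleton.1 hc]
      exact pivot_not_mem_eliminate hB v hv b hb
    · rcases List.mem_append.1 hw with hw | hw
      · exact vec_mem_tspan (hB' hw)
      · rw [List.mem_singleton.1 hw]
        have := add_mem (tspan_mono hB' hsub) (vec_mem_tspan (List.mem_cons_self (a := v) (l := B)))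
        rwa [sub_add_cancel] at this
    · rcases List.mem_cons.1 hw with rfl | hw
      · have h1 : vec (eliminate B w) ∈ tspan (B ++ [eliminate B w]) := vec_mem_tspan (by simp)
        have := sub_mem h1 (tspan_mono (by simp) hsub)
        rwa [sub_sub_cancel] at this
      · exact vec_mem_tspan (by simp [hw])

/-- A basis in echelon form of the space spanned by a list of vectors. -/
noncomputable def reduceTable (T : List (List α)) : List (List α) :=
  T.foldl (fun B v => insertVec B (cancelPairs v)) []

theorem foldl_insertVec_echelon (T : List (List α)) : ∀ B, Echelon B →
    Echelon (T.foldl (fun B v => insertVec B (cancelPairs v)) B) ∧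
    tspan (T.foldl (fun B v => insertVec B (cancelPairs v)) B) = tspan (B ++ T) := by
  induction T with
  | nil => intro B hB; simpa using hB
  | cons v T ih =>
    intro B hB
    obtain ⟨h1, h2⟩ := insertVec_echelon hB (cancelPairs_nodup v)
    obtain ⟨h3, h4⟩ := ih _ h1
    refine ⟨h3, h4.trans ?_⟩
    have hv : tspan (cancelPairs v :: B) = tspan (v :: B) := by
      simp [tspan, Set.image_insert_eq, vec_cancelPairs, List.mem_cons,
        Set.ofPred_or]
    rw [tspan_append, h2, hv, ← tspan_append]
    refine le_antisymm (tspan_mono ?_) (tspan_mono ?_) <;> intro x hx <;>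
      simp only [List.mem_append, List.mem_cons] at hx ⊢ <;> tauto

theorem reduceTable_echelon (T : List (List α)) : Echelon (reduceTable T) :=
  (foldl_insertVec_echelon T [] (by simp [Echelon])).1

theorem tspan_reduceTable (T : List (List α)) : tspan (reduceTable T) = tspan T := by
  simpa [reduceTable] using (foldl_insertVec_echelon T [] (by simp [Echelon])).2

/-- A basis in echelon form has at most as many vectors as there are coordinates. -/
theorem Echelon.length_le {B : List (List α)} (hB : Echelon B) {S : Finset α}
    (hS : ∀ b ∈ B, ∀ a ∈ b, a ∈ S) : B.length ≤ S.card := by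
  classical
  -- The pivots are pairwise distinct, since a later row never contains an earlier pivot. They
  -- therefore inject the rows into S.
  have h1 : (B.map List.head?).Nodup := by
    rw [List.Nodup, List.pairwise_map]
    refine hB.2.imp_of_mem fun {b c} _ hc h e => ?_
    cases c with
    | nil => exact (hB.1 _ hc).2 rfl
    | cons p c => exact h p e (by simp)
  have h2 : (B.map List.head?).toFinset ⊆ S.image some := by
    intro o ho
    simp only [List.mem_toFinset, List.mem_map] at ho
    obtain ⟨b, hb, rfl⟩ := ho
    cases b with
    | nil => exact absurd rfl (hB.1 _ hb).2
    | cons p b => simpa using hS _ hb p (by simp)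
  have := (Finset.card_le_card h2).trans Finset.card_image_le
  rwa [List.toFinset_card_of_nodup h1, List.length_map] at this

/-- Bookkeeping for the running time only: it bounds the intermediate bases of the elimination for
an arbitrary list of vectors. -/
theorem foldl_insertVec_mem (T : List (List α)) : ∀ B L, (∀ b ∈ B, b.Nodup ∧ b ⊆ L) →
    (∀ v ∈ T, v ⊆ L) →
    (∀ b ∈ T.foldl (fun B v => insertVec B (cancelPairs v)) B, b.Nodup ∧ b ⊆ L) ∧
    (T.foldl (fun B v => insertVec B (cancelPairs v)) B).length ≤ B.length + T.length := by
  induction T with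
  | nil => intro B L hB _; exact ⟨hB, by simp⟩
  | cons v T ih =>
    intro B L hB hT
    have hlen : (insertVec B (cancelPairs v)).length ≤ B.length + 1 := by
      rcases insertVec_cases B (cancelPairs v) with ⟨h, -⟩ | ⟨h, -⟩ <;> simp [h]
    have := ih (insertVec B (cancelPairs v)) L (fun b hb => ?_) fun v hv =>
      hT v (List.mem_cons_of_mem _ hv)
    · refine ⟨this.1, this.2.trans ?_⟩
      simp; omega
    · rcases insertVec_cases B (cancelPairs v) with ⟨h, -⟩ | ⟨h, -⟩
      · exact hB b (h ▸ hb)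
      · rw [h] at hb
        rcases List.mem_append.1 hb with hb | hb
        · exact hB b hb
        · rw [List.mem_singleton.1 hb]
          refine ⟨eliminate_nodup _ (cancelPairs_nodup v), fun a ha => ?_⟩
          rcases List.mem_append.1 (eliminate_subset _ _ ha) with ha | ha
          · exact hT v (by simp) (cancelPairs_subset _ ha)
          · obtain ⟨c, hc, hac⟩ := List.mem_flatten.1 ha
            exact (hB c hc).2 hac

end Elimination

/-! ### Gaussian elimination in polynomial time -/

namespace PolyTime

variable {α γ : Type} [Enc α] [Enc γ]

@[fun_prop]
theorem toggle {l : γ → List α} {m : γ → α} (hl : PolyTime l) (hm : PolyTime m) :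
    PolyTime (fun c => toggle (l c) (m c)) := by
  unfold _root_.toggle
  fun_prop

@[fun_prop]
theorem cancelPairs {l : γ → List α} (hl : PolyTime l) : PolyTime (fun c => cancelPairs (l c)) := by
  obtain ⟨r, hr⟩ := hl.size_bound
  refine foldl (f := fun _ => _root_.toggle) hl (const []) (by fun_prop) r fun c l' h => ?_
  obtain ⟨h1, -, h3⟩ := foldl_toggle l' [] List.nodup_nil
  exact (esize_le_of_nodup_subset h1 (by simpa using h3)).trans
    ((esize_sublist h.sublist).trans (hr c))

@[fun_prop]
theorem elimStep {v b : γ → List α} (hv : PolyTime v) (hb : PolyTime b) :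
    PolyTime (fun c => elimStep (v c) (b c)) := by
  unfold _root_.elimStep
  fun_prop

@[fun_prop]
theorem eliminate {B : γ → List (List α)} {v : γ → List α} (hB : PolyTime B) (hv : PolyTime v) :
    PolyTime (fun c => eliminate (B c) (v c)) := by
  obtain ⟨r, hr⟩ := hv.size_bound
  obtain ⟨q, hq⟩ := hB.size_bound
  refine foldl (f := fun _ => _root_.elimStep) hB hv (by fun_prop) (r + q) fun c l' h => ?_
  have h2 := esize_append (v c) l'.flatten
  have h3 := esize_flatten_le l'
  have h4 := esize_sublist h.sublist
  have h5 := hr c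
  have h6 := hq c
  have h7 := one_le_esize l'.flatten
  rw [Polynomial.eval_add]
  rcases eliminate_eq_or l' (v c) with h | ⟨h, h'⟩
  · rw [← _root_.eliminate, h]; omega
  · have := esize_le_of_nodup_subset h h'
    rw [← _root_.eliminate]; omega

@[fun_prop]
theorem insertVec {B : γ → List (List α)} {v : γ → List α} (hB : PolyTime B) (hv : PolyTime v) :
    PolyTime (fun c => insertVec (B c) (v c)) := by
  unfold _root_.insertVec
  fun_prop

@[fun_prop]
theorem reduceTable {T : γ → List (List α)} (hT : PolyTime T) :
    PolyTime (fun c => reduceTable (T c)) := by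
  obtain ⟨r, hr⟩ := hT.size_bound
  -- An intermediate basis has at most r rows, and each row is free of repetitions with entries from
  -- the flattened table, hence has size at most r.
  refine foldl (f := fun _ B v => _root_.insertVec B (_root_.cancelPairs v)) hT (const [])
    (by fun_prop) (r * (r + 1) + 1) fun c l' h => ?_
  obtain ⟨h1, h2⟩ := foldl_insertVec_mem l' [] l'.flatten (by simp) fun v hv a ha =>
    List.mem_flatten.2 ⟨v, hv, ha⟩
  have h3 := (esize_sublist h.sublist).trans (hr c)
  refine (esize_list_le (m := r.eval (esize c)) fun b hb => ?_).trans ?_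
  · exact (esize_le_of_nodup_subset (h1 b hb).1 (h1 b hb).2).trans ((esize_flatten_le _).trans h3)
  · have h4 := (length_le_esize l').trans h3
    have := Nat.mul_le_mul_right (r.eval (esize c) + 1) (h2.trans (by simpa using h4))
    simpa using this

end PolyTime

/-! ### The operations of the dynamic program -/

/-- A colouring of the vertices: for every vertex its side of the cut, or `none` if it is not
selected. -/
abbrev Coloring := List (Datum × Option Bool)

/-- A number of forgotten vertices, a number of forgotten edges, and a colouring of the bag. -/
abbrev Mon := ℕ × ℕ × Coloring

/-- The tables of the dynamic program. -/
abbrev Table := List (List Mon)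

/-- The vertices, the edges, the terminals, and the distinguished terminal. -/
abbrev Context := (List Datum × List Datum) × List Datum × Datum

/-- Changing the colour of one vertex. -/
noncomputable def recolor (u : Datum) (a : Option Bool) (χ : Coloring) : Coloring :=
  χ.map fun p => (p.1, bif eqb p.1 u then a else p.2)

/-- Selecting the new vertex `u`. -/
noncomputable def introMon (r u : Datum) (m : Mon) : List Mon :=
  (m.1, m.2.1, recolor u (some true) m.2.2) ::
    (bif eqb u r then [] else [(m.1, m.2.1, recolor u (some false) m.2.2)])

/-- The vectors for an introduce node. -/
noncomputable def introTable (c : Context) (u : Datum) (T : Table) : Table :=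
  (bif memb u c.2.1 then [] else T) ++ T.map fun v => v.flatMap (introMon c.2.2 u)

/-- The selected neighbours of `u`, with their colours. -/
noncomputable def selectedNeighbors (E : List Datum) (u : Datum) (χ : Coloring) : Coloring :=
  χ.filter fun p => memb (Datum.cons u p.1) E && !eqb p.2 none

/-- Forgetting the vertex `u`. -/
noncomputable def forgetMon (E : List Datum) (u : Datum) (m : Mon) : List Mon :=
  bif memb (u, none) m.2.2 then [m] else
    bif (selectedNeighbors E u m.2.2).any fun p => !memb (u, p.2) m.2.2 then [] else
      [(m.1 + 1, m.2.1 + (selectedNeighbors E u m.2.2).length, recolor u none m.2.2)]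

/-- The vectors for a forget node. -/
noncomputable def forgetTable (E : List Datum) (u : Datum) (T : Table) : Table :=
  T.map fun v => v.flatMap (forgetMon E u)

/-- The product of two monomials. -/
noncomputable def joinMon (m m' : Mon) : List Mon :=
  bif eqb m.2.2 m'.2.2 then [(m.1 + m'.1, m.2.1 + m'.2.1, m.2.2)] else []

/-- The vectors for a join node. -/
noncomputable def joinTable (T T' : Table) : Table :=
  T.flatMap fun v => T'.map fun w => v.flatMap fun m => w.flatMap fun m' => joinMon m m'

/-- The vectors for a leaf. -/
def leafTable (vs : List Datum) : Table := [[(0, 0, vs.map fun v => (v, none))]]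

/-- The vectors for a node with one child, given its bag and the bag of its child. -/
noncomputable def unaryTable (c : Context) (B B' : List Datum) (T : Table) : Table :=
  (B.filter fun u => !memb u B').head?.elim
    ((B'.filter fun u => !memb u B).head?.elim T fun u => forgetTable c.1.2 u T)
    fun u => introTable c u T

/-- The table of a node, given its bag, the bag of its first child, and the tables of its
children. -/
noncomputable def nodeTable (c : Context) (B B' : List Datum) (Ts : List Table) : Table :=
  reduceTable <| Ts.head?.elim (leafTable c.1.1) fun T =>
    Ts.tail.head?.elim (unaryTable c B B' T) fun T' => joinTable T T'

/-- Every operation of the dynamic program is built from list operations already known to be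
polynomial; the argument contains the child tables, so the time is polynomial in their size and not
in n alone. -/
theorem polyTime_nodeTable : PolyTime (fun p : Context × List Datum × List Datum × List Table =>
    nodeTable p.1 p.2.1 p.2.2.1 p.2.2.2) := by
  unfold nodeTable joinTable joinMon unaryTable forgetTable forgetMon selectedNeighbors introTable
    introMon recolor leafTable
  fun_prop

/-! ### Binary numbers -/

/-- The successor of a binary number. -/
def incBits (l : List Bool) : List Bool :=
  let s := l.foldl (fun (s : Bool × List Bool) b => (s.1 && b, s.2 ++ [bif s.1 then !b else b]))
    (true, [])
  bif s.1 then s.2 ++ [true] else s.2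

theorem foldl_false_incBits (l : List Bool) : ∀ acc,
    l.foldl (fun (s : Bool × List Bool) b => (s.1 && b, s.2 ++ [bif s.1 then !b else b]))
    (false, acc) = (false, acc ++ l) := by
  induction l with
  | nil => simp
  | cons b l ih => intro acc; simp [ih]

/-- The accumulator is appended to and never inspected, so it can be split off. This gives `incBits`
its recursion on the digits. -/
theorem foldl_incBits_append (l : List Bool) : ∀ c acc,
    l.foldl (fun (s : Bool × List Bool) b => (s.1 && b, s.2 ++ [bif s.1 then !b else b]))
    (c, acc) = ((l.foldl (fun (s : Bool × List Bool) b =>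
      (s.1 && b, s.2 ++ [bif s.1 then !b else b])) (c, [])).1,
      acc ++ (l.foldl (fun (s : Bool × List Bool) b =>
      (s.1 && b, s.2 ++ [bif s.1 then !b else b])) (c, [])).2) := by
  induction l with
  | nil => simp
  | cons b l ih =>
    intro c acc
    rw [List.foldl_cons, List.foldl_cons, ih, ih _ ([] ++ _)]
    simp

theorem incBits_nil : incBits [] = [true] := rfl

theorem incBits_false (l : List Bool) : incBits (false :: l) = true :: l := by
  simp [incBits, foldl_false_incBits]

theorem incBits_true (l : List Bool) : incBits (true :: l) = false :: incBits l := by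
  unfold incBits
  simp only [List.foldl_cons]
  rw [foldl_incBits_append]
  simp only [Bool.and_self]
  generalize l.foldl (fun (s : Bool × List Bool) b =>
      (s.1 && b, s.2 ++ [bif s.1 then !b else b])) (true, []) = s
  cases h : s.1 <;> simp

/-- A digit zero absorbs the carry and a digit one passes it on. -/
theorem incBits_bits (n : ℕ) : incBits n.bits = (n + 1).bits := by
  induction n using Nat.binaryRec' with
  | zero => simp [incBits_nil]
  | bit b n h ih =>
    rw [Nat.bits_append_bit n b h]
    cases b
    · rw [incBits_false, Nat.bit_false, ← Nat.bit1_bits]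
    · rw [incBits_true, ih, Nat.bit_true, show 2 * n + 1 + 1 = 2 * (n + 1) by ring,
        Nat.bit0_bits _ (by omega)]

theorem length_foldl_incBits (l : List Bool) (s : Bool × List Bool) :
    (l.foldl (fun (s : Bool × List Bool) b => (s.1 && b, s.2 ++ [bif s.1 then !b else b])) s).2.length
      = s.2.length + l.length := by
  induction l generalizing s with
  | nil => simp
  | cons b l ih => simp [ih]; omega

theorem length_incBits_le (l : List Bool) : (incBits l).length ≤ l.length + 1 := by
  have := length_foldl_incBits l (true, [])
  unfold incBits
  generalize l.foldl (fun (s : Bool × List Bool) b =>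
      (s.1 && b, s.2 ++ [bif s.1 then !b else b])) (true, []) = s at this
  cases h : s.1 <;> simp [h] at this ⊢ <;> omega

theorem esize_bits_le (l : List Bool) : esize l ≤ 4 * l.length + 1 := by
  have := esize_list_le (l := l) (m := 3) fun b _ => esize_bool b
  omega

/-- Repeated increments, with the information whether the number `target` has been passed. -/
noncomputable def countUp (k : ℕ) (target start : List Bool) : List Bool × Bool :=
  (List.replicate k ()).foldl (fun s _ => (incBits s.1, s.2 || eqb s.1 target)) (start, false)

/-- The target is compared before each increment, so m + k itself is not tested. Started at zero,
the flag tells whether the target is smaller than k. -/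
theorem countUp_bits (k : ℕ) (t : List Bool) (m : ℕ) : countUp k t m.bits =
    ((m + k).bits, open Classical in decide (∃ j < k, (m + j).bits = t)) := by
  classical
  have key : ∀ b, (List.replicate k ()).foldl
      (fun s _ => (incBits s.1, s.2 || eqb s.1 t)) (m.bits, b) =
      ((m + k).bits, b || decide (∃ j < k, (m + j).bits = t)) := by
    induction k generalizing m with
    | zero => intro b; simp
    | succ k ih =>
      intro b
      rw [List.replicate_succ, List.foldl_cons, incBits_bits, ih]
      rw [show m + 1 + k = m + (k + 1) by ring, Bool.or_assoc]
      congr 2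
      rw [Bool.eq_iff_iff, Bool.or_eq_true, eqb_iff, decide_eq_true_eq, decide_eq_true_eq]
      constructor
      · rintro (h | ⟨j, hj, h⟩)
        · exact ⟨0, by omega, h⟩
        · exact ⟨j + 1, by omega, by rw [← h]; congr 1; ring⟩
      · rintro ⟨_ | j, hj, h⟩
        · exact .inl h
        · exact .inr ⟨j, by omega, by rw [← h]; congr 1; ring⟩
  simpa [countUp] using key false

/-- Needed for truncated digit strings: these may end in zeros and then are not the canonical digits
of any number, so only their length is available for an argument. -/
theorem le_length_countUp (k : ℕ) (t l : List Bool) : l.length ≤ (countUp k t l).1.length := by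
  have key : ∀ s : List Bool × Bool, s.1.length ≤ ((List.replicate k ()).foldl
      (fun s _ => (incBits s.1, s.2 || eqb s.1 t)) s).1.length := by
    induction k with
    | zero => intro s; simp
    | succ k ih =>
      intro s
      rw [List.replicate_succ, List.foldl_cons]
      refine le_trans ?_ (ih _)
      have := length_foldl_incBits s.1 (true, [])
      dsimp only
      unfold incBits
      generalize s.1.foldl (fun (s : Bool × List Bool) b =>
        (s.1 && b, s.2 ++ [bif s.1 then !b else b])) (true, []) = s' at this
      cases h : s'.1 <;> simp [h] at this ⊢ <;> omega
  exact key (l, false)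

theorem PolyTime.incBits {γ : Type} [Enc γ] {l : γ → List Bool} (hl : PolyTime l) :
    PolyTime (fun c => incBits (l c)) := by
  obtain ⟨r, hr⟩ := hl.size_bound
  have : PolyTime (fun c => (l c).foldl (fun (s : Bool × List Bool) b =>
      (s.1 && b, s.2 ++ [bif s.1 then !b else b])) (true, [])) := by
    refine foldl (f := fun _ (s : Bool × List Bool) b => (s.1 && b, s.2 ++ [bif s.1 then !b else b]))
      hl (const (true, [])) (by fun_prop) (4 * r + 6) fun c l' h => ?_
    have h1 := length_foldl_incBits l' (true, [])
    generalize l'.foldl (fun (s : Bool × List Bool) b =>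
      (s.1 && b, s.2 ++ [bif s.1 then !b else b])) (true, []) = s at h1
    have h2 := esize_bits_le s.2
    have h3 := esize_bool s.1
    have h4 := (length_le_esize l').trans ((esize_sublist h.sublist).trans (hr c))
    have h5 : esize s = esize s.1 + esize s.2 + 1 := rfl
    simp at h1 ⊢
    omega
  unfold _root_.incBits
  fun_prop

attribute [fun_prop] PolyTime.incBits

theorem length_countUp (l : List Unit) (target : List Bool) (s : List Bool × Bool) :
    (l.foldl (fun s _ => (incBits s.1, s.2 || eqb s.1 target)) s).1.length ≤
      s.1.length + l.length := by
  induction l generalizing s with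
  | nil => simp
  | cons b l ih =>
    have h1 := ih (incBits s.1, s.2 || eqb s.1 target)
    have := length_incBits_le s.1
    simp at h1 ⊢
    omega

@[fun_prop]
theorem PolyTime.countUp {γ : Type} [Enc γ] {k : γ → ℕ} {t s : γ → List Bool} (hk : PolyTime k)
    (ht : PolyTime t) (hs : PolyTime s) : PolyTime (fun c => countUp (k c) (t c) (s c)) := by
  have hk' := replicate hk
  obtain ⟨r, hr⟩ := hk'.size_bound
  obtain ⟨q, hq⟩ := hs.size_bound
  refine foldl (f := fun c (s : List Bool × Bool) _ => (_root_.incBits s.1, s.2 || _root_.eqb s.1 (t c))) 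
    (b := fun c => (s c, false)) hk' (by fun_prop) (by fun_prop) (4 * q + 4 * r + 6) fun c l' h => ?_
  have h1 := length_countUp l' (t c) (s c, false)
  generalize l'.foldl (fun (s : List Bool × Bool) _ => 
    (_root_.incBits s.1, s.2 || _root_.eqb s.1 (t c))) (s c, false) = s' at h1
  have h2 := esize_bits_le s'.1
  have h3 := esize_bool s'.2
  have h4 := (length_le_esize l').trans ((esize_sublist h.sublist).trans (hr c))
  have h5 : esize s' = esize s'.1 + esize s'.2 + 1 := rfl
  have h6 := (length_le_esize (s c)).trans (hq c)
  simp at h1 ⊢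
  omega

/-! ### Acceptance tests on monomials -/

/-- The test of a monomial for Light Connecting Induced Subgraph. The absolute values of the two
integers are given with the most significant digit first. -/
noncomputable def lightMon (k : ℕ) (a b : Bool × List Bool) (m : Mon) : Bool :=
  (!a.1 && eqb (countUp k [] a.2.reverse).1 (countUp m.1 [] []).1) &&
    (!b.1 && !(countUp m.2.1 b.2.reverse []).2)

/-- Does the table have a suitable monomial? -/
noncomputable def lightTest (K : List Datum) (a b : Bool × List Bool) (T : Table) : Bool :=
  T.any fun v => v.any fun m => lightMon K.length a b m

/-- Does the table have a monomial of a tree? -/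
noncomputable def treeTest (T : Table) : Bool :=
  T.any fun v => v.any fun m => eqb (m.2.1 + 1) m.1

theorem polyTime_lightTest : PolyTime
    (fun p : List Datum × (Bool × List Bool) × (Bool × List Bool) × Table =>
      lightTest p.1 p.2.1 p.2.2.1 p.2.2.2) := by
  unfold lightTest lightMon
  fun_prop

theorem polyTime_treeTest : PolyTime treeTest := by
  unfold treeTest
  fun_prop

/-- A list that is long enough for the digits of the relevant integers. -/
def digitBound (c : Context) : List Datum := Datum.nil :: (c.1.1 ++ c.1.1)

theorem polyTime_digitBound : PolyTime digitBound := by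
  unfold digitBound
  fun_prop

theorem bits_injective : Function.Injective Nat.bits := fun a b h => by
  have key : ∀ n : ℕ, (n.bits).foldr Nat.bit 0 = n := fun n => by
    induction n using Nat.binaryRec' with
    | zero => simp
    | bit b n h ih => rw [Nat.bits_append_bit n b h, List.foldr_cons, ih]
  rw [← key a, h, key]

theorem length_bits_le {m n : ℕ} : m.bits.length ≤ n ↔ m < 2 ^ n := by
  rw [Nat.size_eq_bits_len, Nat.size_le]

/-- An integer with at most d digits is not changed by the truncation. One with more digits keeps
exactly d, which is more than the numbers it is compared with can have: at most n digits for m.1, at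
most 2n for the numbers below m.2.1. Since k ≤ m.1, the required equation forces ℓ to be
nonnegative, and the inequality for f says that f is nonnegative and is not met when counting from
zero through the numbers below m.2.1. -/
theorem lightMon_iff {n k d : ℕ} {m : Mon} (hs : m.1 ≤ n) (hk : k ≤ m.1) (he : m.2.1 ≤ n * n)
    (hd : 2 * n + 1 ≤ d) (ℓ f : ℤ) :
    lightMon k (decide (ℓ < 0), (ℓ.natAbs.bits.take d).reverse)
      (decide (f < 0), (f.natAbs.bits.take d).reverse) m = true ↔
      (m.1 : ℤ) = ℓ + k ∧ (m.2.1 : ℤ) ≤ f := by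
  classical
  have hnd : n < 2 ^ d := Nat.lt_two_pow_self.trans_le (Nat.pow_le_pow_right (by omega) (by omega))
  have hnn : n * n < 2 ^ (2 * n) := by
    have : n < 2 ^ n := Nat.lt_two_pow_self
    rw [two_mul, pow_add]
    exact Nat.mul_lt_mul'' this this
  have hnnd : 2 ^ (2 * n) ≤ 2 ^ d := Nat.pow_le_pow_right (by omega) (by omega)
  unfold lightMon
  simp only [List.reverse_reverse, Bool.and_eq_true, Bool.not_eq_true', decide_eq_false_iff_not,
    not_lt, eqb_iff]
  have h0 : ([] : List Bool) = (0 : ℕ).bits := by simp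
  have hbits : (countUp m.1 [] []).1 = m.1.bits := by
    rw [show countUp m.1 [] [] = countUp m.1 [] (0 : ℕ).bits by rw [← h0], countUp_bits, zero_add]
  have hinj : ∀ a b : ℕ, a.bits = b.bits ↔ a = b := fun a b => bits_injective.eq_iff
  rw [hbits]
  refine and_congr ?_ ?_
  · by_cases hl : ℓ.natAbs.bits.length ≤ d
    · rw [List.take_of_length_le hl, countUp_bits, hinj]
      omega
    -- The truncated string has exactly d digits and counting up never shortens it, so it cannot
    -- become the digit string of m.1; the equation itself fails because ℓ is too large in absolute
    -- value.
    · have h1 := le_length_countUp k [] (ℓ.natAbs.bits.take d)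
      have h2 : ¬ ℓ.natAbs < 2 ^ d := fun h => hl (length_bits_le.2 h)
      have h3 : m.1.bits.length ≤ n := length_bits_le.2 (hs.trans_lt Nat.lt_two_pow_self)
      constructor
      · rintro ⟨-, h⟩
        rw [h, List.length_take] at h1
        omega
      · intro h; omega
  · have hrw : countUp m.2.1 (f.natAbs.bits.take d) [] =
        countUp m.2.1 (f.natAbs.bits.take d) (0 : ℕ).bits := by rw [← h0]
    rw [hrw, countUp_bits]
    simp only [zero_add, decide_eq_false_iff_not, not_exists, not_and]
    by_cases hl : f.natAbs.bits.length ≤ d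
    · rw [List.take_of_length_le hl]
      simp only [hinj]
      constructor
      · rintro ⟨h1, h2⟩
        by_contra hc
        exact h2 f.natAbs (by omega) rfl
      · intro h
        exact ⟨by omega, fun j hj hjf => by omega⟩
    · have h2 : ¬ f.natAbs < 2 ^ d := fun h => hl (length_bits_le.2 h)
      have h3 : ∀ j < m.2.1, ¬ j.bits = f.natAbs.bits.take d := by
        intro j hj h
        have h4 : j.bits.length ≤ 2 * n := length_bits_le.2 (by omega)
        rw [h, List.length_take] at h4
        omega
      constructor
      · rintro ⟨h, -⟩; omega
      · intro h; exact ⟨by omega, h3⟩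

/-! ### Consistent cuts -/

section Cuts

variable {n : ℕ}

theorem Datum.ofNat_injective : Function.Injective Datum.ofNat := fun a b h => by
  have h1 : a.bits = b.bits := by
    have : Enc.enc a.bits = Enc.enc b.bits := h
    exact Enc.inj this
  exact bits_injective h1

/-- The name of a vertex. -/
def vname (v : Fin n) : Datum := Datum.ofNat v

theorem vname_injective : Function.Injective (vname (n := n)) := fun _ _ h =>
  Fin.ext (Datum.ofNat_injective h)

@[simp] theorem vname_inj {u v : Fin n} : vname u = vname v ↔ u = v := vname_injective.eq_iff

/-- A colouring, as it is represented in the tables. -/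
def code (χ : Fin n → Option Bool) : Coloring := (List.finRange n).map fun v => (vname v, χ v)

theorem mem_code {χ : Fin n → Option Bool} {u : Fin n} {a : Option Bool} :
    (vname u, a) ∈ code χ ↔ χ u = a := by
  simp [code]

theorem code_injective : Function.Injective (code (n := n)) := fun χ ψ h => by
  funext v
  have : (vname v, χ v) ∈ code ψ := h ▸ mem_code.2 rfl
  exact (mem_code.1 this).symm

theorem recolor_code (χ : Fin n → Option Bool) (u : Fin n) (a : Option Bool) :
    recolor (vname u) a (code χ) = code (Function.update χ u a) := by
  unfold recolor code
  rw [List.map_map]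
  refine List.map_congr_left fun v _ => ?_
  by_cases h : v = u
  · subst h; simp
  · have : eqb (vname v) (vname u) = false := by simp [eqb, h]
    simp [this, h]

variable (G : SimpleGraph (Fin n)) (r : Fin n)

open Classical in
/-- The edges of a graph, as they are represented in the input. -/
noncomputable def edgeList : List Datum :=
  (((List.finRange n).product (List.finRange n)).filter fun e => decide (G.Adj e.1 e.2)).map
    fun e => Datum.cons (vname e.1) (vname e.2)

theorem mem_edgeList {u v : Fin n} : Datum.cons (vname u) (vname v) ∈ edgeList G ↔ G.Adj u v := by
  simp [edgeList, List.product]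

open Classical in
theorem selectedNeighbors_code (χ : Fin n → Option Bool) (u : Fin n) :
    selectedNeighbors (edgeList G) (vname u) (code χ) = ((List.finRange n).filter fun w =>
      decide (G.Adj u w ∧ χ w ≠ none)).map fun w => (vname w, χ w) := by
  unfold selectedNeighbors code
  rw [List.filter_map]
  congr 1
  refine List.filter_congr fun w _ => ?_
  rw [Bool.eq_iff_iff]
  simp [mem_edgeList, eqb]

open Classical in
theorem length_selectedNeighbors (χ : Fin n → Option Bool) (u : Fin n) :
    (selectedNeighbors (edgeList G) (vname u) (code χ)).length =
      (Finset.univ.filter fun w => G.Adj u w ∧ χ w ≠ none).card := by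
  rw [selectedNeighbors_code, List.length_map]
  rw [← List.toFinset_card_of_nodup ((List.nodup_finRange n).filter _)]
  congr 1
  ext; simp

theorem any_selectedNeighbors (χ : Fin n → Option Bool) (u : Fin n) :
    ((selectedNeighbors (edgeList G) (vname u) (code χ)).any fun p =>
      !memb (vname u, p.2) (code χ)) = true ↔ ∃ w, G.Adj u w ∧ χ w ≠ none ∧ χ u ≠ χ w := by
  rw [selectedNeighbors_code]
  simp only [List.any_map, List.any_eq_true, List.mem_filter, List.mem_finRange, true_and,
    decide_eq_true_eq, Function.comp_apply, Bool.not_eq_true', Bool.eq_false_iff, ne_eq, memb_iff,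
    mem_code, and_assoc]

/-- The part of a colouring in a bag. -/
def restrict (Y : Finset (Fin n)) (χ : Fin n → Option Bool) : Fin n → Option Bool :=
  fun v => if v ∈ Y then χ v else none

/-- The edges inside `S` that are not inside `Y`. -/
noncomputable def outerEdges (Y S : Finset (Fin n)) : Finset (Sym2 (Fin n)) :=
  open Classical in Finset.univ.filter fun e => e ∈ G.edgeSet ∧ (∀ v ∈ e, v ∈ S) ∧ ¬ ∀ v ∈ e, v ∈ Y

theorem mem_outerEdges {Y S : Finset (Fin n)} {a b : Fin n} : s(a, b) ∈ outerEdges G Y S ↔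
    G.Adj a b ∧ (a ∈ S ∧ b ∈ S) ∧ ¬ (a ∈ Y ∧ b ∈ Y) := by
  simp [outerEdges]

/-- The cuts of `S` that no edge outside the bag `Y` crosses, with `r` on a fixed side. -/
noncomputable def cuts (Y S : Finset (Fin n)) : Finset (Fin n → Option Bool) :=
  open Classical in Finset.univ.filter fun χ => (∀ v, v ∈ S ↔ χ v ≠ none) ∧
    (r ∈ S → χ r = some true) ∧
    ∀ u v, G.Adj u v → u ∈ S → v ∈ S → ¬ (u ∈ Y ∧ v ∈ Y) → χ u = χ v

theorem mem_cuts {Y S : Finset (Fin n)} {χ : Fin n → Option Bool} : χ ∈ cuts G r Y S ↔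
    (∀ v, v ∈ S ↔ χ v ≠ none) ∧ (r ∈ S → χ r = some true) ∧
    ∀ u v, G.Adj u v → u ∈ S → v ∈ S → ¬ (u ∈ Y ∧ v ∈ Y) → χ u = χ v := by
  simp [cuts]

/-- The monomial of a cut of `S` at a node with the bag `Y`. -/
noncomputable def mon (Y S : Finset (Fin n)) (χ : Fin n → Option Bool) : Mon :=
  ((S \ Y).card, (outerEdges G Y S).card, code (restrict Y χ))

/-- The sum of the monomials of all cuts of `S`. -/
noncomputable def cutVec (Y S : Finset (Fin n)) : Mon →₀ ZMod 2 :=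
  ∑ χ ∈ cuts G r Y S, Finsupp.single (mon G Y S χ) 1

/-- The linear map given by its values on the monomials. -/
noncomputable def lin {α β : Type} (φ : α → List β) : (α →₀ ZMod 2) →ₗ[ZMod 2] (β →₀ ZMod 2) :=
  Finsupp.linearCombination (ZMod 2) fun a => vec (φ a)

theorem lin_cutVec (φ : Mon → List Mon) (Y S : Finset (Fin n)) :
    lin φ (cutVec G r Y S) = ∑ χ ∈ cuts G r Y S, vec (φ (mon G Y S χ)) := by
  simp [lin, cutVec, Finsupp.linearCombination_single]

/-! ### The effect of introduce, forget and join on the vectors of cuts -/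

variable {G r}

/-- No edge inside S touches u, and u has colour `none` in every cut of S, so it makes no difference
whether u is in the bag. -/
theorem cutVec_insert_of_not_mem {Y S : Finset (Fin n)} {u : Fin n} (hS : u ∉ S) :
    cutVec G r (insert u Y) S = cutVec G r Y S := by
  have h1 : cuts G r (insert u Y) S = cuts G r Y S := by
    ext χ
    rw [mem_cuts, mem_cuts]
    refine and_congr_right fun _ => and_congr_right fun _ => ?_
    refine forall₄_congr fun a b _ ha => forall_congr' fun hb => ?_
    have h1 : a ≠ u := fun h => hS (h ▸ ha)
    have h2 : b ≠ u := fun h => hS (h ▸ hb)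
    simp [h1, h2]
  unfold cutVec
  rw [h1]
  refine Finset.sum_congr rfl fun χ hχ => ?_
  congr 1
  unfold mon
  refine Prod.ext ?_ (Prod.ext ?_ ?_)
  · dsimp only
    congr 1
    ext v
    have : v ∈ S → v ≠ u := fun h e => hS (e ▸ h)
    simp; tauto
  · dsimp only
    congr 1
    ext e
    induction e with | _ a b => ?_
    have h1 : a ∈ S → a ≠ u := fun h e => hS (e ▸ h)
    have h2 : b ∈ S → b ≠ u := fun h e => hS (e ▸ h)
    rw [mem_outerEdges, mem_outerEdges]
    simp; tauto
  · dsimp only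
    congr 1
    funext v
    have hu : χ u = none := by
      have := ((mem_cuts _ _).1 hχ).1 u
      simpa [hS] using this
    by_cases hv : v = u
    · subst hv; simp [restrict, hu]
    · simp [restrict, hv]

/-- A new vertex may take either side of the cut, except that r is tied to its fixed side. -/
theorem vec_introMon (u : Fin n) (s e : ℕ) (χ : Fin n → Option Bool) :
    vec (introMon (vname r) (vname u) (s, e, code χ)) =
      ∑ a ∈ Finset.univ.filter fun a : Bool => u = r → a = true,
        Finsupp.single (s, e, code (Function.update χ u (some a))) 1 := by
  unfold introMon
  simp only [recolor_code]
  by_cases h : u = r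
  · subst h; simp [Finset.filter_eq']
  · have : eqb (vname u) (vname r) = false := by simp [eqb, h]
    simp [this, h]

/-- By `hadj` every edge from u to S stays inside the bag. So u neither adds a constraint nor an
outer edge, and a cut of the enlarged set is a cut of S together with a free choice of colour for u.
-/
theorem cutVec_insert {Y S : Finset (Fin n)} {u : Fin n} (hS : u ∉ S) (hY : u ∉ Y)
    (hadj : ∀ v ∈ S, v ∉ Y → ¬ G.Adj v u) :
    cutVec G r (insert u Y) (insert u S) = lin (introMon (vname r) (vname u)) (cutVec G r Y S) := by
  have hmon : ∀ χ a, mon G (insert u Y) (insert u S) (Function.update χ u (some a)) =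
      ((S \ Y).card, (outerEdges G Y S).card, code (Function.update (restrict Y χ) u (some a))) := by
    intro χ a
    unfold mon
    refine Prod.ext ?_ (Prod.ext ?_ ?_)
    · dsimp only
      congr 1
      ext v
      by_cases hv : v = u
      · subst hv; simp [hS]
      · simp [hv]
    · dsimp only
      congr 1
      ext e
      induction e with | _ a b => ?_
      rw [mem_outerEdges, mem_outerEdges]
      by_cases h1 : a = u
      · subst h1
        have := fun h h' => hadj b h h'
        simp only [G.adj_comm b a] at this
        by_cases h2 : b = a
        · subst h2; simp
        · simp [hS, h2]; tauto
      · by_cases h2 : b = u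
        · subst h2
          have := fun h h' => hadj a h h'
          simp [hS, h1]; tauto
        · simp [h1, h2]
    · dsimp only
      congr 1
      funext v
      by_cases hv : v = u
      · subst hv; simp [restrict]
      · simp [restrict, hv]
  rw [lin_cutVec]
  unfold cutVec
  simp only [mon, vec_introMon]
  rw [← Finset.sum_product']
  symm
  -- The default in `getD` is never used: in a cut of `insert u S` the vertex u has a colour.
  refine Finset.sum_bij' (fun p _ => Function.update p.1 u (some p.2))
    (fun χ _ => (Function.update χ u none, (χ u).getD false)) ?_ ?_ ?_ ?_ ?_
  · rintro ⟨χ, a⟩ h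
    rw [Finset.mem_product, mem_cuts, Finset.mem_filter] at h
    obtain ⟨⟨h1, h2, h3⟩, -, h4⟩ := h
    rw [mem_cuts]
    refine ⟨fun v => ?_, fun hr => ?_, fun v w hvw hv hw hvw' => ?_⟩
    · by_cases hv : v = u
      · subst hv; simp
      · simp [hv, h1]
    · by_cases hru : r = u
      · simpa [hru] using h4 hru.symm
      · simp only [Function.update_of_ne hru]
        exact h2 (by simpa [hru] using hr)
    · have hne := hvw.ne
      by_cases hv' : v = u
      · subst hv'
        have h5 : w ∈ S := by simpa [hne.symm] using hw
        exact absurd hvw.symm (hadj w h5 (by simpa [hne.symm] using hvw'))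
      · by_cases hw' : w = u
        · subst hw'
          have h5 : v ∈ S := by simpa [hne] using hv
          exact absurd hvw (hadj v h5 (by simpa [hne] using hvw'))
        · simp [hv', hw'] at hv hw hvw' ⊢
          exact h3 v w hvw hv hw (by tauto)
  · intro χ h
    rw [mem_cuts] at h
    obtain ⟨h1, h2, h3⟩ := h
    rw [Finset.mem_product, mem_cuts, Finset.mem_filter]
    refine ⟨⟨fun v => ?_, fun hr => ?_, fun v w hvw hv hw hvw' => ?_⟩, Finset.mem_univ _, ?_⟩
    · by_cases hv : v = u
      · subst hv; simp [hS]
      · have := h1 v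
        simpa [hv] using this
    · have hru : r ≠ u := fun h => hS (h ▸ hr)
      simpa [hru] using h2 (by simp [hr])
    · have h4 : v ≠ u := fun h => hS (h ▸ hv)
      have h5 : w ≠ u := fun h => hS (h ▸ hw)
      simpa [h4, h5] using h3 v w hvw (by simp [hv]) (by simp [hw]) (by simpa [h4, h5] using hvw')
    · rintro rfl
      simp [h2]
  · rintro ⟨χ, a⟩ h
    rw [Finset.mem_product, mem_cuts] at h
    have hu : χ u = none := by
      have := h.1.1 u
      simpa [hS] using this
    refine Prod.ext ?_ (by simp)
    dsimp only
    rw [Function.update_idem, Function.update_eq_self_iff, hu]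
  · intro χ h
    rw [mem_cuts] at h
    have hu := (h.1 u).1 (by simp)
    obtain ⟨a, ha⟩ := Option.ne_none_iff_exists'.1 hu
    dsimp only
    rw [Function.update_idem, Function.update_eq_self_iff, ha]
    rfl
  · rintro ⟨χ, a⟩ h
    have := hmon χ a
    unfold mon at this
    rw [this]

/-- When u leaves the bag, its edges to selected bag vertices become outer edges: only now is their
constraint checked and their number counted. All the information for this is in the colouring of the
bag. A cut violating such a constraint contributes zero. -/
theorem vec_forgetMon {Y S : Finset (Fin n)} {u : Fin n} (hY : u ∉ Y) {χ : Fin n → Option Bool}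
    (hχ : χ ∈ cuts G r (insert u Y) S) :
    vec (forgetMon (edgeList G) (vname u) (mon G (insert u Y) S χ)) =
      open Classical in if χ ∈ cuts G r Y S then Finsupp.single (mon G Y S χ) 1 else 0 := by
  classical
  obtain ⟨h1, h2, h3⟩ := (mem_cuts _ _).1 hχ
  have hru : restrict (insert u Y) χ u = χ u := by simp [restrict]
  have hupd : Function.update (restrict (insert u Y) χ) u none = restrict Y χ := by
    funext v
    by_cases hv : v = u
    · subst hv; simp [restrict, hY]
    · simp [restrict, hv]
  unfold forgetMon
  by_cases hu : u ∈ S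
  · have hu' : χ u ≠ none := (h1 u).1 hu
    have hm : memb (vname u, none) (mon G (insert u Y) S χ).2.2 = false := by
      rw [Bool.eq_false_iff, ne_eq, memb_iff]
      simp only [mon, mem_code, hru]
      exact hu'
    rw [hm, cond_false]
    -- The only new constraints come from edges between u and selected vertices of the bag.
    have hcut : χ ∈ cuts G r Y S ↔ ¬ ∃ w, G.Adj u w ∧ restrict (insert u Y) χ w ≠ none ∧
        restrict (insert u Y) χ u ≠ restrict (insert u Y) χ w := by
      rw [mem_cuts, hru]
      constructor
      · rintro ⟨-, -, h⟩ ⟨w, hw, hw', hne⟩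
        have hwY : w ∈ insert u Y := by
          by_contra hc
          simp [restrict, hc] at hw'
        simp only [restrict, hwY, if_true] at hw' hne
        exact hne (h u w hw hu ((h1 w).2 hw') (by simp [hY]))
      · intro h
        push Not at h
        refine ⟨h1, h2, fun a b hab ha hb hab' => ?_⟩
        by_cases hc : a ∈ insert u Y ∧ b ∈ insert u Y
        · have key : ∀ w, G.Adj u w → w ∈ S → w ∈ insert u Y → χ u = χ w := by
            intro w hw hwS hwY
            have := h w hw
            simp only [restrict, hwY, if_true] at this
            exact this ((h1 w).1 hwS)
          obtain ⟨ha', hb'⟩ := hc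
          rw [Finset.mem_insert] at ha' hb'
          rcases ha' with rfl | ha'
          · exact key b hab hb (Finset.mem_insert.2 hb')
          · rcases hb' with rfl | hb'
            · exact (key a hab.symm ha (Finset.mem_insert_of_mem ha')).symm
            · exact absurd ⟨ha', hb'⟩ hab'
        · exact h3 a b hab ha hb hc
    cases hany : (selectedNeighbors (edgeList G) (vname u) (mon G (insert u Y) S χ).2.2).any fun p =>
        !memb (vname u, p.2) (mon G (insert u Y) S χ).2.2
    · have hin : χ ∈ cuts G r Y S := by
        rw [hcut, ← any_selectedNeighbors G]
        simpa [mon] using hany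
      rw [if_pos hin, cond_false, vec_cons, vec_nil, add_zero]
      congr 1
      unfold mon
      dsimp only
      rw [recolor_code, hupd, length_selectedNeighbors]
      refine Prod.ext ?_ (Prod.ext ?_ rfl)
      · dsimp only
        rw [← Finset.card_insert_of_notMem (a := u) (by simp)]
        congr 1
        ext v
        by_cases hv : v = u
        · subst hv; simp [hu, hY]
        · simp [hv]
      · dsimp only
        -- The new outer edges are the pairs of u with its selected neighbours in the bag, one edge
        -- for each neighbour, and none of them was outer before.
        rw [← Finset.card_image_of_injective (f := fun w => s(u, w)) _ (fun a b h => Sym2.congr_right.1 h),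
          ← Finset.card_union_of_disjoint]
        · congr 1
          ext e
          induction e with | _ a b => ?_
          rw [Finset.mem_union, mem_outerEdges, mem_outerEdges, Finset.mem_image]
          simp only [Finset.mem_filter, Finset.mem_univ, true_and]
          have hsel : ∀ w, restrict (insert u Y) χ w ≠ none ↔ w ∈ insert u Y ∧ w ∈ S := by
            intro w
            rw [h1 w]
            unfold restrict
            split_ifs with h <;> simp [h]
          simp only [hsel]
          constructor
          · rintro (⟨h4, h5, h6⟩ | ⟨w, ⟨hw, hwY, hwS⟩, he⟩)
            · refine ⟨h4, h5, fun h => h6 ⟨?_, ?_⟩⟩ <;> simp [h]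
            · rw [Sym2.eq_iff] at he
              rcases he with ⟨rfl, rfl⟩ | ⟨rfl, rfl⟩
              · exact ⟨hw, ⟨hu, hwS⟩, fun h => hY h.1⟩
              · exact ⟨hw.symm, ⟨hwS, hu⟩, fun h => hY h.2⟩
          · rintro ⟨h4, h5, h6⟩
            by_cases hc : a ∈ insert u Y ∧ b ∈ insert u Y
            · right
              obtain ⟨ha', hb'⟩ := hc
              by_cases hau : a = u
              · subst hau; exact ⟨b, ⟨h4, hb', h5.2⟩, rfl⟩
              · by_cases hbu : b = u
                · subst hbu; exact ⟨a, ⟨h4.symm, ha', h5.1⟩, Sym2.eq_swap⟩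
                · simp [hau, hbu] at ha' hb'
                  exact absurd ⟨ha', hb'⟩ h6
            · exact .inl ⟨h4, h5, hc⟩
        · rw [Finset.disjoint_left]
          intro e he he'
          rw [Finset.mem_image] at he'
          obtain ⟨w, hw, rfl⟩ := he'
          rw [mem_outerEdges] at he
          refine he.2.2 ⟨by simp, ?_⟩
          by_contra hc
          rw [Finset.mem_filter] at hw
          exact hw.2.2 (if_neg hc)
    · have hin : χ ∉ cuts G r Y S := by
        rw [hcut, ← any_selectedNeighbors G, not_not]
        simpa only [mon] using hany
      rw [if_neg hin, cond_true, vec_nil]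
  · have hu' : χ u = none := by
      have := h1 u
      simpa [hu] using this
    have hm : memb (vname u, none) (mon G (insert u Y) S χ).2.2 = true := by
      rw [memb_iff]
      simp only [mon, mem_code, hru]
      exact hu'
    have hcuts : cuts G r Y S = cuts G r (insert u Y) S := by
      ext ψ
      rw [mem_cuts, mem_cuts]
      refine and_congr_right fun _ => and_congr_right fun _ => ?_
      refine forall₄_congr fun a b _ ha => forall_congr' fun hb => ?_
      have h1 : a ≠ u := fun h => hu (h ▸ ha)
      have h2 : b ≠ u := fun h => hu (h ▸ hb)
      simp [h1, h2]
    rw [hm, cond_true, vec_cons, vec_nil, add_zero, hcuts, if_pos hχ]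
    congr 1
    unfold mon
    refine Prod.ext ?_ (Prod.ext ?_ ?_)
    · dsimp only
      congr 1
      ext v
      have : v ∈ S → v ≠ u := fun h e => hu (e ▸ h)
      simp; tauto
    · dsimp only
      congr 1
      ext e
      induction e with | _ a b => ?_
      have h1 : a ∈ S → a ≠ u := fun h e => hu (e ▸ h)
      have h2 : b ∈ S → b ≠ u := fun h e => hu (e ▸ h)
      rw [mem_outerEdges, mem_outerEdges]
      simp; tauto
    · dsimp only
      rw [← hupd]
      congr 1
      rw [eq_comm, Function.update_eq_self_iff, hru, hu']

/-- Shrinking the bag only adds constraints, so the cuts for Y are those cuts for `insert u Y` that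
survive in `vec_forgetMon`. -/
theorem cutVec_forget {Y S : Finset (Fin n)} {u : Fin n} (hY : u ∉ Y) :
    cutVec G r Y S = lin (forgetMon (edgeList G) (vname u)) (cutVec G r (insert u Y) S) := by
  classical
  rw [lin_cutVec, Finset.sum_congr rfl fun χ hχ => vec_forgetMon hY hχ, ← Finset.sum_filter]
  unfold cutVec
  refine Finset.sum_congr ?_ fun _ _ => rfl
  ext χ
  rw [Finset.mem_filter]
  refine ⟨fun h => ⟨?_, h⟩, fun h => h.2⟩
  rw [mem_cuts] at h ⊢
  exact ⟨h.1, h.2.1, fun a b hab ha hb hc => h.2.2 a b hab ha hb fun hd => hc (by simp [hd])⟩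

/-- The product of vectors. -/
noncomputable def joinLin : (Mon →₀ ZMod 2) →ₗ[ZMod 2] (Mon →₀ ZMod 2) →ₗ[ZMod 2] (Mon →₀ ZMod 2) :=
  Finsupp.linearCombination (ZMod 2) fun m => lin (joinMon m)

theorem vec_join (v w : List Mon) :
    vec (v.flatMap fun m => w.flatMap fun m' => joinMon m m') = joinLin (vec v) (vec w) := by
  induction v with
  | nil => simp
  | cons m v ih =>
    simp only [List.flatMap_cons, vec_append, ih, vec_flatMap, vec_cons, map_add,
      LinearMap.add_apply]
    simp [joinLin, lin, Finsupp.linearCombination_single]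

theorem joinLin_cutVec (Y S S' : Finset (Fin n)) : joinLin (cutVec G r Y S) (cutVec G r Y S') =
    ∑ χ ∈ cuts G r Y S, ∑ ψ ∈ cuts G r Y S',
      vec (joinMon (mon G Y S χ) (mon G Y S' ψ)) := by
  simp [joinLin, cutVec, lin, Finsupp.linearCombination_single]
  rw [Finset.sum_comm]

/-- A colouring of the bag reveals which bag vertices are selected. If the two selections differ on
the bag, no pair of colourings matches. -/
theorem joinLin_eq_zero {Y S S' : Finset (Fin n)} (h : S ∩ Y ≠ S' ∩ Y) :
    joinLin (cutVec G r Y S) (cutVec G r Y S') = 0 := by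
  rw [joinLin_cutVec]
  refine Finset.sum_eq_zero fun χ hχ => Finset.sum_eq_zero fun ψ hψ => ?_
  have hne : restrict Y χ ≠ restrict Y ψ := by
    intro he
    apply h
    ext v
    rw [Finset.mem_inter, Finset.mem_inter, ((mem_cuts _ _).1 hχ).1, ((mem_cuts _ _).1 hψ).1]
    refine and_congr_left fun hv => ?_
    have := congrFun he v
    simp only [restrict, hv, if_true] at this
    rw [this]
  have : eqb (mon G Y S χ).2.2 (mon G Y S' ψ).2.2 = false := by
    rw [Bool.eq_false_iff, ne_eq, eqb_iff]
    exact fun h => hne (code_injective h)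
  simp [joinMon, this]

/-- Outside Y the two sets are disjoint and no edge runs between their private parts, so the numbers
of forgotten vertices and edges add up, and a cut of the union is the same as a pair of cuts
agreeing on Y. -/
theorem cutVec_union {Y S S' : Finset (Fin n)} (h : S ∩ Y = S' ∩ Y) (hd : S ∩ S' ⊆ Y)
    (h1 : ∀ v ∈ S, v ∉ Y → ∀ w ∈ S', G.Adj v w → w ∈ S)
    (h2 : ∀ v ∈ S', v ∉ Y → ∀ w ∈ S, G.Adj v w → w ∈ S') :
    cutVec G r Y (S ∪ S') = joinLin (cutVec G r Y S) (cutVec G r Y S') := by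
  classical
  have hY : ∀ v ∈ Y, v ∈ S ↔ v ∈ S' := fun v hv => by
    have := congrArg (v ∈ ·) h
    simpa [hv] using this
  have hSS : ∀ v, v ∈ S → v ∈ S' → v ∈ Y := fun v hv hv' => hd (Finset.mem_inter.2 ⟨hv, hv'⟩)
  have hcard1 : ((S ∪ S') \ Y).card = (S \ Y).card + (S' \ Y).card := by
    rw [← Finset.card_union_of_disjoint, Finset.union_sdiff_distrib]
    rw [Finset.disjoint_left]
    intro v hv hv'
    rw [Finset.mem_sdiff] at hv hv'
    exact hv.2 (hSS v hv.1 hv'.1)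
  have hcard2 : (outerEdges G Y (S ∪ S')).card =
      (outerEdges G Y S).card + (outerEdges G Y S').card := by
    rw [← Finset.card_union_of_disjoint]
    · congr 1
      ext e
      induction e with | _ a b => ?_
      rw [Finset.mem_union, mem_outerEdges, mem_outerEdges, mem_outerEdges, Finset.mem_union,
        Finset.mem_union]
      constructor
      · rintro ⟨hab, ⟨ha, hb⟩, hc⟩
        have hba := hab.symm
        have := h1 a
        have := h2 a
        have := h1 b
        have := h2 b
        have := hY a
        have := hY b
        by_cases haY : a ∈ Y
        · have hbY : b ∉ Y := fun h => hc ⟨haY, h⟩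
          grind
        · grind
      · rintro (⟨hab, ⟨ha, hb⟩, hc⟩ | ⟨hab, ⟨ha, hb⟩, hc⟩) <;> simp [*]
    · rw [Finset.disjoint_left]
      intro e
      induction e with | _ a b => ?_
      rw [mem_outerEdges, mem_outerEdges]
      rintro ⟨-, ⟨ha, hb⟩, hc⟩ ⟨-, ⟨ha', hb'⟩, -⟩
      exact hc ⟨hSS a ha ha', hSS b hb hb'⟩
  rw [joinLin_cutVec]
  have hterm : ∀ χ ψ, vec (joinMon (mon G Y S χ) (mon G Y S' ψ)) =
      if restrict Y χ = restrict Y ψ then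
        Finsupp.single (((S ∪ S') \ Y).card, (outerEdges G Y (S ∪ S')).card, code (restrict Y χ)) 1
      else 0 := by
    intro χ ψ
    unfold joinMon
    split_ifs with he
    · have : eqb (mon G Y S χ).2.2 (mon G Y S' ψ).2.2 = true := by rw [eqb_iff]; simp [mon, he]
      rw [this, hcard1, hcard2]
      simp [mon]
    · have : eqb (mon G Y S χ).2.2 (mon G Y S' ψ).2.2 = false := by
        rw [Bool.eq_false_iff, ne_eq, eqb_iff]
        exact fun h => he (code_injective h)
      simp [this]
  simp only [hterm]
  rw [← Finset.sum_product', ← Finset.sum_filter]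
  unfold cutVec
  -- A cut goes to its restrictions to S and S'. Conversely two cuts are glued; preferring the value
  -- on S is harmless because S and S' overlap only in Y, where the cuts agree.
  refine Finset.sum_bij' (fun χ _ => (restrict S χ, restrict S' χ))
    (fun p _ v => if v ∈ S then p.1 v else p.2 v) ?_ ?_ ?_ ?_ ?_
  · intro χ hχ
    obtain ⟨c1, c2, c3⟩ := (mem_cuts _ _).1 hχ
    rw [Finset.mem_filter, Finset.mem_product, mem_cuts, mem_cuts]
    have hne : ∀ v, v ∈ S ∨ v ∈ S' → χ v ≠ none := fun v hv => (c1 v).1 (by simpa using hv)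
    refine ⟨⟨⟨fun v => ?_, fun hr => ?_, fun a b hab ha hb hc => ?_⟩,
      ⟨fun v => ?_, fun hr => ?_, fun a b hab ha hb hc => ?_⟩⟩, ?_⟩
    · by_cases hv : v ∈ S <;> simp [restrict, hv, hne]
    · simp only [restrict, hr, if_true]
      exact c2 (by simp [hr])
    · simp only [restrict, ha, hb, if_true]
      exact c3 a b hab (by simp [ha]) (by simp [hb]) hc
    · by_cases hv : v ∈ S' <;> simp [restrict, hv, hne]
    · simp only [restrict, hr, if_true]
      exact c2 (by simp [hr])
    · simp only [restrict, ha, hb, if_true]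
      exact c3 a b hab (by simp [ha]) (by simp [hb]) hc
    · funext v
      by_cases hv : v ∈ Y
      · simp [restrict, hv, hY v hv]
      · simp [restrict, hv]
  · rintro ⟨χ, ψ⟩ hp
    rw [Finset.mem_filter, Finset.mem_product, mem_cuts, mem_cuts] at hp
    obtain ⟨⟨⟨c1, c2, c3⟩, ⟨d1, d2, d3⟩⟩, he⟩ := hp
    dsimp only at c1 c2 c3 d1 d2 d3 he
    have heq : ∀ v, v ∈ S' → (if v ∈ S then χ v else ψ v) = ψ v := fun v hv => by
      split_ifs with hvS
      · have := congrFun he v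
        simpa [restrict, hSS v hvS hv] using this
      · rfl
    rw [mem_cuts]
    refine ⟨fun v => ?_, fun hr => ?_, fun a b hab ha hb hc => ?_⟩
    · by_cases hv : v ∈ S
      · simpa [hv] using (c1 v).1 hv
      · simpa [hv] using d1 v
    · dsimp only
      split_ifs with hrS
      · exact c2 hrS
      · exact d2 (by simpa [hrS] using hr)
    -- An outer edge of the union lies entirely in S or entirely in S', so its constraint is already
    -- present on one side.
    · have : (a ∈ S ∧ b ∈ S) ∨ (a ∈ S' ∧ b ∈ S') := by
        have : s(a, b) ∈ outerEdges G Y (S ∪ S') := (mem_outerEdges G).2 ⟨hab, ⟨ha, hb⟩, hc⟩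
        have hba := hab.symm
        rw [Finset.mem_union] at ha hb
        have := h1 a
        have := h2 a
        have := h1 b
        have := h2 b
        have := hY a
        have := hY b
        by_cases haY : a ∈ Y
        · have hbY : b ∉ Y := fun h => hc ⟨haY, h⟩
          grind
        · grind
      dsimp only
      rcases this with ⟨ha, hb⟩ | ⟨ha, hb⟩
      · simp only [ha, hb, if_true]
        exact c3 a b hab ha hb hc
      · rw [heq a ha, heq b hb]
        exact d3 a b hab ha hb hc
  · intro χ hχ
    obtain ⟨c1, c2, c3⟩ := (mem_cuts _ _).1 hχ
    funext v
    by_cases hv : v ∈ S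
    · simp [restrict, hv]
    · by_cases hv' : v ∈ S'
      · simp [restrict, hv, hv']
      · have := c1 v
        simp [hv, hv'] at this
        simp [restrict, hv, hv', this]
  · rintro ⟨χ, ψ⟩ hp
    rw [Finset.mem_filter, Finset.mem_product, mem_cuts, mem_cuts] at hp
    obtain ⟨⟨⟨c1, c2, c3⟩, ⟨d1, d2, d3⟩⟩, he⟩ := hp
    dsimp only at c1 c2 c3 d1 d2 d3 he
    refine Prod.ext ?_ ?_
    · funext v
      by_cases hv : v ∈ S
      · simp [restrict, hv]
      · have := c1 v
        simp [hv] at this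
        simp [restrict, hv, this]
    · funext v
      by_cases hv : v ∈ S'
      · by_cases hvS : v ∈ S
        · have := congrFun he v
          simp [restrict, hSS v hvS hv] at this
          simp [restrict, hv, hvS, this]
        · simp [restrict, hv, hvS]
      · have := d1 v
        simp [hv] at this
        simp [restrict, hv, this]
  · intro χ hχ
    congr 1
    unfold mon
    congr 2
    dsimp only
    congr 1
    funext v
    by_cases hv : v ∈ Y
    · by_cases hvS : v ∈ S
      · simp [restrict, hv, hvS]
      · have := ((mem_cuts _ _).1 hχ).1 v
        simp [hvS, ← hY v hv] at this
        simp [restrict, hv, hvS, this]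
    · simp [restrict, hv]

end Cuts

/-! ### The recursive structure of a nice tree decomposition -/

namespace BagTree

variable {V : Type}

section Graph

variable {B : Finset V} {c l r : BagTree V}

/-- A node of the subtree below a node with one child. -/
def Node.sub (x : c.Node) : (unary B c).Node := (some x : Option c.Node)

/-- A node of the left subtree. -/
def Node.inl (x : l.Node) : (binary B l r).Node := (some (.inl x) : Option (l.Node ⊕ r.Node))

/-- A node of the right subtree. -/
def Node.inr (x : r.Node) : (binary B l r).Node := (some (.inr x) : Option (l.Node ⊕ r.Node))

theorem root_adj_sub : (unary B c).graph.Adj (unary B c).root (Node.sub c.root) :=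
  (SimpleGraph.fromRel_adj _ _ _).2 ⟨(Option.some_ne_none _).symm, .inl rfl⟩

theorem root_adj_inl : (binary B l r).graph.Adj (binary B l r).root (Node.inl l.root) :=
  (SimpleGraph.fromRel_adj _ _ _).2 ⟨(Option.some_ne_none _).symm, .inl rfl⟩

theorem root_adj_inr : (binary B l r).graph.Adj (binary B l r).root (Node.inr r.root) :=
  (SimpleGraph.fromRel_adj _ _ _).2 ⟨(Option.some_ne_none _).symm, .inl rfl⟩

theorem not_adj_inl_inr {x : l.Node} {y : r.Node} :
    ¬ (binary B l r).graph.Adj (Node.inl x) (Node.inr y) :=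
  fun h => ((SimpleGraph.fromRel_adj _ _ _).1 h).2.elim id id

/-- The subtree below a node with one child. -/
def unaryHom (B : Finset V) (c : BagTree V) : c.graph →g (unary B c).graph where
  toFun := Node.sub
  map_rel' h := (SimpleGraph.fromRel_adj _ _ _).2
    ⟨fun e => ((SimpleGraph.fromRel_adj _ _ _).1 h).1 (Option.some_injective _ e),
      ((SimpleGraph.fromRel_adj _ _ _).1 h).2⟩

/-- The left subtree. -/
def inlHom (B : Finset V) (l r : BagTree V) : l.graph →g (binary B l r).graph where
  toFun := Node.inl
  map_rel' h := (SimpleGraph.fromRel_adj _ _ _).2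
    ⟨fun e => ((SimpleGraph.fromRel_adj _ _ _).1 h).1 (Sum.inl_injective (Option.some_injective _ e)),
      ((SimpleGraph.fromRel_adj _ _ _).1 h).2⟩

/-- The right subtree. -/
def inrHom (B : Finset V) (l r : BagTree V) : r.graph →g (binary B l r).graph where
  toFun := Node.inr
  map_rel' h := (SimpleGraph.fromRel_adj _ _ _).2
    ⟨fun e => ((SimpleGraph.fromRel_adj _ _ _).1 h).1 (Sum.inr_injective (Option.some_injective _ e)),
      ((SimpleGraph.fromRel_adj _ _ _).1 h).2⟩

theorem unaryHom_injective : Function.Injective (unaryHom B c) := fun _ _ h =>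
  Option.some_injective _ h

theorem inlHom_injective : Function.Injective (inlHom B l r) := fun _ _ h =>
  Sum.inl_injective (Option.some_injective _ h)

theorem inrHom_injective : Function.Injective (inrHom B l r) := fun _ _ h =>
  Sum.inr_injective (Option.some_injective _ h)

end Graph

theorem bagAt_root (D : BagTree V) : D.bagAt D.root = D.bag := by
  cases D <;> rfl

theorem reachable_root (D : BagTree V) : ∀ x : D.Node, D.graph.Reachable D.root x := by
  induction D with
  | leaf B => intro x; exact .refl _
  | unary B c ih =>
    intro x
    match x with
    | none => exact .refl _
    | some y => exact root_adj_sub.reachable.trans ((ih y).map (unaryHom B c))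
  | binary B l r ihl ihr =>
    intro x
    match x with
    | none => exact .refl _
    | some (.inl y) => exact root_adj_inl.reachable.trans ((ihl y).map (inlHom B l r))
    | some (.inr y) => exact root_adj_inr.reachable.trans ((ihr y).map (inrHom B l r))

/-- The root separates the two subtrees: a walk avoiding it cannot leave the left one. -/
theorem walk_inl {B : Finset V} {l r : BagTree V} {i j : (binary B l r).Node} (p : (binary B l r).graph.Walk i j) 
    (hp : (binary B l r).root ∉ p.support) (hi : ∃ x, i = inlHom B l r x) :
    ∃ x, j = inlHom B l r x := by
  induction p with
  | nil => exact hi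
  | @cons u v w h p ih =>
    rw [SimpleGraph.Walk.support_cons, List.mem_cons, not_or] at hp
    refine ih hp.2 ?_
    obtain ⟨x, rfl⟩ := hi
    match v, h with
    | none, h => exact absurd (SimpleGraph.Walk.start_mem_support p) hp.2
    | some (.inl y), _ => exact ⟨y, rfl⟩
    | some (.inr y), h => exact absurd h not_adj_inl_inr

theorem WidthLE.unary {B : Finset V} {c : BagTree V} {t : ℕ} (h : (unary B c).WidthLE t) :
    c.WidthLE t := fun x => h (unaryHom B c x)

theorem WidthLE.inl {B : Finset V} {l r : BagTree V} {t : ℕ} (h : (binary B l r).WidthLE t) :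
    l.WidthLE t := fun x => h (inlHom B l r x)

theorem WidthLE.inr {B : Finset V} {l r : BagTree V} {t : ℕ} (h : (binary B l r).WidthLE t) :
    r.WidthLE t := fun x => h (inrHom B l r x)

theorem WidthLE.bag {D : BagTree V} {t : ℕ} (h : D.WidthLE t) : D.bag.card ≤ t + 1 := by
  rw [← bagAt_root]; exact h _

variable [DecidableEq V]

/-- The union of all bags. -/
def verts : BagTree V → Finset V
  | leaf B => B
  | unary B c => B ∪ c.verts
  | binary B l r => B ∪ (l.verts ∪ r.verts)

theorem mem_verts {D : BagTree V} {v : V} : v ∈ D.verts ↔ ∃ x : D.Node, v ∈ D.bagAt x := by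
  induction D with
  | leaf B => exact ⟨fun h => ⟨(), h⟩, fun ⟨_, h⟩ => h⟩
  | unary B c ih =>
    rw [verts, Finset.mem_union, ih]
    constructor
    · rintro (h | ⟨x, h⟩)
      · exact ⟨(none : Option c.Node), h⟩
      · exact ⟨(some x : Option c.Node), h⟩
    · rintro ⟨x, h⟩
      match x, h with
      | none, h => exact .inl h
      | some x, h => exact .inr ⟨x, h⟩
  | binary B l r ihl ihr =>
    rw [verts, Finset.mem_union, Finset.mem_union, ihl, ihr]
    constructor
    · rintro (h | ⟨x, h⟩ | ⟨x, h⟩)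
      · exact ⟨(none : Option (l.Node ⊕ r.Node)), h⟩
      · exact ⟨(some (.inl x) : Option (l.Node ⊕ r.Node)), h⟩
      · exact ⟨(some (.inr x) : Option (l.Node ⊕ r.Node)), h⟩
    · rintro ⟨x, h⟩
      match x, h with
      | none, h => exact .inl h
      | some (.inl x), h => exact .inr (.inl ⟨x, h⟩)
      | some (.inr x), h => exact .inr (.inr ⟨x, h⟩)

theorem bag_subset_verts (D : BagTree V) : D.bag ⊆ D.verts := fun v hv =>
  mem_verts.2 ⟨D.root, by rwa [bagAt_root]⟩

/-- The nodes with a given vertex are connected. -/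
def PathProp (D : BagTree V) : Prop :=
  ∀ (i j q : D.Node) (p : D.graph.Walk i j), p.IsPath → q ∈ p.support →
    D.bagAt i ∩ D.bagAt j ⊆ D.bagAt q

/-- The edges at the vertices outside the root bag are covered. -/
def EdgeProp (G : SimpleGraph V) (D : BagTree V) : Prop :=
  ∀ v ∈ D.verts, v ∉ D.bag → ∀ w, G.Adj v w → ∃ x : D.Node, v ∈ D.bagAt x ∧ w ∈ D.bagAt x

/-- The neighbours of the vertices outside the root bag occur in the tree. -/
def Closed (G : SimpleGraph V) (D : BagTree V) : Prop :=
  ∀ v ∈ D.verts, v ∉ D.bag → ∀ w, G.Adj v w → w ∈ D.verts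

theorem EdgeProp.closed {G : SimpleGraph V} {D : BagTree V} (h : EdgeProp G D) : Closed G D :=
  fun v hv hv' w hw => by
    obtain ⟨x, -, hx⟩ := h v hv hv' w hw
    exact mem_verts.2 ⟨x, hx⟩

section Path

variable {B : Finset V} {c l r : BagTree V}

theorem PathProp.unary (h : PathProp (unary B c)) : PathProp c := fun i j q p hp hq =>
  h (unaryHom B c i) (unaryHom B c j) (unaryHom B c q) (p.map (unaryHom B c))
    (hp.map unaryHom_injective)
    (by rw [SimpleGraph.Walk.support_map]; exact List.mem_map_of_mem hq)

theorem PathProp.inl (h : PathProp (binary B l r)) : PathProp l := fun i j q p hp hq =>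
  h (inlHom B l r i) (inlHom B l r j) (inlHom B l r q) (p.map (inlHom B l r))
    (hp.map inlHom_injective)
    (by rw [SimpleGraph.Walk.support_map]; exact List.mem_map_of_mem hq)

theorem PathProp.inr (h : PathProp (binary B l r)) : PathProp r := fun i j q p hp hq =>
  h (inrHom B l r i) (inrHom B l r j) (inrHom B l r q) (p.map (inrHom B l r))
    (hp.map inrHom_injective)
    (by rw [SimpleGraph.Walk.support_map]; exact List.mem_map_of_mem hq)

/-- A path from the root to a node below the child passes through the child, so a vertex in the root
bag and in some bag below is also in the bag of the child. -/
theorem PathProp.inter_subset_bag (h : PathProp (BagTree.unary B c)) : B ∩ c.verts ⊆ c.bag := by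
  intro v hv
  rw [Finset.mem_inter, mem_verts] at hv
  obtain ⟨hvB, x, hx⟩ := hv
  obtain ⟨p, hp⟩ := (c.reachable_root x).exists_isPath
  have hadj : (BagTree.unary B c).graph.Adj (BagTree.unary B c).root (unaryHom B c c.root) :=
    root_adj_sub
  have h1 := h _ _ (unaryHom B c c.root) (.cons hadj (p.map (unaryHom B c)))
    (by
      rw [SimpleGraph.Walk.cons_isPath_iff]
      refine ⟨hp.map unaryHom_injective, ?_⟩
      rw [SimpleGraph.Walk.support_map, List.mem_map]
      rintro ⟨y, -, hy⟩
      exact Option.some_ne_none y hy)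
    (by
      rw [SimpleGraph.Walk.support_cons]
      exact List.mem_cons_of_mem _ (SimpleGraph.Walk.start_mem_support _))
  rw [← bagAt_root]
  exact h1 (Finset.mem_inter.2 ⟨hvB, hx⟩)

/-- A path between nodes of different subtrees passes through the root. -/
theorem PathProp.verts_inter_subset (h : PathProp (binary B l r)) : l.verts ∩ r.verts ⊆ B := by
  intro v hv
  rw [Finset.mem_inter, mem_verts, mem_verts] at hv
  obtain ⟨⟨x, hx⟩, y, hy⟩ := hv
  obtain ⟨p, hp⟩ := (((binary B l r).reachable_root (inlHom B l r x)).symm.trans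
    ((binary B l r).reachable_root (inrHom B l r y))).exists_isPath
  have hroot : (binary B l r).root ∈ p.support := by
    by_contra hc
    obtain ⟨z, hz⟩ := walk_inl p hc ⟨x, rfl⟩
    exact absurd (Option.some_injective _ hz) (by simp)
  exact h _ _ _ p hp hroot (Finset.mem_inter.2 ⟨hx, hy⟩)

theorem EdgeProp.unary {G : SimpleGraph V} (h : EdgeProp G (unary B c)) (hB : B ∩ c.verts ⊆ c.bag) :
    EdgeProp G c := by
  intro v hv hv' w hw
  have hvB : v ∉ B := fun hc => hv' (hB (Finset.mem_inter.2 ⟨hc, hv⟩))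
  obtain ⟨x, h1, h2⟩ := h v (Finset.mem_union_right _ hv) hvB w hw
  match x, h1, h2 with
  | none, h1, _ => exact absurd h1 hvB
  | some x, h1, h2 => exact ⟨x, h1, h2⟩

theorem EdgeProp.inl {G : SimpleGraph V} (h : EdgeProp G (binary B l r)) (hB : B = l.bag)
    (hlr : l.verts ∩ r.verts ⊆ B) : EdgeProp G l := by
  intro v hv hv' w hw
  have hvB : v ∉ B := fun hc => hv' (hB ▸ hc)
  obtain ⟨x, h1, h2⟩ := h v (by simp [verts, hv]) hvB w hw
  match x, h1, h2 with
  | none, h1, _ => exact absurd h1 hvB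
  | some (.inl x), h1, h2 => exact ⟨x, h1, h2⟩
  | some (.inr x), h1, _ =>
    exact absurd (hlr (Finset.mem_inter.2 ⟨hv, mem_verts.2 ⟨x, h1⟩⟩)) hvB

theorem EdgeProp.inr {G : SimpleGraph V} (h : EdgeProp G (binary B l r)) (hB : B = r.bag)
    (hlr : l.verts ∩ r.verts ⊆ B) : EdgeProp G r := by
  intro v hv hv' w hw
  have hvB : v ∉ B := fun hc => hv' (hB ▸ hc)
  obtain ⟨x, h1, h2⟩ := h v (by simp [verts, hv]) hvB w hw
  match x, h1, h2 with
  | none, h1, _ => exact absurd h1 hvB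
  | some (.inr x), h1, h2 => exact ⟨x, h1, h2⟩
  | some (.inl x), h1, _ =>
    exact absurd (hlr (Finset.mem_inter.2 ⟨mem_verts.2 ⟨x, h1⟩, hv⟩)) hvB

end Path

/-- The properties of a nice tree decomposition that the dynamic program uses, in recursive form. -/
def Valid (G : SimpleGraph V) : BagTree V → Prop
  | leaf B => B = ∅
  | unary B c => ((∃ u ∉ c.verts, B = insert u c.bag) ∨ ∃ u ∉ B, c.bag = insert u B) ∧
      Closed G c ∧ c.Valid G
  | binary B l r => B = l.bag ∧ B = r.bag ∧ l.verts ∩ r.verts ⊆ B ∧ Closed G l ∧ Closed G r ∧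
      l.Valid G ∧ r.Valid G

/-- Paths in the decomposition tree are used only here, to extract three local facts: an introduced
vertex is new to the whole subtree, the two sides of a join share only bag vertices, and vertices
outside the bag of a child have all their neighbours in the subtree of that child. -/
theorem valid_of_niceNodes {G : SimpleGraph V} : ∀ {D : BagTree V}, D.NiceNodes → PathProp D →
    EdgeProp G D → D.Valid G
  | leaf _, h, _, _ => h
  | unary B c, h, hp, he => by
    have hB := hp.inter_subset_bag
    have he' := he.unary hB
    refine ⟨?_, he'.closed, valid_of_niceNodes h.2 hp.unary he'⟩
    rcases h.1 with ⟨u, hu, rfl⟩ | h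
    · exact .inl ⟨u, fun hc => hu (hB (Finset.mem_inter.2 ⟨by simp, hc⟩)), rfl⟩
    · exact .inr (by simpa using h)
  | binary B l r, ⟨h1, h2, h3, h4⟩, hp, he => by
    have hlr := hp.verts_inter_subset
    have hel := he.inl h1 hlr
    have her := he.inr h2 hlr
    exact ⟨h1, h2, hlr, hel.closed, her.closed, valid_of_niceNodes h3 hp.inl hel,
      valid_of_niceNodes h4 hp.inr her⟩

theorem _root_.IsNiceTreeDecomposition.valid {G : SimpleGraph V} {D : BagTree V}
    (h : IsNiceTreeDecomposition G D) : D.Valid G :=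
  valid_of_niceNodes h.nice h.decomposition.path fun v _ _ w hw => h.decomposition.edges v w hw

end BagTree

/-! ### Correctness of the tables -/

section Tables

variable {n : ℕ}

/-- A set of vertices, as it is represented in the input. -/
def setList (B : Finset (Fin n)) : List Datum :=
  ((List.finRange n).filter fun v => decide (v ∈ B)).map vname

theorem mem_setList {B : Finset (Fin n)} {v : Fin n} : vname v ∈ setList B ↔ v ∈ B := by
  simp [setList]

/-- The input does not label the types of the nodes; the introduced or forgotten vertex is found by
comparing the bag of a node with that of its child. -/
theorem setList_sdiff (B B' : Finset (Fin n)) :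
    (setList B).filter (fun u => !memb u (setList B')) = setList (B \ B') := by
  unfold setList
  rw [List.filter_map, List.filter_filter]
  congr 1
  refine List.filter_congr fun v _ => ?_
  rw [Bool.eq_iff_iff]
  simp only [Function.comp_apply, Bool.and_eq_true, Bool.not_eq_true', Bool.eq_false_iff, ne_eq,
    memb_iff, decide_eq_true_eq, Finset.mem_sdiff]
  rw [← setList, mem_setList]
  tauto

theorem setList_empty : setList (∅ : Finset (Fin n)) = [] := by simp [setList]

theorem head?_setList_singleton (u : Fin n) : (setList {u}).head? = some (vname u) := by
  have h1 : vname u ∈ setList {u} := by simp [mem_setList]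
  have h2 : ∀ d ∈ setList {u}, d = vname u := by
    intro d hd
    simp only [setList, List.mem_map, List.mem_filter] at hd
    obtain ⟨v, ⟨-, hv⟩, rfl⟩ := hd
    simpa using hv
  cases h : setList {u} with
  | nil => simp [h] at h1
  | cons d l => rw [List.head?_cons, h2 d (by simp [h])]

variable (G : SimpleGraph (Fin n)) (K : Finset (Fin n)) (r : Fin n)

/-- The context for an instance. -/
noncomputable def context : Context :=
  (((List.finRange n).map vname, edgeList G), setList K, vname r)

/-- The table of the root of a tree. -/
noncomputable def table : BagTree (Fin n) → Table
  | .leaf B => nodeTable (context G K r) (setList B) [] []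
  | .unary B c => nodeTable (context G K r) (setList B) (setList c.bag) [table c]
  | .binary B l r' => nodeTable (context G K r) (setList B) (setList l.bag) [table l, table r']

/-- The selections of vertices below a node. -/
def selections (D : BagTree (Fin n)) : Set (Finset (Fin n)) :=
  {S | S ⊆ D.verts ∧ ∀ v ∈ K, v ∈ D.verts → v ∈ S}

theorem tspan_map (T : Table) (φ : Mon → List Mon) :
    tspan (T.map fun v => v.flatMap φ) = (tspan T).map (lin φ) := by
  rw [tspan, tspan, Submodule.map_span, Set.image_image]
  congr 1
  ext x
  simp [lin, vec_flatMap]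

theorem tspan_joinTable (T T' : Table) :
    tspan (joinTable T T') = Submodule.map₂ joinLin (tspan T) (tspan T') := by
  rw [tspan, tspan, tspan, Submodule.map₂_span_span]
  congr 1
  ext x
  simp only [joinTable, List.mem_flatMap, List.mem_map, Set.mem_image, Set.mem_ofPred_eq,
    Set.mem_image2]
  constructor
  · rintro ⟨_, ⟨v, hv, w, hw, rfl⟩, rfl⟩
    exact ⟨_, ⟨v, hv, rfl⟩, _, ⟨w, hw, rfl⟩, (vec_join v w).symm⟩
  · rintro ⟨_, ⟨v, hv, rfl⟩, _, ⟨w, hw, rfl⟩, rfl⟩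
    exact ⟨_, ⟨v, hv, w, hw, rfl⟩, vec_join v w⟩

variable {G K r}

theorem cuts_empty : cuts G r ∅ ∅ = {fun _ => none} := by
  ext χ
  rw [mem_cuts, Finset.mem_singleton]
  constructor
  · rintro ⟨h, -⟩
    funext v
    simpa using h v
  · rintro rfl
    simp

theorem tspan_leafTable : tspan (leafTable ((List.finRange n).map vname)) =
    Submodule.span (ZMod 2) {cutVec G r ∅ ∅} := by
  have h : vec [((0, 0, (List.map (fun v => (v, none)) ((List.finRange n).map vname))) : Mon)] =
      cutVec G r ∅ ∅ := by
    have h0 : outerEdges G ∅ ∅ = ∅ := by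
      ext e
      induction e with | _ a b => ?_
      simp [mem_outerEdges]
    simp only [cutVec, cuts_empty, Finset.sum_singleton, vec_cons, vec_nil, add_zero]
    congr 1
    simp [mon, h0, code, restrict]
  rw [← h, tspan, leafTable]
  congr 1
  ext x
  simp

/-- The invariant of the dynamic program. Elimination preserves the span, and the table operations
are linear or bilinear, so it suffices to follow the generators `cutVec` through each type of node.
-/
theorem tspan_table : ∀ {D : BagTree (Fin n)}, D.Valid G → tspan (table G K r D) =
    Submodule.span (ZMod 2) (cutVec G r D.bag '' selections K D)
  | .leaf B, h => by
    obtain rfl : B = ∅ := h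
    rw [table, nodeTable, tspan_reduceTable]
    have : selections K (.leaf ∅ : BagTree (Fin n)) = {∅} := by
      ext S
      simp [selections, BagTree.verts]
    rw [this, Set.image_singleton]
    exact tspan_leafTable
  | .unary B c, h => by
    obtain ⟨h1, hcl, hc⟩ := h
    have ih := tspan_table hc
    rw [table, nodeTable, tspan_reduceTable]
    simp only [List.head?_cons, Option.elim_some, List.tail_cons, List.head?_nil, Option.elim_none]
    unfold unaryTable
    rw [setList_sdiff, setList_sdiff]
    rcases h1 with ⟨u, hu, hB⟩ | ⟨u, hu, hB⟩
    · have hub : u ∉ c.bag := fun h => hu (c.bag_subset_verts h)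
      have hd : B \ c.bag = {u} := by
        rw [hB]; ext v; simp only [Finset.mem_sdiff, Finset.mem_insert, Finset.mem_singleton]
        constructor
        · tauto
        · rintro rfl; exact ⟨.inl rfl, hub⟩
      have hv : (BagTree.unary B c).verts = insert u c.verts := by
        rw [BagTree.verts, hB, Finset.insert_union, Finset.union_eq_right.2 c.bag_subset_verts]
      rw [hd, head?_setList_singleton, Option.elim_some, introTable, tspan_append, tspan_map, ih,
        Submodule.map_span]
      have hin : ∀ S ∈ selections K c, u ∉ S := fun S hS h => hu (hS.1 h)
      have hcv : ∀ S ∈ selections K c, cutVec G r B (insert u S) =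
          lin (introMon (vname r) (vname u)) (cutVec G r c.bag S) := fun S hS => by
        rw [hB]
        exact cutVec_insert (hin S hS) hub fun v hv hvb hadj => hu (hcl v (hS.1 hv) hvb u hadj)
      have hcv' : ∀ S ∈ selections K c, cutVec G r B S = cutVec G r c.bag S := fun S hS => by
        rw [hB]; exact cutVec_insert_of_not_mem (hin S hS)
      -- The selections split according to whether they contain u; leaving u out is allowed only
      -- when u is not a terminal.
      have hsel : cutVec G r B '' selections K (.unary B c) =
          (if u ∈ K then ∅ else cutVec G r c.bag '' selections K c) ∪
          lin (introMon (vname r) (vname u)) '' (cutVec G r c.bag '' selections K c) := by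
        ext x
        constructor
        · rintro ⟨S, ⟨hS1, hS2⟩, rfl⟩
          rw [hv] at hS1 hS2
          by_cases huS : u ∈ S
          · right
            have hsel : S.erase u ∈ selections K c := by
              refine ⟨fun v hv => ?_, fun v hvK hv => ?_⟩
              · rw [Finset.mem_erase] at hv
                simpa [hv.1] using hS1 hv.2
              · exact Finset.mem_erase.2 ⟨fun e => hu (e ▸ hv),
                  hS2 v hvK (Finset.mem_insert_of_mem hv)⟩
            refine ⟨_, ⟨S.erase u, hsel, rfl⟩, ?_⟩
            rw [← hcv _ hsel, Finset.insert_erase huS]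
          · left
            have huK : u ∉ K := fun h => huS (hS2 u h (Finset.mem_insert_self _ _))
            have hsel : S ∈ selections K c := by
              refine ⟨fun v hv => ?_, fun v hvK hv => hS2 v hvK (Finset.mem_insert_of_mem hv)⟩
              have hne : v ≠ u := fun e => huS (e ▸ hv)
              simpa [hne] using hS1 hv
            rw [if_neg huK]
            exact ⟨S, hsel, (hcv' S hsel).symm⟩
        · rintro (hx | ⟨_, ⟨S, hS, rfl⟩, rfl⟩)
          · split_ifs at hx with huK
            · exact hx.elim
            · obtain ⟨S, hS, rfl⟩ := hx
              refine ⟨S, ⟨?_, fun v hvK hv' => ?_⟩, hcv' S hS⟩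
              · rw [hv]; exact hS.1.trans (Finset.subset_insert _ _)
              · rw [hv, Finset.mem_insert] at hv'
                rcases hv' with rfl | hv'
                · exact absurd hvK huK
                · exact hS.2 v hvK hv'
          · refine ⟨insert u S, ⟨?_, fun v hvK hv' => ?_⟩, hcv S hS⟩
            · rw [hv]; exact Finset.insert_subset_insert _ hS.1
            · rw [hv, Finset.mem_insert] at hv'
              rcases hv' with rfl | hv'
              · exact Finset.mem_insert_self _ _
              · exact Finset.mem_insert_of_mem (hS.2 v hvK hv')
      rw [show (BagTree.unary B c).bag = B from rfl, hsel, Submodule.span_union]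
      congr 1
      have hm : memb (vname u) (context G K r).2.1 = decide (u ∈ K) := by
        rw [Bool.eq_iff_iff, memb_iff, decide_eq_true_eq]
        exact mem_setList
      rw [hm]
      by_cases huK : u ∈ K
      · simp [huK, tspan]
      · simp [huK, ih]
    · have hd : B \ c.bag = ∅ := by
        rw [hB, Finset.sdiff_eq_empty_iff_subset]; exact Finset.subset_insert _ _
      have hd' : c.bag \ B = {u} := by
        rw [hB]; ext v; simp only [Finset.mem_sdiff, Finset.mem_insert, Finset.mem_singleton]
        constructor
        · tauto
        · rintro rfl; exact ⟨.inl rfl, hu⟩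
      have hv : (BagTree.unary B c).verts = c.verts := by
        rw [BagTree.verts, Finset.union_eq_right]
        exact (Finset.subset_insert u B).trans (hB ▸ c.bag_subset_verts)
      rw [hd, setList_empty, List.head?_nil, Option.elim_none, hd', head?_setList_singleton,
        Option.elim_some, forgetTable, tspan_map, ih, Submodule.map_span, Set.image_image]
      congr 1
      have hs : selections K (.unary B c) = selections K c := by
        unfold selections; rw [hv]
      rw [hs, hB]
      exact Set.image_congr fun S _ => (cutVec_forget hu).symm
  | .binary B t t', h => by
    obtain ⟨hB, hB', hi, hcl, hcl', hval, hval'⟩ := h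
    have ih := tspan_table hval
    have ih' := tspan_table hval'
    rw [table, nodeTable, tspan_reduceTable]
    simp only [List.head?_cons, Option.elim_some, List.tail_cons]
    rw [tspan_joinTable, ih, ih', ← hB, ← hB', Submodule.map₂_span_span]
    have hBt : B ⊆ t.verts := hB ▸ t.bag_subset_verts
    have hBt' : B ⊆ t'.verts := hB' ▸ t'.bag_subset_verts
    have hunion : ∀ S ∈ selections K t, ∀ S' ∈ selections K t', S ∩ B = S' ∩ B →
        cutVec G r B (S ∪ S') = joinLin (cutVec G r B S) (cutVec G r B S') := by
      intro S hS S' hS' he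
      have key : ∀ v ∈ B, v ∈ S ↔ v ∈ S' := fun v hv => by
        have := congrArg (v ∈ ·) he
        simpa [hv] using this
      refine cutVec_union he ?_ ?_ ?_
      · exact (Finset.inter_subset_inter hS.1 hS'.1).trans hi
      · intro v hv hvB w hw hadj
        -- A neighbour of v occurs below the same child as v. If it also occurs below the other
        -- child it lies in B, where the two selections agree.
        have h1 := hcl v (hS.1 hv) (hB ▸ hvB) w hadj
        exact (key w (hi (Finset.mem_inter.2 ⟨h1, hS'.1 hw⟩))).2 hw
      · intro v hv hvB w hw hadj
        have h1 := hcl' v (hS'.1 hv) (hB' ▸ hvB) w hadj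
        exact (key w (hi (Finset.mem_inter.2 ⟨hS.1 hw, h1⟩))).1 hw
    have hv : (BagTree.binary B t t').verts = t.verts ∪ t'.verts := by
      rw [BagTree.verts, Finset.union_eq_right]
      exact hBt.trans Finset.subset_union_left
    refine le_antisymm (Submodule.span_le.2 ?_) (Submodule.span_le.2 ?_)
    · rintro _ ⟨_, ⟨S, hS, rfl⟩, _, ⟨S', hS', rfl⟩, rfl⟩
      -- Pairs with different traces on the bag contribute zero, so no unwanted generators arise.
      by_cases he : S ∩ B = S' ∩ B
      · refine Submodule.subset_span ⟨S ∪ S', ⟨?_, fun v hvK hv' => ?_⟩, hunion S hS S' hS' he⟩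
        · rw [hv]; exact Finset.union_subset_union hS.1 hS'.1
        · rw [hv, Finset.mem_union] at hv'
          rcases hv' with hv' | hv'
          · exact Finset.mem_union_left _ (hS.2 v hvK hv')
          · exact Finset.mem_union_right _ (hS'.2 v hvK hv')
      · dsimp only
        rw [joinLin_eq_zero he]; exact zero_mem _
    · rintro _ ⟨S, ⟨hS1, hS2⟩, rfl⟩
      rw [hv] at hS1 hS2
      -- Every selection is the union of its parts below the two children, and these parts have the
      -- same trace on the bag.
      have hl : S ∩ t.verts ∈ selections K t := ⟨Finset.inter_subset_right, fun v hvK hv' =>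
        Finset.mem_inter.2 ⟨hS2 v hvK (Finset.mem_union_left _ hv'), hv'⟩⟩
      have hr : S ∩ t'.verts ∈ selections K t' := ⟨Finset.inter_subset_right, fun v hvK hv' =>
        Finset.mem_inter.2 ⟨hS2 v hvK (Finset.mem_union_right _ hv'), hv'⟩⟩
      have hu : S ∩ t.verts ∪ S ∩ t'.verts = S := by
        rw [← Finset.inter_union_distrib_left, Finset.inter_eq_left.2 hS1]
      refine Submodule.subset_span ⟨_, ⟨_, hl, rfl⟩, _, ⟨_, hr, rfl⟩, ?_⟩
      dsimp only
      rw [← hunion _ hl _ hr, hu]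
      · rfl
      · rw [Finset.inter_assoc, Finset.inter_assoc, Finset.inter_eq_right.2 hBt,
          Finset.inter_eq_right.2 hBt']

/-! ### The result at the root -/

/-- A coordinate is a linear functional: if it vanishes on all generators, it vanishes on the span.
This makes it safe to store a space in place of the individual sets S. -/
theorem exists_mem_span_apply_ne_zero {s : Set (Mon →₀ ZMod 2)} {m : Mon} :
    (∃ x ∈ Submodule.span (ZMod 2) s, x m ≠ 0) ↔ ∃ x ∈ s, x m ≠ 0 := by
  constructor
  · rintro ⟨x, hx, hm⟩
    by_contra hc
    push Not at hc
    have : Submodule.span (ZMod 2) s ≤ LinearMap.ker (Finsupp.lapply (R := ZMod 2) m) :=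
      Submodule.span_le.2 fun y hy => hc y hy
    exact hm (this hx)
  · rintro ⟨x, hx, hm⟩
    exact ⟨x, Submodule.subset_span hx, hm⟩

/-- In a list without repetitions the entries are exactly the nonzero coordinates. Hence the
monomials written in a table depend only on the space that it spans. -/
theorem exists_mem_table_iff {T : Table} (hT : ∀ v ∈ T, v.Nodup) {m : Mon} :
    (∃ v ∈ T, m ∈ v) ↔ ∃ x ∈ tspan T, x m ≠ 0 := by
  rw [tspan, exists_mem_span_apply_ne_zero]
  simp only [Set.mem_image, Set.mem_ofPred_eq, exists_exists_and_eq_and]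
  exact exists_congr fun v => and_congr_right fun hv => (vec_apply_ne_zero (hT v hv)).symm

/-- The number of consistent cuts of a set is odd if and only if the set is connected. -/
theorem card_cuts_ne_zero_iff {S : Finset (Fin n)} (hr : r ∈ S) :
    ((cuts G r ∅ S).card : ZMod 2) ≠ 0 ↔ (G.induce (S : Set (Fin n))).Connected := by
  classical
  let H := G.induce (S : Set (Fin n))
  let r' : (S : Set (Fin n)) := ⟨r, hr⟩
  by_cases hc : (G.induce (S : Set (Fin n))).Connected
  · simp only [hc, iff_true]
    have : cuts G r ∅ S = {fun v => if v ∈ S then some true else none} := by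
      ext χ
      rw [mem_cuts, Finset.mem_singleton]
      constructor
      · rintro ⟨h1, h2, h3⟩
        -- With an empty bag no edge is exempt, so a cut is constant along walks; connectedness and
        -- the fixed colour of r leave a single cut.
        have key : ∀ (a b : (S : Set (Fin n))), H.Walk a b → χ a = χ b := by
          intro a b p
          induction p with
          | nil => rfl
          | @cons a b c h p ih => exact (h3 _ _ h a.2 b.2 (by simp)).trans ih
        funext v
        split_ifs with hv
        · obtain ⟨p⟩ := hc.preconnected ⟨v, hv⟩ r'
          exact (key _ _ p).trans (h2 hr)
        · simpa [hv] using h1 v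
      · rintro rfl
        refine ⟨fun v => ?_, fun h => ?_, fun a b _ ha hb _ => ?_⟩
        · by_cases hv : v ∈ S <;> simp [hv]
        · simp [h]
        · simp [ha, hb]
    rw [this]; simp
  · simp only [hc, iff_false, not_not]
    -- If S is disconnected, exchanging the two sides on everything unreachable from r is an
    -- involution on the cuts. It has no fixed point because some vertex is unreachable, and it
    -- respects the colour of r.
    let far : Fin n → Prop := fun v => ∃ hv : v ∈ S, ¬ H.Reachable r' ⟨v, hv⟩
    let flip : (Fin n → Option Bool) → Fin n → Option Bool := fun χ v =>
      if far v then (χ v).map (!·) else χ v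
    obtain ⟨w, hw⟩ : ∃ w, far w := by
      by_contra hn
      simp only [far, not_exists, not_not] at hn
      exact hc ((SimpleGraph.connected_iff_exists_forall_reachable _).2 ⟨r', fun v => hn v.1 v.2⟩)
    have hfar : ∀ a b, G.Adj a b → a ∈ S → b ∈ S → (far a ↔ far b) := by
      intro a b hab ha hb
      have hadj : H.Adj ⟨a, ha⟩ ⟨b, hb⟩ := hab
      simp only [far, ha, hb, exists_true_left]
      exact not_congr ⟨fun h => h.trans hadj.reachable, fun h => h.trans hadj.symm.reachable⟩
    have hflip : ∀ χ, flip (flip χ) = χ := by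
      intro χ
      funext v
      by_cases hv : far v
      · cases hχ : χ v <;> simp [flip, hv, hχ]
      · simp [flip, hv]
    rw [Finset.card_eq_sum_ones, Nat.cast_sum]
    refine Finset.sum_involution (fun χ _ => flip χ) (fun χ _ => by decide) ?_ ?_
      (fun χ _ => hflip χ)
    · intro χ hχ _ he
      obtain ⟨hw', -⟩ := id hw
      have h1 := ((mem_cuts _ _).1 hχ).1 w
      have h2 := congrFun he w
      simp only [flip, hw, if_true] at h2
      cases h : χ w with
      | none => simp [h, hw'] at h1
      | some b => simp [h] at h2
    · intro χ hχ
      obtain ⟨h1, h2, h3⟩ := (mem_cuts _ _).1 hχ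
      rw [mem_cuts]
      refine ⟨fun v => ?_, fun _ => ?_, fun a b hab ha hb hh => ?_⟩
      · rw [h1 v]
        by_cases hv : far v <;> simp [flip, hv]
      · have : ¬ far r := fun ⟨_, h⟩ => h (.refl _)
        simp only [flip, this, if_false]
        exact h2 hr
      · simp only [flip, hfar a b hab ha hb, h3 a b hab ha hb hh]

/-- For an empty bag all cuts of S have the same monomial, so only the parity of their number
remains. -/
theorem cutVec_empty (S : Finset (Fin n)) : cutVec G r ∅ S =
    Finsupp.single (S.card, (outerEdges G ∅ S).card, code (n := n) fun _ => none)
      ((cuts G r ∅ S).card : ZMod 2) := by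
  have h : ∀ χ : Fin n → Option Bool, restrict ∅ χ = fun _ => none := fun χ => by
    funext v; simp [restrict]
  simp only [cutVec, mon, h, Finset.sdiff_empty, Finset.sum_const]
  simp

theorem ncard_edgeSet_induce (S : Finset (Fin n)) :
    (G.induce (S : Set (Fin n))).edgeSet.ncard = (outerEdges G ∅ S).card := by
  rw [← Set.ncard_image_of_injective _ (Sym2.map.injective Subtype.val_injective),
    ← Set.ncard_coe_finset]
  congr 1
  ext e
  induction e with | _ a b => ?_
  rw [Finset.mem_coe, mem_outerEdges, Set.mem_image]
  constructor
  · rintro ⟨e, he, hab⟩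
    induction e with | _ x y => ?_
    rw [Sym2.map_mk, Sym2.eq_iff] at hab
    rw [SimpleGraph.mem_edgeSet] at he
    have he' : G.Adj x y := he
    rcases hab with ⟨rfl, rfl⟩ | ⟨rfl, rfl⟩
    · exact ⟨he', ⟨x.2, y.2⟩, by simp⟩
    · exact ⟨he'.symm, ⟨y.2, x.2⟩, by simp⟩
  · rintro ⟨hab, ⟨ha, hb⟩, -⟩
    exact ⟨s(⟨a, ha⟩, ⟨b, hb⟩), hab, rfl⟩

theorem table_nodup {D : BagTree (Fin n)} : ∀ v ∈ table G K r D, v.Nodup := by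
  intro v hv
  cases D <;> exact ((reduceTable_echelon _).1 v hv).1

/-- The monomials in the table of the root tell which connected sets there are. -/
theorem exists_table_iff {D : BagTree (Fin n)} (hD : D.Valid G) (hb : D.bag = ∅)
    (hv : ∀ v, v ∈ D.verts) (hr : r ∈ K) (P : ℕ → ℕ → Prop) :
    (∃ v ∈ table G K r D, ∃ m ∈ v, P m.1 m.2.1) ↔ ∃ S : Finset (Fin n), K ⊆ S ∧
      (G.induce (S : Set (Fin n))).Connected ∧
      P S.card (G.induce (S : Set (Fin n))).edgeSet.ncard := by
  have h1 : (∃ v ∈ table G K r D, ∃ m ∈ v, P m.1 m.2.1) ↔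
      ∃ m : Mon, P m.1 m.2.1 ∧ ∃ v ∈ table G K r D, m ∈ v := by
    constructor
    · rintro ⟨v, hv, m, hm, h⟩; exact ⟨m, h, v, hv, hm⟩
    · rintro ⟨m, h, v, hv, hm⟩; exact ⟨v, hv, m, hm, h⟩
  rw [h1]
  simp only [exists_mem_table_iff table_nodup, tspan_table hD, hb, exists_mem_span_apply_ne_zero,
    Set.exists_mem_image, cutVec_empty]
  constructor
  · rintro ⟨m, hP, S, hS, hm⟩
    have hKS : K ⊆ S := fun v hvK => hS.2 v hvK (hv v)
    by_cases he : (S.card, (outerEdges G ∅ S).card, code (n := n) fun _ => none) = m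
    · subst he
      rw [Finsupp.single_eq_same] at hm
      refine ⟨S, hKS, (card_cuts_ne_zero_iff (hKS hr)).1 hm, ?_⟩
      rw [ncard_edgeSet_induce]
      exact hP
    · exact absurd (Finsupp.single_eq_of_ne' he) hm
  · rintro ⟨S, hKS, hc, hP⟩
    rw [ncard_edgeSet_induce] at hP
    refine ⟨(S.card, (outerEdges G ∅ S).card, code (n := n) fun _ => none), hP, S,
      ⟨fun v _ => hv v, fun v hvK _ => hKS hvK⟩, ?_⟩
    rw [Finsupp.single_eq_same]
    exact (card_cuts_ne_zero_iff (hKS hr)).2 hc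

end Tables

/-! ### Sizes of the tables -/

section Sizes

variable {n : ℕ}

theorem esize_vname (v : Fin n) : esize (vname v) ≤ 4 * n + 1 := by
  have h1 : esize (vname v) = esize ((v : ℕ).bits) := rfl
  have h2 := esize_bits_le (v : ℕ).bits
  have h3 : (v : ℕ).bits.length ≤ n := by
    rw [Nat.size_eq_bits_len, Nat.size_le]
    exact v.2.trans Nat.lt_two_pow_self
  omega

theorem esize_vnames (l : List (Fin n)) : esize (l.map vname) ≤ l.length * (4 * n + 2) + 1 := by
  have := esize_list_le (l := l.map vname) (m := 4 * n + 1) fun d hd => by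
    obtain ⟨v, -, rfl⟩ := List.mem_map.1 hd
    exact esize_vname v
  simpa using this

theorem esize_setList (B : Finset (Fin n)) : esize (setList B) ≤ n * (4 * n + 2) + 1 := by
  refine (esize_vnames _).trans ?_
  have := List.length_filter_le (fun v => decide (v ∈ B)) (List.finRange n)
  rw [List.length_finRange] at this
  gcongr

theorem esize_edgeList (G : SimpleGraph (Fin n)) :
    esize (edgeList G) ≤ n * n * (8 * n + 4) + 1 := by
  classical
  refine (esize_list_le (m := 8 * n + 3) fun d hd => ?_).trans ?_
  · obtain ⟨e, -, rfl⟩ := List.mem_map.1 hd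
    have h1 := esize_vname e.1
    have h2 := esize_vname e.2
    have h3 : esize (Datum.cons (vname e.1) (vname e.2)) = esize (vname e.1) + esize (vname e.2) + 1 :=
      rfl
    omega
  · have : (edgeList G).length ≤ n * n := by
      unfold edgeList
      rw [List.length_map]
      refine (List.length_filter_le _ _).trans ?_
      exact ((List.length_product _ _).trans (by rw [List.length_finRange])).le
    gcongr

theorem esize_context (G : SimpleGraph (Fin n)) (K : Finset (Fin n)) (r : Fin n) :
    esize (context G K r) ≤ n * (4 * n + 2) + n * n * (8 * n + 4) + n * (4 * n + 2) + 4 * n + 7 := by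
  have h1 := esize_vnames (List.finRange n)
  have h2 := esize_edgeList G
  have h3 := esize_setList K
  have h4 := esize_vname r
  rw [List.length_finRange] at h1
  simp only [context, esize_pair]
  omega

theorem esize_code (χ : Fin n → Option Bool) : esize (code χ) ≤ n * (4 * n + 8) + 1 := by
  refine (esize_list_le (m := 4 * n + 7) fun p hp => ?_).trans (by simp [code])
  obtain ⟨v, -, rfl⟩ := List.mem_map.1 hp
  have h1 := esize_vname v
  have h2 : esize (χ v) ≤ 5 := by
    cases χ v with
    | none => simp
    | some b => have := esize_bool b; simp; omega
  simp; omega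

/-- The monomials that can occur in the table of a node with bag `Y`. -/
noncomputable def monomials (Y : Finset (Fin n)) : Finset Mon :=
  open Classical in
  (Finset.range (n + 1) ×ˢ Finset.range (n * n + 1) ×ˢ
    Fintype.piFinset fun v => if v ∈ Y then Finset.univ else {none}).image
    fun p => (p.1, p.2.1, code p.2.2)

theorem card_monomials (Y : Finset (Fin n)) :
    (monomials Y).card ≤ (n + 1) * ((n * n + 1) * 3 ^ Y.card) := by
  classical
  refine Finset.card_image_le.trans ?_
  rw [Finset.card_product, Finset.card_product, Finset.card_range, Finset.card_range,
    Fintype.card_piFinset]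
  gcongr
  have : ∀ v, (if v ∈ Y then (Finset.univ : Finset (Option Bool)) else {none}).card =
      if v ∈ Y then 3 else 1 := fun v => by split_ifs <;> rfl
  simp only [this]
  rw [Finset.prod_ite]
  simp

theorem card_outerEdges_le (G : SimpleGraph (Fin n)) (Y S : Finset (Fin n)) :
    (outerEdges G Y S).card ≤ n * n := by
  classical
  refine (Finset.card_le_univ _).trans ?_
  have : Fintype.card (Sym2 (Fin n)) ≤ Fintype.card (Fin n × Fin n) :=
    Fintype.card_le_of_surjective _ Sym2.mk_surjective
  simpa using this

theorem mon_mem_monomials (G : SimpleGraph (Fin n)) (Y S : Finset (Fin n))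
    (χ : Fin n → Option Bool) : mon G Y S χ ∈ monomials Y := by
  classical
  refine Finset.mem_image.2 ⟨((S \ Y).card, (outerEdges G Y S).card, restrict Y χ), ?_, rfl⟩
  rw [Finset.mem_product, Finset.mem_product, Finset.mem_range, Finset.mem_range,
    Fintype.mem_piFinset]
  refine ⟨?_, Nat.lt_succ_of_le (card_outerEdges_le G Y S), fun v => ?_⟩
  · have := Finset.card_le_univ (S \ Y)
    rw [Fintype.card_fin] at this
    exact Nat.lt_succ_of_le this
  · by_cases hv : v ∈ Y <;> simp [restrict, hv]

theorem esize_of_mem_monomials {Y : Finset (Fin n)} {m : Mon} (hm : m ∈ monomials Y) :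
    esize m ≤ 2 * n + 2 * (n * n) + n * (4 * n + 8) + 5 := by
  classical
  obtain ⟨⟨s, e, χ⟩, h, rfl⟩ := Finset.mem_image.1 hm
  rw [Finset.mem_product, Finset.mem_product, Finset.mem_range, Finset.mem_range] at h
  obtain ⟨h1, h2, -⟩ := h
  have := esize_code χ
  simp only [esize_pair, esize_nat]
  dsimp only at h1 h2
  omega

variable {G : SimpleGraph (Fin n)} {K : Finset (Fin n)} {r : Fin n}

/-- A monomial in the table is a nonzero coordinate of some vector in the span, hence of some
generator, and the monomials of generators obey the bounds by construction. -/
theorem mem_monomials_of_mem_table {D : BagTree (Fin n)} (hD : D.Valid G) :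
    ∀ v ∈ table G K r D, ∀ m ∈ v, m ∈ monomials D.bag := by
  intro v hv m hm
  obtain ⟨x, hx, hxm⟩ := (exists_mem_table_iff table_nodup).1 ⟨v, hv, hm⟩
  rw [tspan_table hD] at hx
  obtain ⟨_, ⟨S, -, rfl⟩, hS⟩ := exists_mem_span_apply_ne_zero.1 ⟨x, hx, hxm⟩
  by_contra hc
  apply hS
  rw [cutVec, Finsupp.finsetSum_apply]
  refine Finset.sum_eq_zero fun χ _ => Finsupp.single_eq_of_ne' fun h => hc ?_
  rw [← h]
  exact mon_mem_monomials G _ S χ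

/-- A polynomial bound for the sizes of the data of the dynamic program. -/
noncomputable def sizeBound : Polynomial ℕ :=
  open Polynomial in
  let c := (X + 1) * ((X * X + 1) * (3 * (X * X)))
  c * (c * (2 * X + 2 * (X * X) + X * (4 * X + 8) + 6) + 2) +
    (X * (4 * X + 2) + X * X * (8 * X + 4) + X * (4 * X + 2) + 4 * X + 7)

theorem le_two_pow_mul (n t : ℕ) : n ≤ 2 ^ t * n := Nat.le_mul_of_pos_left _ (by positivity)

/-- The factor 3^(t+1) is at most 3 (2^t)^2 because 3 ≤ 4. So the count is bounded by a polynomial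
in the single quantity 2^t n, in which all later bounds are expressed. -/
theorem card_monomials_le {Y : Finset (Fin n)} {t : ℕ} (hY : Y.card ≤ t + 1) (hn : 1 ≤ n) :
    (monomials Y).card ≤ (2 ^ t * n + 1) * ((2 ^ t * n * (2 ^ t * n) + 1) *
      (3 * (2 ^ t * n * (2 ^ t * n)))) := by
  refine (card_monomials Y).trans ?_
  have h1 : 3 ^ Y.card ≤ 3 * (2 ^ t * n * (2 ^ t * n)) := by
    calc 3 ^ Y.card ≤ 3 ^ (t + 1) := Nat.pow_le_pow_right (by norm_num) hY
      _ = 3 * 3 ^ t := pow_succ' _ _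
      _ ≤ 3 * 4 ^ t := by gcongr; norm_num
      _ = 3 * (2 ^ t * 2 ^ t) := by rw [← mul_pow]; norm_num
      _ ≤ 3 * (2 ^ t * n * (2 ^ t * n)) := by gcongr <;> exact Nat.le_mul_of_pos_right _ hn
  gcongr <;> exact le_two_pow_mul n t

/-- Echelon form bounds the number of vectors by the number of monomials; each vector has no
repetitions and so obeys the same bound on its length. -/
theorem esize_table {D : BagTree (Fin n)} (hD : D.Valid G) {t : ℕ} (hY : D.bag.card ≤ t + 1)
    (hn : 1 ≤ n) : esize (table G K r D) ≤ sizeBound.eval (2 ^ t * n) := by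
  have hech : Echelon (table G K r D) := by cases D <;> exact reduceTable_echelon _
  have hmem := mem_monomials_of_mem_table (K := K) (r := r) hD
  have hlen := (hech.length_le hmem).trans (card_monomials_le hY hn)
  have hM := le_two_pow_mul n t
  set c := (2 ^ t * n + 1) * ((2 ^ t * n * (2 ^ t * n) + 1) * (3 * (2 ^ t * n * (2 ^ t * n)))) with hc
  set d := 2 * (2 ^ t * n) + 2 * (2 ^ t * n * (2 ^ t * n)) + 2 ^ t * n * (4 * (2 ^ t * n) + 8) + 6
    with hd
  have hvec : ∀ v ∈ table G K r D, esize v ≤ c * d + 1 := by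
    intro v hv
    refine (esize_list_le fun m hm => esize_of_mem_monomials (hmem v hv m hm)).trans ?_
    change v.length * (2 * n + 2 * (n * n) + n * (4 * n + 8) + 6) + 1 ≤ _
    have h1 : v.length ≤ (monomials D.bag).card := by
      classical
      rw [← List.toFinset_card_of_nodup (table_nodup v hv)]
      exact Finset.card_le_card fun m hm => hmem v hv m (List.mem_toFinset.1 hm)
    have h2 := h1.trans (card_monomials_le hY hn)
    rw [hd]
    gcongr
  have h3 : esize (table G K r D) ≤ (table G K r D).length * (c * d + 2) + 1 := esize_list_le hvec
  have h4 := Nat.mul_le_mul_right (c * d + 2) hlen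
  simp only [sizeBound, Polynomial.eval_add, Polynomial.eval_mul, Polynomial.eval_X,
    Polynomial.eval_ofNat, Polynomial.eval_one]
  rw [← hc, ← hd]
  omega

theorem esize_context_le (t : ℕ) :
    esize (context G K r) ≤ sizeBound.eval (2 ^ t * n) := by
  have h := esize_context G K r
  have hM := le_two_pow_mul n t
  have h2 : n * (4 * n + 2) + n * n * (8 * n + 4) + n * (4 * n + 2) + 4 * n + 7 ≤
    2 ^ t * n * (4 * (2 ^ t * n) + 2) + 2 ^ t * n * (2 ^ t * n) * (8 * (2 ^ t * n) + 4) +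
    2 ^ t * n * (4 * (2 ^ t * n) + 2) + 4 * (2 ^ t * n) + 7 := by gcongr
  simp only [sizeBound, Polynomial.eval_add, Polynomial.eval_mul, Polynomial.eval_X,
    Polynomial.eval_ofNat, Polynomial.eval_one]
  omega

theorem esize_setList_le (B : Finset (Fin n)) (t : ℕ) :
    esize (setList B) ≤ sizeBound.eval (2 ^ t * n) := by
  have h := esize_setList B
  have hM := le_two_pow_mul n t
  have h2 : n * (4 * n + 2) ≤ 2 ^ t * n * (4 * (2 ^ t * n) + 2) := by gcongr
  simp only [sizeBound, Polynomial.eval_add, Polynomial.eval_mul, Polynomial.eval_X,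
    Polynomial.eval_ofNat, Polynomial.eval_one]
  omega

end Sizes

/-! ### The traversal of the tree -/

/-- `Cmd.Run c s s' T`: from the state `s` the program `c` reaches the state `s'` within time `T`. -/
def Cmd.Run (c : Cmd) (s s' : ℕ → Datum) (T : ℕ) : Prop := ∃ k ≤ T, Cmd.Exec c s k s'

/-- Complete iterations of a loop lead from `s` to `s'` within time `T`. -/
def Cmd.Reach (x : ℕ) (c : Cmd) (s s' : ℕ → Datum) (T : ℕ) : Prop :=
  ∀ s'' T', Cmd.Run (.loop x c) s' s'' T' → Cmd.Run (.loop x c) s s'' (T + T')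

namespace Cmd

theorem Run.seq {c d : Cmd} {s s₁ s₂ : ℕ → Datum} {T₁ T₂ : ℕ} (h : Run c s s₁ T₁)
    (h' : Run d s₁ s₂ T₂) : Run (.seq c d) s s₂ (T₁ + T₂) := by
  obtain ⟨k, hk, e⟩ := h
  obtain ⟨l, hl, e'⟩ := h'
  exact ⟨k + l, by omega, .seq e e'⟩

theorem Run.condTrue {x : ℕ} {c d : Cmd} {s s' : ℕ → Datum} {T : ℕ} (hx : s x ≠ .nil)
    (h : Run c s s' T) : Run (.cond x c d) s s' (T + 1) := by
  obtain ⟨k, hk, e⟩ := h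
  exact ⟨k + 1, by omega, .condTrue hx e⟩

theorem Run.condFalse {x : ℕ} {c d : Cmd} {s s' : ℕ → Datum} {T : ℕ} (hx : s x = .nil)
    (h : Run d s s' T) : Run (.cond x c d) s s' (T + 1) := by
  obtain ⟨k, hk, e⟩ := h
  exact ⟨k + 1, by omega, .condFalse hx e⟩

theorem Run.mono {c : Cmd} {s s' : ℕ → Datum} {T T' : ℕ} (h : Run c s s' T) (hT : T ≤ T') :
    Run c s s' T' := by
  obtain ⟨k, hk, e⟩ := h
  exact ⟨k, hk.trans hT, e⟩

theorem run_clear (x : ℕ) (s : ℕ → Datum) : Run (.clear x) s (Function.update s x .nil) 1 :=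
  ⟨1, le_rfl, .clear _ _⟩

theorem run_copy (x y : ℕ) (s : ℕ → Datum) : Run (.copy x y) s (Function.update s x (s y)) 1 :=
  ⟨1, le_rfl, .copy _ _ _⟩

theorem run_pair (x y z : ℕ) (s : ℕ → Datum) :
    Run (.pair x y z) s (Function.update s x (.cons (s y) (s z))) 1 := ⟨1, le_rfl, .pair _ _ _ _⟩

theorem run_left (x y : ℕ) (s : ℕ → Datum) : Run (.left x y) s (Function.update s x (s y).head) 1 :=
  ⟨1, le_rfl, .left _ _ _⟩

theorem run_right (x y : ℕ) (s : ℕ → Datum) :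
    Run (.right x y) s (Function.update s x (s y).tail) 1 := ⟨1, le_rfl, .right _ _ _⟩

theorem Run.reach {x : ℕ} {c : Cmd} {s s' : ℕ → Datum} {T : ℕ} (hx : s x ≠ .nil)
    (h : Run c s s' T) : Reach x c s s' (T + 1) := by
  rintro s'' T' ⟨l, hl, e'⟩
  obtain ⟨k, hk, e⟩ := h
  exact ⟨k + l + 1, by omega, .loopTrue hx e e'⟩

theorem Reach.trans {x : ℕ} {c : Cmd} {s s₁ s₂ : ℕ → Datum} {T₁ T₂ : ℕ} (h : Reach x c s s₁ T₁)
    (h' : Reach x c s₁ s₂ T₂) : Reach x c s s₂ (T₁ + T₂) := fun s'' T' e => by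
  rw [add_assoc]
  exact h _ _ (h' _ _ e)

theorem Reach.mono {x : ℕ} {c : Cmd} {s s' : ℕ → Datum} {T T' : ℕ} (h : Reach x c s s' T)
    (hT : T ≤ T') : Reach x c s s' T' := fun s'' U e => (h s'' U e).mono (by omega)

/-- Pushing a task for the next child of the current node. -/
def pushChild (K : ℕ) : Cmd :=
  .seq (.left (K + 6) (K + 5)) (.seq (.clear (K + 7)) (.seq (.pair (K + 6) (K + 7) (K + 6))
    (.seq (.pair (K + 1) (K + 6) (K + 1)) (.right (K + 5) (K + 5)))))

/-- The first visit of a node: pushing a task for its table, and tasks for its children. -/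
def visit (K : ℕ) : Cmd :=
  .seq (.pair (K + 5) (K + 4) (K + 4)) (.seq (.pair (K + 1) (K + 5) (K + 1))
    (.seq (.right (K + 5) (K + 4)) (.cond (K + 5) (.seq (pushChild K)
      (.cond (K + 5) (pushChild K) (.clear (K + 6)))) (.clear (K + 6)))))

/-- Throughout the traversal K + 1 holds the stack of tasks, K + 2 the stack of finished tables, K +
3 the context and K + 4 the current node; K + 5 to K + 7 are scratch. A task with first component
`nil` is a first visit, any other task asks for the table of its node. -/
theorem run_pushChild (K : ℕ) (s : ℕ → Datum) : ∃ s', Run (pushChild K) s s' 5 ∧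
    s' (K + 1) = .cons (.cons .nil (s (K + 5)).head) (s (K + 1)) ∧ s' (K + 5) = (s (K + 5)).tail ∧
    s' (K + 2) = s (K + 2) ∧ s' (K + 3) = s (K + 3) ∧ ∀ i, K + 7 < i → s' i = s i := by
  refine ⟨_, (run_left _ _ _).seq ((run_clear _ _).seq ((run_pair _ _ _ _).seq
    ((run_pair _ _ _ _).seq (run_right _ _ _)))), by simp, by simp, by simp, by simp,
    fun i hi => ?_⟩
  simp [show i ≠ K + 1 by omega, show i ≠ K + 5 by omega, show i ≠ K + 6 by omega,
    show i ≠ K + 7 by omega]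

theorem run_visit (K : ℕ) (s : ℕ → Datum) (B : Datum) (ch : List Datum) (hch : ch.length ≤ 2)
    (hs : s (K + 4) = .cons B (Datum.ofList ch)) : ∃ s', Run (visit K) s s' 20 ∧
    s' (K + 1) = ch.foldl (fun acc x => .cons (.cons .nil x) acc)
      (.cons (.cons (s (K + 4)) (s (K + 4))) (s (K + 1))) ∧
    s' (K + 2) = s (K + 2) ∧ s' (K + 3) = s (K + 3) ∧ ∀ i, K + 7 < i → s' i = s i := by
  set s₁ := Function.update (Function.update (Function.update s (K + 5)
    (.cons (s (K + 4)) (s (K + 4)))) (K + 1) (.cons (.cons (s (K + 4)) (s (K + 4))) (s (K + 1))))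
    (K + 5) (Datum.ofList ch) with hs₁
  have h1 : s₁ (K + 1) = .cons (.cons (s (K + 4)) (s (K + 4))) (s (K + 1)) := by simp [hs₁]
  have h2 : s₁ (K + 2) = s (K + 2) := by simp [hs₁]
  have h3 : s₁ (K + 3) = s (K + 3) := by simp [hs₁]
  have h5 : s₁ (K + 5) = Datum.ofList ch := by simp [hs₁]
  have hi : ∀ i, K + 7 < i → s₁ i = s i := fun i hi => by
    simp [hs₁, show i ≠ K + 1 by omega, show i ≠ K + 5 by omega]
  suffices h : ∃ s', Run (.cond (K + 5) (.seq (pushChild K)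
      (.cond (K + 5) (pushChild K) (.clear (K + 6)))) (.clear (K + 6))) s₁ s' 17 ∧
    s' (K + 1) = ch.foldl (fun acc x => .cons (.cons .nil x) acc) (s₁ (K + 1)) ∧
    s' (K + 2) = s₁ (K + 2) ∧ s' (K + 3) = s₁ (K + 3) ∧ ∀ i, K + 7 < i → s' i = s₁ i by
    obtain ⟨s', h, g1, g2, g3, gi⟩ := h
    refine ⟨s', ((run_pair _ _ _ _).seq ((run_pair _ _ _ _).seq ((run_right _ _ _).seq
      (T₂ := 17) ?_))).mono (by omega), by rw [g1, h1], by rw [g2, h2], by rw [g3, h3],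
      fun i hi' => by rw [gi i hi', hi i hi']⟩
    simpa [hs, Datum.tail, hs₁] using h
  match ch, hch with
  | [], _ =>
    refine ⟨_, ((run_clear _ _).condFalse h5).mono (by omega), by simp, by simp, by simp,
      fun i hi => ?_⟩
    simp [show i ≠ K + 6 by omega]
  | [x], _ =>
    obtain ⟨s₂, r2, g1, g5, g2, g3, gi⟩ := run_pushChild K s₁
    rw [h5] at g1 g5
    refine ⟨_, (Run.condTrue (by simp [h5, Datum.ofList]) (r2.seq
      ((run_clear _ _).condFalse g5))).mono (by omega), ?_, ?_, ?_, fun i hi => ?_⟩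
    · simp [g1, Datum.ofList, Datum.head]
    · simp [g2]
    · simp [g3]
    · rw [Function.update_of_ne (by omega), gi i hi]
  | [x, y], _ =>
    obtain ⟨s₂, r2, g1, g5, g2, g3, gi⟩ := run_pushChild K s₁
    rw [h5] at g1 g5
    obtain ⟨s₃, r3, f1, f5, f2, f3, fi⟩ := run_pushChild K s₂
    rw [g5] at f1
    refine ⟨_, (Run.condTrue (by simp [h5, Datum.ofList]) (r2.seq (r3.condTrue
      (by simp [g5, Datum.ofList, Datum.tail])))).mono (by omega), ?_, ?_, ?_, fun i hi => ?_⟩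
    · rw [f1, g1]; simp [Datum.ofList, Datum.head, Datum.tail]
    · rw [f2, g2]
    · rw [f3, g3]
    · rw [fi i hi, gi i hi]

/-- Collecting the arguments for the table of the current node. -/
def prepare (K : ℕ) : Cmd :=
  .seq (.right (K + 6) (K + 4)) (.seq (.clear (K + 5)) (.seq
    (.cond (K + 6) (.seq (.left (K + 7) (K + 2)) (.seq (.right (K + 2) (K + 2))
      (.seq (.right (K + 6) (K + 6)) (.seq
        (.cond (K + 6) (.seq (.left (K + 6) (K + 2)) (.seq (.right (K + 2) (K + 2))
          (.pair (K + 5) (K + 6) (K + 5)))) (.clear (K + 6)))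
        (.pair (K + 5) (K + 7) (K + 5)))))) (.clear (K + 7)))
    (.seq (.right (K + 6) (K + 4)) (.seq (.left (K + 6) (K + 6)) (.seq (.left (K + 6) (K + 6))
      (.seq (.pair (K + 5) (K + 6) (K + 5)) (.seq (.left (K + 6) (K + 4))
        (.seq (.pair (K + 5) (K + 6) (K + 5)) (.pair 0 (K + 3) (K + 5))))))))))

/-- The tables of the children are on top of the value stack, first child uppermost. For a leaf the
entry for the bag of the child is `nil`, the code of the empty list, since `head` of `nil` is `nil`.
-/
theorem run_prepare (K : ℕ) (s : ℕ → Datum) (B v : Datum) (ch Ts : List Datum) (hch : ch.length ≤ 2)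
    (hTs : Ts.length = ch.length) (hs : s (K + 4) = .cons B (Datum.ofList ch))
    (hv : s (K + 2) = Ts.foldr .cons v) : ∃ s', Run (prepare K) s s' 30 ∧
    s' 0 = .cons (s (K + 3)) (.cons B (.cons (Datum.ofList ch).head.head (Datum.ofList Ts))) ∧
    s' (K + 1) = s (K + 1) ∧ s' (K + 2) = v ∧ s' (K + 3) = s (K + 3) ∧
    ∀ i, K + 7 < i → s' i = s i := by
  match ch, hch, Ts, hTs with
  | [], _, [], _ =>
    refine ⟨_, ((run_right _ _ _).seq ((run_clear _ _).seq (((run_clear _ _).condFalse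
      ?_).seq ((run_right _ _ _).seq ((run_left _ _ _).seq ((run_left _ _ _).seq
      ((run_pair _ _ _ _).seq ((run_left _ _ _).seq ((run_pair _ _ _ _).seq
      (run_pair _ _ _ _)))))))))).mono (by omega), ?_, ?_, ?_, ?_, fun i hi => ?_⟩
    · simp [hs, Datum.tail, Datum.ofList]
    · simp [hs, Datum.tail, Datum.head, Datum.ofList]
    · simp
    · simp [hv]
    · simp
    · simp [show i ≠ 0 by omega, show i ≠ K + 5 by omega, show i ≠ K + 6 by omega,
        show i ≠ K + 7 by omega]
  | [x], _, [T], _ =>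
    refine ⟨_, ((run_right _ _ _).seq ((run_clear _ _).seq ((Run.condTrue ?_ ((run_left _ _ _).seq
      ((run_right _ _ _).seq ((run_right _ _ _).seq (((run_clear _ _).condFalse ?_).seq
      (run_pair _ _ _ _)))))).seq ((run_right _ _ _).seq ((run_left _ _ _).seq ((run_left _ _ _).seq
      ((run_pair _ _ _ _).seq ((run_left _ _ _).seq ((run_pair _ _ _ _).seq
      (run_pair _ _ _ _)))))))))).mono (by omega), ?_, ?_, ?_, ?_, fun i hi => ?_⟩
    · simp [hs, Datum.tail, Datum.ofList]
    · simp [hs, Datum.tail, Datum.ofList]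
    · simp [hs, hv, Datum.tail, Datum.head, Datum.ofList]
    · simp
    · simp [hv, Datum.tail]
    · simp
    · simp [show i ≠ 0 by omega, show i ≠ K + 2 by omega, show i ≠ K + 5 by omega,
        show i ≠ K + 6 by omega, show i ≠ K + 7 by omega]
  | [x, y], _, [T, T'], _ =>
    refine ⟨_, ((run_right _ _ _).seq ((run_clear _ _).seq ((Run.condTrue ?_ ((run_left _ _ _).seq
      ((run_right _ _ _).seq ((run_right _ _ _).seq ((Run.condTrue ?_ ((run_left _ _ _).seq
      ((run_right _ _ _).seq (run_pair _ _ _ _)))).seq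
      (run_pair _ _ _ _)))))).seq ((run_right _ _ _).seq ((run_left _ _ _).seq ((run_left _ _ _).seq
      ((run_pair _ _ _ _).seq ((run_left _ _ _).seq ((run_pair _ _ _ _).seq
      (run_pair _ _ _ _)))))))))).mono (by omega), ?_, ?_, ?_, ?_, fun i hi => ?_⟩
    · simp [hs, Datum.tail, Datum.ofList]
    · simp [hs, Datum.tail, Datum.ofList]
    · simp [hs, hv, Datum.tail, Datum.head, Datum.ofList]
    · simp
    · simp [hv, Datum.tail]
    · simp
    · simp [show i ≠ 0 by omega, show i ≠ K + 2 by omega, show i ≠ K + 5 by omega,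
        show i ≠ K + 6 by omega, show i ≠ K + 7 by omega]

/-- One iteration of the traversal: the topmost task is either the first visit of a node or the
computation of its table from the tables of its children with the program `c`. -/
def traverseStep (K : ℕ) (c : Cmd) : Cmd :=
  .seq (.left (K + 5) (K + 1)) (.seq (.right (K + 1) (K + 1)) (.seq (.right (K + 4) (K + 5))
    (.seq (.left (K + 5) (K + 5)) (.cond (K + 5)
      (.seq (prepare K) (.seq c (.pair (K + 2) 0 (K + 2)))) (visit K)))))

theorem reach_visit (K : ℕ) (c : Cmd) (s : ℕ → Datum) (B rest : Datum) (ch : List Datum)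
    (hch : ch.length ≤ 2) (hs : s (K + 1) = .cons (.cons .nil (.cons B (Datum.ofList ch))) rest) :
    ∃ s', Reach (K + 1) (traverseStep K c) s s' 30 ∧
    s' (K + 1) = ch.foldl (fun acc x => .cons (.cons .nil x) acc)
      (.cons (.cons (.cons B (Datum.ofList ch)) (.cons B (Datum.ofList ch))) rest) ∧
    s' (K + 2) = s (K + 2) ∧ s' (K + 3) = s (K + 3) ∧ ∀ i, K + 7 < i → s' i = s i := by
  obtain ⟨s', h, g1, g2, g3, gi⟩ := run_visit K (Function.update (Function.update (Function.update
    (Function.update s (K + 5) (.cons .nil (.cons B (Datum.ofList ch)))) (K + 1) rest)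
    (K + 4) (.cons B (Datum.ofList ch))) (K + 5) .nil) B ch hch (by simp)
  refine ⟨s', (Run.reach (by simp [hs]) ((run_left _ _ _).seq ((run_right _ _ _).seq
    ((run_right _ _ _).seq ((run_left _ _ _).seq (Run.condFalse (T := 20) ?_ ?_)))))).mono (by omega),
    ?_, ?_, ?_, fun i hi => ?_⟩
  · simp [hs, Datum.head]
  · simpa [hs, Datum.head, Datum.tail] using h
  · simpa using g1
  · simpa using g2
  · simpa using g3
  · rw [gi i hi]
    simp [show i ≠ K + 1 by omega, show i ≠ K + 4 by omega, show i ≠ K + 5 by omega]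

/-- Because L ≤ K, the program c for `nodeTable` leaves both stacks and the context intact. -/
theorem reach_combine {K L : ℕ} {c : Cmd} {p : Polynomial ℕ} (hK : L ≤ K)
    (hc : ∀ (a : Context × List Datum × List Datum × List Table) (s : ℕ → Datum),
      s 0 = Enc.enc a → ∃ (s' : ℕ → Datum) (k : ℕ), c.Exec s k s' ∧
      s' 0 = Enc.enc (nodeTable a.1 a.2.1 a.2.2.1 a.2.2.2) ∧ (∀ i, L < i → s' i = s i) ∧
      k ≤ p.eval (esize a) ∧ esize (nodeTable a.1 a.2.1 a.2.2.1 a.2.2.2) ≤ p.eval (esize a))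
    (s : ℕ → Datum) (x : Context) (B B' : List Datum) (Ts : List Table) (ch : List Datum)
    (rest v : Datum) (hch : ch.length ≤ 2) (hTs : Ts.length = ch.length)
    (hB' : (Datum.ofList ch).head.head = Enc.enc B')
    (hs : s (K + 1) = .cons (.cons (.cons (Enc.enc B) (Datum.ofList ch))
      (.cons (Enc.enc B) (Datum.ofList ch))) rest)
    (hv : s (K + 2) = (Ts.map Enc.enc).foldr .cons v)
    (hx : s (K + 3) = Enc.enc x) :
    ∃ s', Reach (K + 1) (traverseStep K c) s s' (40 + p.eval (esize (x, B, B', Ts))) ∧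
    s' (K + 1) = rest ∧ s' (K + 2) = .cons (Enc.enc (nodeTable x B B' Ts)) v ∧
    s' (K + 3) = s (K + 3) ∧ ∀ i, K + 7 < i → s' i = s i := by
  obtain ⟨s₁, h, g0, g1, g2, g3, gi⟩ := run_prepare K (Function.update (Function.update
    (Function.update (Function.update s (K + 5) (.cons (.cons (Enc.enc B) (Datum.ofList ch))
      (.cons (Enc.enc B) (Datum.ofList ch)))) (K + 1) rest)
    (K + 4) (.cons (Enc.enc B) (Datum.ofList ch))) (K + 5) (.cons (Enc.enc B) (Datum.ofList ch)))
    (Enc.enc B) v ch (Ts.map Enc.enc) hch (by simpa using hTs) (by simp) (by simpa using hv)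
  obtain ⟨s₂, k₂, e₂, v₂, f₂, t₂, -⟩ := hc (x, B, B', Ts) s₁ (by rw [g0, hB']; simp [hx]; rfl)
  refine ⟨Function.update s₂ (K + 2) (.cons (s₂ 0) (s₂ (K + 2))), (Run.reach (by simp [hs])
    ((run_left _ _ _).seq ((run_right _ _ _).seq ((run_right _ _ _).seq ((run_left _ _ _).seq
    (Run.condTrue (T := 31 + p.eval (esize (x, B, B', Ts))) ?_ ?_)))))).mono (by omega),
    ?_, ?_, ?_, fun i hi => ?_⟩
  · simp [hs, Datum.head]
  · refine (Run.seq (T₁ := 30) (s₁ := s₁) ?_ (Run.seq ⟨k₂, t₂, e₂⟩ (run_pair _ _ _ _))).mono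
      (by omega)
    simpa [hs, Datum.head, Datum.tail] using h
  · rw [Function.update_of_ne (by omega), f₂ _ (by omega), g1]; simp
  · rw [Function.update_self, v₂, f₂ _ (by omega), g2]
  · rw [Function.update_of_ne (by omega), f₂ _ (by omega), g3]; simp
  · rw [Function.update_of_ne (by omega), f₂ _ (by omega), gi i hi]
    simp [show i ≠ K + 1 by omega, show i ≠ K + 4 by omega, show i ≠ K + 5 by omega]

end Cmd

/-! ### The traversal computes the table of every subtree -/

section Traverse

variable {n : ℕ} {G : SimpleGraph (Fin n)} {Q : Finset (Fin n)} {r : Fin n}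

theorem ofVertices_eq (l : List (Fin n)) : Datum.ofVertices l = Enc.enc (l.map vname) := by
  unfold Datum.ofVertices
  change _ = Datum.ofList (List.map id (List.map _ _))
  rw [List.map_id]
  congr 1
  induction l with
  | nil => rfl
  | cons a l ih => simpa [vname] using ih

theorem enc_setList (B : Finset (Fin n)) : Enc.enc (setList B) = Datum.ofSet B := by
  rw [setList, Datum.ofSet, ofVertices_eq]

theorem ofBagTree_head (D : BagTree (Fin n)) :
    (Datum.ofBagTree D).head = Enc.enc (setList D.bag) := by
  rw [enc_setList]
  cases D <;> rfl

/-- Induction on the tree: handling the task of D consumes it and pushes the table of D. Each node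
costs 30 for its visit and 40 plus one run of c for its combination, which is the constant 70. -/
theorem Cmd.reach_traverse {K L t : ℕ} {c : Cmd} {p : Polynomial ℕ} (hK : L ≤ K)
    (hc : ∀ (a : Context × List Datum × List Datum × List Table) (s : ℕ → Datum),
      s 0 = Enc.enc a → ∃ (s' : ℕ → Datum) (k : ℕ), c.Exec s k s' ∧
      s' 0 = Enc.enc (nodeTable a.1 a.2.1 a.2.2.1 a.2.2.2) ∧ (∀ i, L < i → s' i = s i) ∧
      k ≤ p.eval (esize a) ∧ esize (nodeTable a.1 a.2.1 a.2.2.1 a.2.2.2) ≤ p.eval (esize a))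
    (hn : 1 ≤ n) : ∀ (D : BagTree (Fin n)) (s : ℕ → Datum) (rest : Datum), D.Valid G →
    D.WidthLE t → s (K + 1) = .cons (.cons .nil (Datum.ofBagTree D)) rest →
    s (K + 3) = Enc.enc (context G Q r) →
    ∃ s', Reach (K + 1) (traverseStep K c) s s'
      (D.numNodes * (70 + p.eval (5 * sizeBound.eval (2 ^ t * n) + 6))) ∧
    s' (K + 1) = rest ∧ s' (K + 2) = .cons (Enc.enc (table G Q r D)) (s (K + 2)) ∧
    s' (K + 3) = s (K + 3) ∧ ∀ i, K + 7 < i → s' i = s i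
  | .leaf B, s, rest, hD, hw, hs, hx => by
    obtain ⟨s₁, r1, g1, g2, g3, gi⟩ := reach_visit K c s (Datum.ofSet B) rest [] (by simp) hs
    rw [← enc_setList] at g1
    obtain ⟨s₂, r2, f1, f2, f3, fi⟩ := reach_combine hK hc s₁ (context G Q r) (setList B) [] [] []
      rest (s₁ (K + 2)) (by simp) rfl rfl g1 rfl (g3.trans hx)
    refine ⟨s₂, (r1.trans r2).mono ?_, f1, ?_, f3.trans g3, fun i hi => (fi i hi).trans (gi i hi)⟩
    · have h1 := esize_context_le (G := G) (K := Q) (r := r) t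
      have h2 := esize_setList_le B t
      have h3 := eval_mono p (show esize (context G Q r, setList B, ([] : List Datum),
        ([] : List Table)) ≤ 5 * sizeBound.eval (2 ^ t * n) + 6 by simp; omega)
      simp only [BagTree.numNodes]
      omega
    · rw [f2, g2, table]
  | .unary B d, s, rest, hD, hw, hs, hx => by
    obtain ⟨s₁, r1, g1, g2, g3, gi⟩ := reach_visit K c s (Datum.ofSet B) rest [Datum.ofBagTree d]
      (by simp) hs
    obtain ⟨s₂, r2, f1, f2, f3, fi⟩ := reach_traverse hK hc hn d s₁ _ hD.2.2 hw.unary g1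
      (g3.trans hx)
    rw [← enc_setList] at f1
    obtain ⟨s₃, r3, e1, e2, e3, ei⟩ := reach_combine hK hc s₂ (context G Q r) (setList B)
      (setList d.bag) [table G Q r d] [Datum.ofBagTree d]
      rest (s₁ (K + 2)) (by simp) rfl (ofBagTree_head d) f1 f2 ((f3.trans g3).trans hx)
    refine ⟨s₃, ((r1.trans r2).trans r3).mono ?_, e1, ?_, (e3.trans f3).trans g3,
      fun i hi => ((ei i hi).trans (fi i hi)).trans (gi i hi)⟩
    · have h1 := esize_context_le (G := G) (K := Q) (r := r) t
      have h2 := esize_setList_le B t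
      have h4 := esize_setList_le d.bag t
      have h5 := esize_table (K := Q) (r := r) hD.2.2 hw.unary.bag hn
      have h3 := eval_mono p (show esize (context G Q r, setList B, setList d.bag,
        [table G Q r d]) ≤ 5 * sizeBound.eval (2 ^ t * n) + 6 by simp; omega)
      simp only [BagTree.numNodes, add_mul]
      omega
    · rw [e2, g2, table]
  | .binary B d d', s, rest, hD, hw, hs, hx => by
    obtain ⟨s₁, r1, g1, g2, g3, gi⟩ := reach_visit K c s (Datum.ofSet B) rest
      [Datum.ofBagTree d, Datum.ofBagTree d'] (by simp) hs
    obtain ⟨hB, hB', -, -, -, hval, hval'⟩ := hD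
    -- The second child was pushed last and is therefore treated first; so the table of the first
    -- child ends up on top, as `prepare` expects.
    obtain ⟨s₂, r2, f1, f2, f3, fi⟩ := reach_traverse hK hc hn d' s₁ _ hval' hw.inr g1
      (g3.trans hx)
    obtain ⟨s₄, r4, d1, d2, d3, di⟩ := reach_traverse hK hc hn d s₂ _ hval hw.inl f1
      ((f3.trans g3).trans hx)
    rw [← enc_setList] at d1
    obtain ⟨s₃, r3, e1, e2, e3, ei⟩ := reach_combine hK hc s₄ (context G Q r) (setList B)
      (setList d.bag) [table G Q r d, table G Q r d'] [Datum.ofBagTree d, Datum.ofBagTree d']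
      rest (s₁ (K + 2)) (by simp) rfl (ofBagTree_head d) d1 (by rw [d2, f2]; rfl)
      (((d3.trans f3).trans g3).trans hx)
    refine ⟨s₃, (((r1.trans r2).trans r4).trans r3).mono ?_, e1, ?_,
      ((e3.trans d3).trans f3).trans g3,
      fun i hi => (((ei i hi).trans (di i hi)).trans (fi i hi)).trans (gi i hi)⟩
    · have h1 := esize_context_le (G := G) (K := Q) (r := r) t
      have h2 := esize_setList_le B t
      have h4 := esize_setList_le d.bag t
      have h5 := esize_table (K := Q) (r := r) hval hw.inl.bag hn
      have h6 := esize_table (K := Q) (r := r) hval' hw.inr.bag hn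
      -- Five pieces of data, each within `sizeBound`: the context, two bags and two tables. The six
      -- pairing nodes and list ends around them account for the summand 6.
      have h3 := eval_mono p (show esize (context G Q r, setList B, setList d.bag,
        [table G Q r d, table G Q r d']) ≤ 5 * sizeBound.eval (2 ^ t * n) + 6 by simp; omega)
      simp only [BagTree.numNodes, add_mul]
      omega
    · rw [e2, g2, table]

end Traverse

/-! ### The programs -/

namespace Datum

theorem head_cons (a b : Datum) : (cons a b).head = a := rfl

theorem tail_cons (a b : Datum) : (cons a b).tail = b := rfl

end Datum

namespace Cmd

/-- Dropping the first entries of the list in variable `0`. -/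
def dropEntries : ℕ → Cmd
  | 0 => .copy 0 0
  | m + 1 => .seq (.right 0 0) (dropEntries m)

theorem run_dropEntries (m : ℕ) (s : ℕ → Datum) :
    Run (dropEntries m) s (Function.update s 0 (Datum.tail^[m] (s 0))) (m + 1) := by
  induction m generalizing s with
  | zero => exact run_copy 0 0 s
  | succ m ih =>
    have := ih (Function.update s 0 (s 0).tail)
    rw [Function.update_self, Function.update_idem] at this
    exact ((run_right _ _ _).seq this).mono (by omega)

/-- Preparing the traversal of the tree, which is entry `m` of the input. -/
def setup (K m : ℕ) : Cmd :=
  .seq (.copy (K + 8) 0) (.seq (dropEntries m) (.seq (.left (K + 4) 0)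
    (.seq (.right (K + 5) (K + 4)) (.seq (.left (K + 5) (K + 5)) (.seq (.left (K + 5) (K + 5))
    (.seq (.left (K + 5) (K + 5)) (.seq (.left (K + 6) (K + 8)) (.seq (.right (K + 7) (K + 8))
    (.seq (.left (K + 7) (K + 7)) (.seq (.pair (K + 7) (K + 7) (K + 5))
    (.seq (.pair (K + 3) (K + 6) (K + 7)) (.seq (.clear (K + 1)) (.seq (.clear (K + 2))
    (.seq (.pair (K + 5) (K + 1) (K + 4)) (.pair (K + 1) (K + 5) (K + 1))))))))))))))))

theorem run_setup (K m : ℕ) (s : ℕ → Datum) : ∃ s', Run (setup K m) s s' (m + 20) ∧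
    s' (K + 1) = .cons (.cons .nil (Datum.tail^[m] (s 0)).head) .nil ∧ s' (K + 2) = .nil ∧
    s' (K + 3) = .cons (s 0).head (.cons (s 0).tail.head
      (Datum.tail^[m] (s 0)).head.tail.head.head.head) ∧
    s' (K + 8) = s 0 := by
  refine ⟨_, ((run_copy _ _ _).seq ((run_dropEntries _ _).seq ((run_left _ _ _).seq
    ((run_right _ _ _).seq ((run_left _ _ _).seq ((run_left _ _ _).seq ((run_left _ _ _).seq
    ((run_left _ _ _).seq ((run_right _ _ _).seq ((run_left _ _ _).seq ((run_pair _ _ _ _).seq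
    ((run_pair _ _ _ _).seq ((run_clear _ _).seq ((run_clear _ _).seq ((run_pair _ _ _ _).seq
    (run_pair _ _ _ _)))))))))))))))).mono (by omega), ?_, ?_, ?_, ?_⟩ <;> simp

/-- Computing the table of the root of the tree. -/
def rootTable (K m : ℕ) (c : Cmd) : Cmd := .seq (setup K m) (.loop (K + 1) (traverseStep K c))

theorem run_rootTable {n t K L m : ℕ} {c : Cmd} {p : Polynomial ℕ} (hK : L ≤ K)
    (hc : ∀ (a : Context × List Datum × List Datum × List Table) (s : ℕ → Datum),
      s 0 = Enc.enc a → ∃ (s' : ℕ → Datum) (k : ℕ), c.Exec s k s' ∧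
      s' 0 = Enc.enc (nodeTable a.1 a.2.1 a.2.2.1 a.2.2.2) ∧ (∀ i, L < i → s' i = s i) ∧
      k ≤ p.eval (esize a) ∧ esize (nodeTable a.1 a.2.1 a.2.2.1 a.2.2.2) ≤ p.eval (esize a))
    {G : SimpleGraph (Fin n)} {Q : Finset (Fin n)} {r : Fin n} {D : BagTree (Fin n)}
    (hD : IsNiceTreeDecomposition G D) (hw : D.WidthLE t) (hr : D.RootForgets r) (s : ℕ → Datum)
    (h1 : (s 0).head = Datum.ofGraph G) (h2 : (s 0).tail.head = Datum.ofSet Q)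
    (h3 : (Datum.tail^[m] (s 0)).head = Datum.ofBagTree D) :
    ∃ s', Run (rootTable K m c) s s'
      (D.numNodes * (70 + p.eval (5 * sizeBound.eval (2 ^ t * n) + 6)) + m + 21) ∧
    s' (K + 2) = .cons (Enc.enc (table G Q r D)) .nil ∧ s' (K + 3) = Enc.enc (context G Q r) ∧
    s' (K + 8) = s 0 := by
  obtain ⟨s₁, r1, g1, g2, g3, g8⟩ := run_setup K m s
  -- The root bag is empty and the root forgets r, so the bag of its child is {r}; the program finds
  -- r there as the only entry.
  have hr' : (Datum.ofBagTree D).tail.head.head.head = vname r := by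
    match D, hr, hD with
    | .unary B d, hr, hD =>
      have hB : B = ∅ := hD.root_empty
      have hbag : d.bag = {r} := by rw [hr.2, hB]; rfl
      have h4 : (Datum.ofBagTree (.unary B d)).tail.head = Datum.ofBagTree d := rfl
      have h5 := head?_setList_singleton r
      rw [h4, ofBagTree_head, hbag]
      cases h : setList {r} with
      | nil => simp [h] at h5
      | cons a l => simpa [h, Datum.head] using h5
  have hctx : s₁ (K + 3) = Enc.enc (context G Q r) := by
    rw [g3, h1, h2, h3, hr', ← enc_setList]
    have : Datum.ofGraph G = Enc.enc ((List.finRange n).map vname, edgeList G) := by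
      rw [enc_pair, ← ofVertices_eq, Datum.ofGraph]
      congr 1
      change _ = Datum.ofList (List.map id _)
      rw [List.map_id]
      rfl
    rw [this]
    rfl
  rw [h3] at g1
  obtain ⟨s₂, r2, f1, f2, f3, fi⟩ := reach_traverse hK hc (Fin.pos r) D s₁ _ hD.valid hw g1 hctx
  refine ⟨s₂, (r1.seq (r2 s₂ 1 ⟨1, le_rfl, .loopFalse f1⟩)).mono (by omega), ?_, f3.trans hctx,
    (fi _ (by omega)).trans g8⟩
  rw [f2, g2]

/-! ### Truncating the integers of the input -/

/-- Copying, in reverse order, as many entries of a list as another list has. -/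
def takeLoop (K : ℕ) : Cmd :=
  .loop (K + 1) (.seq (.right (K + 1) (K + 1)) (.cond (K + 4) (.seq (.left (K + 6) (K + 4))
    (.seq (.pair (K + 5) (K + 6) (K + 5)) (.right (K + 4) (K + 4)))) (.clear (K + 6))))

/-- The number of rounds is the length of l, whether or not the digits run out earlier. The cost is
thus independent of the length of the integer. -/
theorem run_takeLoop (K : ℕ) : ∀ (l : List Datum) (s : ℕ → Datum) (b acc : List Bool),
    s (K + 1) = Enc.enc l → s (K + 4) = Enc.enc b → s (K + 5) = Enc.enc acc →
    ∃ s', Run (takeLoop K) s s' (6 * l.length + 1) ∧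
      s' (K + 5) = Enc.enc ((b.take l.length).reverse ++ acc) ∧ s' (K + 2) = s (K + 2) ∧
      s' (K + 3) = s (K + 3) ∧ ∀ i, K + 6 < i → s' i = s i
  | [], s, b, acc, h1, h4, h5 => ⟨s, ⟨1, by simp, .loopFalse h1⟩, by simpa using h5, rfl, rfl,
      fun _ _ => rfl⟩
  | d :: l, s, [], acc, h1, h4, h5 => by
    obtain ⟨s₁, h, g5, g2, g3, gi⟩ := run_takeLoop K l (Function.update (Function.update s (K + 1)
      (Enc.enc l)) (K + 6) .nil) [] acc (by simp) (by simpa using h4) (by simpa using h5)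
    refine ⟨s₁, (Run.reach (T := 3) (by simp [h1]) ((((run_right _ _ _).seq
      ((run_clear _ _).condFalse ?_)))) _ _ ?_).mono
      (T := 4 + (6 * l.length + 1)) (by simp; omega), by simpa using g5, by simpa using g2,
      by simpa using g3, fun i hi => ?_⟩
    · simpa using h4
    · rw [takeLoop] at h
      simpa [h1, Datum.tail_cons] using h
    · rw [gi i hi]
      simp [show i ≠ K + 1 by omega, show i ≠ K + 6 by omega]
  | d :: l, s, x :: b, acc, h1, h4, h5 => by
    obtain ⟨s₁, h, g5, g2, g3, gi⟩ := run_takeLoop K l (Function.update (Function.update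
      (Function.update (Function.update s (K + 1) (Enc.enc l)) (K + 6) (Enc.enc x)) (K + 5)
      (Enc.enc (x :: acc))) (K + 4) (Enc.enc b)) b (x :: acc) (by simp) (by simp) (by simp)
    refine ⟨s₁, (Run.reach (T := 5) (by simp [h1]) ((((run_right _ _ _).seq
      (((run_left _ _ _).seq ((run_pair _ _ _ _).seq (run_right _ _ _))).condTrue ?_)))) _ _ ?_).mono
      (T := 6 + (6 * l.length + 1)) (by simp; omega), by simpa using g5, by simpa using g2,
      by simpa using g3, fun i hi => ?_⟩
    · simp [h4]
    · rw [takeLoop] at h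
      simpa [h1, h4, h5, Datum.tail_cons, Datum.head_cons] using h
    · rw [gi i hi]
      simp [show i ≠ K + 1 by omega, show i ≠ K + 4 by omega, show i ≠ K + 5 by omega,
        show i ≠ K + 6 by omega]

/-- Truncating the integer in entry `m` of the input to as many digits as the list in variable
`K + 7` has entries. -/
def truncate (K m x : ℕ) : Cmd :=
  .seq (.copy 0 (K + 8)) (.seq (dropEntries m) (.seq (.left (K + 4) 0) (.seq (.left x (K + 4))
    (.seq (.right (K + 4) (K + 4)) (.seq (.clear (K + 5)) (.seq (.copy (K + 1) (K + 7))
    (.seq (takeLoop K) (.pair x x (K + 5)))))))))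

theorem run_truncate (K m x : ℕ) (hx : K + 8 < x) (s : ℕ → Datum) (l : List Datum) (z : ℤ)
    (hl : s (K + 7) = Enc.enc l) (hz : (Datum.tail^[m] (s (K + 8))).head = Datum.ofInt z) :
    ∃ s', Run (truncate K m x) s s' (6 * l.length + m + 9) ∧
      s' x = Enc.enc (decide (z < 0), (z.natAbs.bits.take l.length).reverse) ∧
      s' (K + 2) = s (K + 2) ∧ s' (K + 3) = s (K + 3) ∧ ∀ i, K + 6 < i → i ≠ x → s' i = s i := by
  obtain ⟨s₁, h, g5, g2, g3, gi⟩ := run_takeLoop K l (Function.update (Function.update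
    (Function.update (Function.update (Function.update (Function.update s 0
    (Datum.tail^[m] (s (K + 8)))) (K + 4) (Datum.ofInt z)) x (Enc.enc (decide (z < 0))))
    (K + 4) (Enc.enc z.natAbs.bits)) (K + 5) .nil) (K + 1) (Enc.enc l)) z.natAbs.bits []
    (by simp) (by simp) (by simp)
  have hz' : (Datum.tail^[m] (s (K + 8))).head =
    .cons (Enc.enc (decide (z < 0))) (Enc.enc z.natAbs.bits) := hz
  have hz'' : Datum.ofInt z = .cons (Enc.enc (decide (z < 0))) (Enc.enc z.natAbs.bits) := rfl
  have h0 : x ≠ 0 := by omega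
  have h1 : x ≠ K + 1 := by omega
  have h2 : x ≠ K + 2 := by omega
  have h3 : x ≠ K + 3 := by omega
  have h4 : x ≠ K + 4 := by omega
  have h5 : x ≠ K + 5 := by omega
  have h7 : x ≠ K + 7 := by omega
  have h8 : x ≠ K + 8 := by omega
  refine ⟨_, ((run_copy _ _ _).seq ((run_dropEntries _ _).seq ((run_left _ _ _).seq
    ((run_left _ _ _).seq ((run_right _ _ _).seq ((run_clear _ _).seq ((run_copy _ _ _).seq
    (Run.seq (s₁ := s₁) (T₁ := 6 * l.length + 1) ?_ (run_pair _ _ _ _))))))))).mono (by omega),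
    ?_, ?_, ?_, fun i hi hix => ?_⟩
  · simpa [hz', hz'', hl, Datum.head_cons, Datum.tail_cons, h4, h7, h4.symm, h7.symm] using h
  · rw [Function.update_self, gi x (by omega), g5]
    simp [h1, h4, h5]
  · rw [Function.update_of_ne h2.symm, g2]
    simp [h2.symm]
  · rw [Function.update_of_ne h3.symm, g3]
    simp [h3.symm]
  · rw [Function.update_of_ne hix, gi i hi]
    simp [hix, show i ≠ 0 by omega, show i ≠ K + 1 by omega, show i ≠ K + 4 by omega,
      show i ≠ K + 5 by omega]

end Cmd

/-! ### Acceptance at the root and the final time bound -/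

section Final

variable {n t : ℕ} {G : SimpleGraph (Fin n)} {Q : Finset (Fin n)} {r : Fin n}
  {D : BagTree (Fin n)}

theorem IsNiceTreeDecomposition.mem_verts (hD : IsNiceTreeDecomposition G D) (v : Fin n) :
    v ∈ D.verts := BagTree.mem_verts.2 (hD.decomposition.vertices v)

theorem treeTest_iff (hD : IsNiceTreeDecomposition G D) (hr : r ∈ Q) :
    treeTest (table G Q r D) = true ↔ KInATree G Q := by
  have := exists_table_iff hD.valid hD.root_empty hD.mem_verts hr fun s e => e + 1 = s
  simp only [treeTest, List.any_eq_true, eqb_iff]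
  rw [this, KInATree]
  refine exists_congr fun S => and_congr_right fun _ => ?_
  rw [SimpleGraph.isTree_iff_connected_and_card]
  refine and_congr_right fun _ => ?_
  rw [← Nat.card_coe_set_eq]
  simp

theorem lightTest_iff (hD : IsNiceTreeDecomposition G D) (hr : r ∈ Q) (ℓ f : ℤ) {d : ℕ}
    (hd : 2 * n + 1 ≤ d) :
    lightTest (setList Q) (decide (ℓ < 0), (ℓ.natAbs.bits.take d).reverse)
      (decide (f < 0), (f.natAbs.bits.take d).reverse) (table G Q r D) = true ↔
      LightConnectingInducedSubgraph G Q ℓ f := by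
  -- The test ignores the colouring, so the empty list can stand in for it.
  have := exists_table_iff hD.valid hD.root_empty hD.mem_verts hr fun s e =>
    lightMon (setList Q).length (decide (ℓ < 0), (ℓ.natAbs.bits.take d).reverse)
      (decide (f < 0), (f.natAbs.bits.take d).reverse) (s, e, []) = true
  simp only [lightTest, List.any_eq_true]
  refine this.trans ?_
  rw [LightConnectingInducedSubgraph]
  refine exists_congr fun S => and_congr_right fun hS => and_congr_right fun _ => ?_
  have hQ : (setList Q).length = Q.card := by
    rw [setList, List.length_map,
      ← List.toFinset_card_of_nodup ((List.nodup_finRange n).filter _)]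
    congr 1
    ext; simp
  rw [ncard_edgeSet_induce, hQ]
  have hs : S.card ≤ n := by simpa using Finset.card_le_univ S
  exact lightMon_iff (m := (S.card, _, [])) hs (Finset.card_le_card hS)
    (card_outerEdges_le G ∅ S) hd ℓ f

theorem one_le_numNodes {V : Type} (D : BagTree V) : 1 ≤ D.numNodes := by
  cases D <;> simp [BagTree.numNodes]

/-- With M = 2^t n ≥ 1, every power of M in R is at most M to the degree of R, and `R.eval 1` is the
sum of the coefficients. The constant C is the sum of the two, so that it dominates both. -/
theorem exists_bound (R : Polynomial ℕ) : ∃ C : ℕ, ∀ n t : ℕ, 1 ≤ n →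
    R.eval (2 ^ t * n) ≤ C * 2 ^ (C * t) * n ^ C := by
  refine ⟨R.eval 1 + R.natDegree, fun n t hn => ?_⟩
  have hM : 1 ≤ 2 ^ t * n := Nat.mul_pos (by positivity) hn
  have h1 : R.eval (2 ^ t * n) ≤ R.eval 1 * (2 ^ t * n) ^ R.natDegree := by
    rw [Polynomial.eval_eq_sum_range, Polynomial.eval_eq_sum_range, Finset.sum_mul]
    refine Finset.sum_le_sum fun i hi => ?_
    rw [one_pow, mul_one]
    exact Nat.mul_le_mul_left _ (Nat.pow_le_pow_right hM
      (Nat.lt_succ_iff.1 (Finset.mem_range.1 hi)))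
  refine h1.trans ?_
  rw [mul_pow, ← pow_mul, ← mul_assoc, mul_comm t]
  gcongr <;> omega

end Final

theorem exists_tree_program : ∃ (P : Cmd) (C : ℕ), ∀ (n t : ℕ) (G : SimpleGraph (Fin n))
    (K : Finset (Fin n)) (D : BagTree (Fin n)), IsNiceTreeDecomposition G D → D.WidthLE t →
    (∃ r ∈ K, D.RootForgets r) → P.DecidesWithin
      (Datum.ofList [Datum.ofGraph G, Datum.ofSet K, Datum.ofBagTree D]) (KInATree G K)
      (C * 2 ^ (C * t) * n ^ C * D.numNodes) := by
  obtain ⟨c, L, p, hc⟩ := polyTime_nodeTable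
  obtain ⟨d, L', q, hd⟩ := polyTime_treeTest
  obtain ⟨C, hC⟩ := exists_bound (70 + p.comp (5 * sizeBound + 6) + q.comp sizeBound + 30)
  refine ⟨.seq (.rootTable L 2 c) (.seq (.left 0 (L + 2)) d), C, ?_⟩
  rintro n t G Q D hD hw ⟨r, hr, hrf⟩
  obtain ⟨s₁, r1, g2, -, -⟩ := Cmd.run_rootTable (m := 2) (Q := Q) le_rfl hc hD hw hrf
    (inputState (Datum.ofList [Datum.ofGraph G, Datum.ofSet Q, Datum.ofBagTree D])) rfl rfl rfl
  obtain ⟨s₂, k, e, v, -, ht, -⟩ := hd (table G Q r D) (Function.update s₁ 0 (s₁ (L + 2)).head)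
    (by simp [g2, Datum.head])
  obtain ⟨k', hk', e'⟩ := r1.seq ((Cmd.run_left _ _ _).seq ⟨k, ht, e⟩)
  refine ⟨s₂, k', e', ?_, ?_⟩
  · have h1 := hC n t (Fin.pos r)
    have h2 := Nat.mul_le_mul_right D.numNodes h1
    have h3 := eval_mono q (esize_table (K := Q) (r := r) hD.valid hw.bag (Fin.pos r))
    have h4 := Nat.mul_le_mul_left (q.eval (sizeBound.eval (2 ^ t * n)) + 30) (one_le_numNodes D)
    simp only [Polynomial.eval_add, Polynomial.eval_comp, Polynomial.eval_mul,
      Polynomial.eval_ofNat] at h2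
    refine hk'.trans (le_trans ?_ h2)
    rw [mul_comm D.numNodes]
    simp only [add_mul, mul_one] at h4 ⊢
    omega
  · rw [v, ← treeTest_iff hD hr]
    cases treeTest (table G Q r D) <;> simp

theorem exists_light_program : ∃ (P : Cmd) (C : ℕ), ∀ (n t : ℕ) (G : SimpleGraph (Fin n))
    (K : Finset (Fin n)) (ℓ f : ℤ) (D : BagTree (Fin n)), IsNiceTreeDecomposition G D →
    D.WidthLE t → (∃ r ∈ K, D.RootForgets r) → P.DecidesWithin
      (Datum.ofList [Datum.ofGraph G, Datum.ofSet K, Datum.ofInt ℓ, Datum.ofInt f,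
        Datum.ofBagTree D])
      (LightConnectingInducedSubgraph G K ℓ f) (C * 2 ^ (C * t) * n ^ C * D.numNodes) := by
  obtain ⟨c, L, p, hc⟩ := polyTime_nodeTable
  obtain ⟨d, L', q, hd⟩ := polyTime_lightTest
  obtain ⟨e, L'', u, he⟩ := polyTime_digitBound
  set K := max L L'' with hK
  obtain ⟨C, hC⟩ := exists_bound (70 + p.comp (5 * sizeBound + 6) +
    (q.comp (2 * sizeBound + 16 * Polynomial.X + 30) + u.comp sizeBound + 24 * Polynomial.X + 100))
  refine ⟨.seq (.rootTable K 4 c) (.seq (.copy 0 (K + 3)) (.seq e (.seq (.copy (K + 7) 0)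
    (.seq (.truncate K 2 (K + 9)) (.seq (.truncate K 3 (K + 10)) (.seq (.left 0 (K + 2))
    (.seq (.pair 0 (K + 10) 0) (.seq (.pair 0 (K + 9) 0) (.seq (.right (K + 1) (K + 8))
    (.seq (.left (K + 1) (K + 1)) (.seq (.pair 0 (K + 1) 0) d))))))))))), C, ?_⟩
  rintro n t G Q ℓ f D hD hw ⟨r, hr, hrf⟩
  set x := Datum.ofList [Datum.ofGraph G, Datum.ofSet Q, Datum.ofInt ℓ, Datum.ofInt f,
        Datum.ofBagTree D] with hx
  obtain ⟨s₁, r1, g2, g3, g8⟩ := Cmd.run_rootTable (m := 4) (Q := Q) (le_max_left L L'') hc hD hw hrf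
    (inputState x) rfl rfl rfl
  rw [← hK] at r1 g2 g3 g8
  have g8' : s₁ (K + 8) = x := g8
  obtain ⟨s₂, k₂, e₂, v₂, f₂, t₂, -⟩ := he (context G Q r) (Function.update s₁ 0 (s₁ (K + 3)))
    (by simp [g3])
  -- The vertex list twice and one further entry: one digit more than any number below n * n can
  -- have.
  have hlen : (digitBound (context G Q r)).length = 2 * n + 1 := by
    simp [digitBound, context]; omega
  obtain ⟨s₃, r3, a3, b3, -, i3⟩ := Cmd.run_truncate K 2 (K + 9) (by omega)
    (Function.update s₂ (K + 7) (s₂ 0)) (digitBound (context G Q r)) ℓ (by simp [v₂])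
    (by rw [Function.update_of_ne (by omega), f₂ _ (by omega), Function.update_of_ne (by omega),
      g8']; rfl)
  have h38 : s₃ (K + 8) = x := by
    rw [i3 _ (by omega) (by omega), Function.update_of_ne (by omega), f₂ _ (by omega),
      Function.update_of_ne (by omega), g8']
  obtain ⟨s₄, r4, a4, b4, -, i4⟩ := Cmd.run_truncate K 3 (K + 10) (by omega)
    s₃ (digitBound (context G Q r)) f (by rw [i3 _ (by omega) (by omega)]; simp [v₂])
    (by rw [h38]; rfl)
  have h42 : s₄ (K + 2) = .cons (Enc.enc (table G Q r D)) .nil := by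
    rw [b4, b3, Function.update_of_ne (by omega), f₂ _ (by omega), Function.update_of_ne (by omega),
      g2]
  have h48 : s₄ (K + 8) = x := by rw [i4 _ (by omega) (by omega), h38]
  have h49 : s₄ (K + 9) = _ := (i4 _ (by omega) (by omega)).trans a3
  set ℓ' := (decide (ℓ < 0), (ℓ.natAbs.bits.take (digitBound (context G Q r)).length).reverse)
    with hℓ'
  set f' := (decide (f < 0), (f.natAbs.bits.take (digitBound (context G Q r)).length).reverse)
    with hf'
  have hx1 : x.tail.head = Enc.enc (setList Q) := (enc_setList Q).symm
  obtain ⟨s₅, k₅, e₅, v₅, -, t₅, -⟩ := hd (setList Q, ℓ', f', table G Q r D) (Function.update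
    (Function.update s₄ (K + 1) (Enc.enc (setList Q))) 0 (Enc.enc (setList Q, ℓ', f', table G Q r D)))
    (by simp)
  have r5 : Cmd.Run (.seq (.left 0 (K + 2)) (.seq (.pair 0 (K + 10) 0) (.seq (.pair 0 (K + 9) 0)
      (.seq (.right (K + 1) (K + 8)) (.seq (.left (K + 1) (K + 1)) (.seq (.pair 0 (K + 1) 0) d))))))
      s₄ s₅ (6 + q.eval (esize (setList Q, ℓ', f', table G Q r D))) := by
    refine ((Cmd.run_left _ _ _).seq ((Cmd.run_pair _ _ _ _).seq ((Cmd.run_pair _ _ _ _).seq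
      ((Cmd.run_right _ _ _).seq ((Cmd.run_left _ _ _).seq ((Cmd.run_pair _ _ _ _).seq
      (T₂ := q.eval (esize (setList Q, ℓ', f', table G Q r D))) ⟨k₅, t₅, ?_⟩)))))).mono (by omega)
    convert e₅ using 1
    funext i
    by_cases h0 : i = 0
    · subst h0
      simp [h42, h48, h49, a4, hx1, Datum.head_cons]
    · by_cases h1 : i = K + 1
      · subst h1
        simp [h48, hx1]
      · simp [h0, h1]
  obtain ⟨k', hk', e'⟩ := r1.seq ((Cmd.run_copy _ _ _).seq (Cmd.Run.seq ⟨k₂, t₂, e₂⟩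
    ((Cmd.run_copy _ _ _).seq (r3.seq (r4.seq r5)))))
  refine ⟨s₅, k', e', ?_, ?_⟩
  · have h1 := hC n t (Fin.pos r)
    have h2 := Nat.mul_le_mul_right D.numNodes h1
    have hM := le_two_pow_mul n t
    have h5 := esize_table (K := Q) (r := r) hD.valid hw.bag (Fin.pos r)
    have h6 := esize_setList_le Q t
    have hint : ∀ z : ℤ, esize (decide (z < 0),
        (z.natAbs.bits.take (digitBound (context G Q r)).length).reverse) ≤ 8 * (2 ^ t * n) + 9 := by
      intro z
      have h1 := esize_bool (decide (z < 0))
      have h2 := esize_bits_le (z.natAbs.bits.take (digitBound (context G Q r)).length).reverse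
      rw [List.length_reverse, List.length_take, hlen] at h2
      simp only [esize_pair]
      rw [hlen]
      omega
    have h7 : esize ℓ' ≤ _ := hint ℓ
    have h8 : esize f' ≤ _ := hint f
    have h3 := eval_mono q (show esize (setList Q, ℓ', f', table G Q r D) ≤
      2 * sizeBound.eval (2 ^ t * n) + 16 * (2 ^ t * n) + 30 by
        have : esize (setList Q, ℓ', f', table G Q r D) = esize (setList Q) +
          (esize ℓ' + (esize f' + esize (table G Q r D) + 1) + 1) + 1 := rfl
        omega)
    have h9 := eval_mono u (esize_context_le (G := G) (K := Q) (r := r) t)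
    rw [hlen] at hk'
    simp only [Polynomial.eval_add, Polynomial.eval_comp, Polynomial.eval_mul,
      Polynomial.eval_ofNat, Polynomial.eval_X] at h2
    refine hk'.trans (le_trans ?_ h2)
    rw [mul_comm D.numNodes, add_mul (70 + p.eval (5 * sizeBound.eval (2 ^ t * n) + 6)) _
      D.numNodes]
    -- The work outside the traversal is done only once; since there is at least one node, it may be
    -- charged to the factor `D.numNodes`.
    refine le_trans ?_ (Nat.add_le_add_left (Nat.le_mul_of_pos_right _ (one_le_numNodes D)) _)
    generalize (70 + p.eval (5 * sizeBound.eval (2 ^ t * n) + 6)) * D.numNodes = A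
    omega
  · rw [v₅]
    have := lightTest_iff hD hr ℓ f (d := (digitBound (context G Q r)).length) hlen.ge
    rw [← this]
    dsimp only
    rw [← hℓ', ← hf']
    cases lightTest (setList Q) ℓ' f' (table G Q r D) <;> simp

theorem mainTheorem5 :
    (∃ (P : Cmd) (C : ℕ), ∀ (n t : ℕ) (G : SimpleGraph (Fin n)) (K : Finset (Fin n)) (ℓ f : ℤ)
      (D : BagTree (Fin n)), IsNiceTreeDecomposition G D → D.WidthLE t →
      (∃ r ∈ K, D.RootForgets r) →
      P.DecidesWithin
        (Datum.ofList [Datum.ofGraph G, Datum.ofSet K, Datum.ofInt ℓ, Datum.ofInt f,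
          Datum.ofBagTree D])
        (LightConnectingInducedSubgraph G K ℓ f)
        (C * 2 ^ (C * t) * n ^ C * D.numNodes)) ∧
    (∃ (P : Cmd) (C : ℕ), ∀ (n t : ℕ) (G : SimpleGraph (Fin n)) (K : Finset (Fin n))
      (D : BagTree (Fin n)), IsNiceTreeDecomposition G D → D.WidthLE t →
      (∃ r ∈ K, D.RootForgets r) →
      P.DecidesWithin
        (Datum.ofList [Datum.ofGraph G, Datum.ofSet K, Datum.ofBagTree D])
        (KInATree G K)
        (C * 2 ^ (C * t) * n ^ C * D.numNodes)) := by
  exact ⟨exists_light_program, exists_tree_program⟩
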